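/- An election consists of a finite set of candidates $C$ and a finite collection of voters $V$, each of whom has a vote, that is, a strict total order on $C$. Under the scoring rule First-Last, each vote gives $1$ point to the candidate ranked first, $-1$ point to the candidate ranked last and $0$ points to every other candidate (scoring vector $\langle 1,0,\dots,0,-1\rangle$), and the winners are the candidates with the highest total score. Consider the following decision problems. - **First-Last Conformant Manipulation.** Given: an election $(C,V)$, a collection $W$ of manipulators, and a preferred candidate $p\in C$. Question: can the votes of all the manipulators in $W$ be set, using only votes that occur in $V$ (repetition allowed), such that $p$ is a First-Last winner of $(C,V\cup W)$? - **First-Last Conformant Bribery.** Given: an election $(C,V)$, a bribe limit $k\in\mathbb{N}$, and a preferred candidate $p\in C$. Question: can the votes of at most $k$ voters in $V$ be changed to votes that occur in $V$ (before any change) such that $p$ is a First-Last winner? - **Exact Perfect Bipartite Matching.** Given: a bipartite graph $G=(A\cup B,E)$ with sides $A$ and $B$, a set $E'\subseteq E$ of red edges, and an integer $k\ge 0$. Question: does $G$ have a perfect matching that contains exactly $k$ edges from $E'$? Voters and manipulators are listed individually, so their numbers count towards the input size; the numbers $k$ are written in binary. A problem $X$ disjunctively truth-table (dtt) reduces to a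 problem $Y$ if there is a polynomial-time computable function that maps every instance $x$ of $X$ to a finite list of instances of $Y$ such that $x$ is a yes-instance of $X$ if and only if at least one instance in the list is a yes-instance of $Y$. Two problems are dtt equivalent if each dtt reduces to the other. **Theorem.** First-Last Conformant Manipulation is dtt equivalent to Exact Perfect Bipartite Matching, and First-Last Conformant Bribery is dtt equivalent to Exact Perfect Bipartite Matching. -/

import Mathlib

namespace ConformantVoting

open Computability

/-! ### Elections and voting rules -/

/-- A vote over the candidates `Fin m`: a strict total order, given as the ranking that sends each
position (`0` is the most preferred one) to the candidate in that position. -/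
abbrev Vote (m : ℕ) : Type := Equiv.Perm (Fin m)

/-- An election together with a preferred candidate: `m` candidates, and `n` voters who are listed
one by one with their votes. -/
structure Election where
  /-- the number of candidates -/
  m : ℕ
  /-- the number of voters -/
  n : ℕ
  /-- the votes of the voters -/
  vote : Fin n → Vote m
  /-- the preferred candidate -/
  p : Fin m

/-- A voting rule maps every election to its set of winners. -/
abbrev VotingRule : Type := (m n : ℕ) → (Fin n → Vote m) → Set (Fin m)

/-- The score of candidate `c` when the candidate in position `i` of a vote gets `a i` points. -/
def score {m n : ℕ} (a : Fin m → ℤ) (V : Fin n → Vote m) (c : Fin m) : ℤ :=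
  ∑ v, a ((V v).symm c)

/-- The voting rule of a family of scoring vectors: the candidates with the highest score win. -/
def scoringRule (a : (m : ℕ) → Fin m → ℤ) : VotingRule :=
  fun m _ V => {c | ∀ d, score (a m) V d ≤ score (a m) V c}

/-- The scoring vector `⟨1, 0, …, 0, -1⟩`. -/
def firstLastVector (m : ℕ) (i : Fin m) : ℤ :=
  (if (i : ℕ) = 0 then 1 else 0) - (if (i : ℕ) + 1 = m then 1 else 0)

/-- The voting rule first-last. -/
def firstLast : VotingRule := scoringRule firstLastVector

/-! ### Encodings as strings

The names of candidates and vertices, the number of objects that are part of the input, and the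
number of manipulators (a collection of voters) are written in unary; the integer `k` of the
bribery and the matching problem is written in binary. -/

/-- The unary encoding of a number, followed by a comma. -/
def encodeUnary (n : ℕ) : List Γ' := List.replicate n (Γ'.bit true) ++ [Γ'.comma]

/-- The binary encoding of a number (least significant bit first), followed by a comma. -/
def encodeBinary (n : ℕ) : List Γ' := (encodeNat n).map Γ'.bit ++ [Γ'.comma]

/-- The concatenation of `n` strings. -/
def concat {n : ℕ} (s : Fin n → List Γ') : List Γ' := (List.ofFn s).flatten

/-- A vote is encoded by the list of its candidates, from the first one to the last one. -/
def encodeVote {m : ℕ} (v : Vote m) : List Γ' :=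
  Γ'.bra :: (concat (fun i => encodeUnary (v i)) ++ [Γ'.ket])

/-- The encoding of an election with its preferred candidate. -/
def encodeElection (E : Election) : List Γ' :=
  encodeUnary E.m ++ (encodeUnary E.n ++ (encodeUnary E.p ++ concat fun v => encodeVote (E.vote v)))

theorem encodeUnary_append_inj {a b : ℕ} {x y : List Γ'}
    (h : encodeUnary a ++ x = encodeUnary b ++ y) : a = b ∧ x = y := by
  induction a generalizing b with
  | zero =>
    cases b with
    | zero => simpa [encodeUnary] using h
    | succ b => simp [encodeUnary, List.replicate_succ] at h
  | succ a ih =>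
    cases b with
    | zero => simp [encodeUnary, List.replicate_succ] at h
    | succ b =>
      have := @ih b (by simpa [encodeUnary, List.replicate_succ] using h)
      exact ⟨by rw [this.1], this.2⟩

theorem map_bit_append_inj {a b : List Bool} {x y : List Γ'}
    (h : a.map Γ'.bit ++ ([Γ'.comma] ++ x) = b.map Γ'.bit ++ ([Γ'.comma] ++ y)) :
    a = b ∧ x = y := by
  induction a generalizing b with
  | nil =>
    cases b with
    | nil => simpa using h
    | cons c b => simp at h
  | cons d a ih =>
    cases b with
    | nil => simp at h
    | cons c b =>
      simp only [List.map_cons, List.cons_append, List.cons.injEq, Γ'.bit.injEq] at h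
      have := ih h.2
      exact ⟨by rw [h.1, this.1], this.2⟩

theorem encodeBinary_append_inj {a b : ℕ} {x y : List Γ'}
    (h : encodeBinary a ++ x = encodeBinary b ++ y) : a = b ∧ x = y := by
  simp only [encodeBinary, List.append_assoc] at h
  obtain ⟨h1, h2⟩ := map_bit_append_inj h
  exact ⟨by rw [← decode_encodeNat a, h1, decode_encodeNat], h2⟩

theorem concat_append_inj {α : Type} {e : α → List Γ'}
    (he : ∀ {a b : α} {x y : List Γ'}, e a ++ x = e b ++ y → a = b ∧ x = y) {n : ℕ}
    {s t : Fin n → α} {x y : List Γ'}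
    (h : concat (fun i => e (s i)) ++ x = concat (fun i => e (t i)) ++ y) : s = t ∧ x = y := by
  induction n with
  | zero => exact ⟨Subsingleton.elim _ _, by simpa [concat] using h⟩
  | succ n ih =>
    simp only [concat, List.ofFn_succ, List.flatten_cons, List.append_assoc] at h
    obtain ⟨h0, h1⟩ := he h
    obtain ⟨h2, h3⟩ := @ih (fun i => s i.succ) (fun i => t i.succ) h1
    refine ⟨funext fun i => ?_, h3⟩
    cases i using Fin.cases with
    | zero => exact h0
    | succ i => exact congrFun h2 i

theorem encodeVote_append_inj {m : ℕ} {v w : Vote m} {x y : List Γ'}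
    (h : encodeVote v ++ x = encodeVote w ++ y) : v = w ∧ x = y := by
  simp only [encodeVote, List.cons_append, List.append_assoc, List.cons.injEq, true_and] at h
  obtain ⟨h1, h2⟩ := concat_append_inj (e := encodeUnary) encodeUnary_append_inj h
  exact ⟨Equiv.ext fun i => Fin.ext (congrFun h1 i), by simpa using h2⟩

theorem encodeElection_injective : Function.Injective encodeElection := by
  rintro ⟨m, n, v, p⟩ ⟨m', n', v', p'⟩ h
  obtain ⟨h1, h⟩ := encodeUnary_append_inj h
  obtain ⟨h2, h⟩ := encodeUnary_append_inj h
  obtain ⟨h3, h⟩ := encodeUnary_append_inj h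
  dsimp only at h1 h2
  subst h1 h2
  have h4 := concat_append_inj (x := []) (y := []) encodeVote_append_inj (by simpa using h)
  have h5 : p = p' := Fin.ext h3
  rw [h4.1, h5]

/-! ### Decision problems and polynomial-time disjunctive truth-table reductions -/

/-- A decision problem: a type of instances, an encoding of the instances as strings, and the set
of yes-instances. -/
structure DecisionProblem where
  /-- the instances -/
  Instance : Type
  /-- the string that encodes an instance -/
  encode : Instance → List Γ'
  /-- different instances have different encodings -/
  encode_injective : Function.Injective encode
  /-- the yes-instances -/
  Yes : Instance → Prop

/-- The encoding of a finite list of instances: each of them is followed by the end mark `none`. -/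
def DecisionProblem.encodeList (B : DecisionProblem) (l : List B.Instance) :
    List (Option Γ') :=
  (l.map fun y => (B.encode y).map some ++ [none]).flatten

/-- `A` disjunctively truth-table reduces to `B` in polynomial time: a polynomial-time computable
function maps every instance `x` of `A` to a finite list of instances of `B` such that `x` is a
yes-instance if and only if at least one member of the list is. -/
def DTTReducible (A B : DecisionProblem) : Prop :=
  ∃ f : A.Instance → List B.Instance,
    Nonempty (Turing.TM2ComputableInPolyTime A.encode B.encodeList f) ∧
    ∀ x, A.Yes x ↔ ∃ y ∈ f x, B.Yes y

/-- Equivalence under polynomial-time disjunctive truth-table reductions. -/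
def DTTEquivalent (A B : DecisionProblem) : Prop :=
  DTTReducible A B ∧ DTTReducible B A

/-! ### Conformant manipulation -/

/-- An instance of conformant manipulation: an election with a preferred candidate, and the
number `w` of manipulators. -/
structure ManipulationInstance where
  /-- the election of the nonmanipulators and the preferred candidate -/
  election : Election
  /-- the number of manipulators -/
  w : ℕ

/-- The manipulators can vote, using only votes of nonmanipulators, such that `p` is a winner of
the election with all voters. -/
def CanManipulate (R : VotingRule) (I : ManipulationInstance) : Prop :=
  ∃ W : Fin I.w → Vote I.election.m,
    (∀ i, ∃ v, W i = I.election.vote v) ∧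
    I.election.p ∈ R I.election.m (I.election.n + I.w) (Fin.append I.election.vote W)

/-- `R`-Conformant Manipulation. -/
def conformantManipulation (R : VotingRule) : DecisionProblem where
  Instance := ManipulationInstance
  encode I := encodeUnary I.w ++ encodeElection I.election
  encode_injective := by
    rintro ⟨E, w⟩ ⟨E', w'⟩ h
    obtain ⟨h1, h2⟩ := encodeUnary_append_inj h
    have h3 := encodeElection_injective h2
    dsimp only at h1 h3
    rw [h1, h3]
  Yes := CanManipulate R

/-! ### Conformant bribery -/

/-- An instance of conformant bribery: an election with a preferred candidate, and the bribe
limit `k`. -/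
structure BriberyInstance where
  /-- the election and the preferred candidate -/
  election : Election
  /-- the bribe limit -/
  k : ℕ

/-- The votes of at most `k` voters can be changed to votes of the initial election such that `p`
is a winner. -/
def CanBribe (R : VotingRule) (I : BriberyInstance) : Prop :=
  ∃ (S : Finset (Fin I.election.n)) (V : Fin I.election.n → Vote I.election.m),
    S.card ≤ I.k ∧
    (∀ i ∈ S, ∃ v, V i = I.election.vote v) ∧
    (∀ i ∉ S, V i = I.election.vote i) ∧
    I.election.p ∈ R I.election.m I.election.n V

/-- `R`-Conformant Bribery. -/
def conformantBribery (R : VotingRule) : DecisionProblem where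
  Instance := BriberyInstance
  encode I := encodeBinary I.k ++ encodeElection I.election
  encode_injective := by
    rintro ⟨E, k⟩ ⟨E', k'⟩ h
    obtain ⟨h1, h2⟩ := encodeBinary_append_inj h
    have h3 := encodeElection_injective h2
    dsimp only at h1 h3
    rw [h1, h3]
  Yes := CanBribe R

/-! ### Exact perfect bipartite matching -/

/-- A bipartite graph with sides `Fin a` and `Fin b`, a set of red edges, and an integer `k`. -/
structure MatchingInstance where
  /-- the number of vertices on the left side -/
  a : ℕ
  /-- the number of vertices on the right side -/
  b : ℕ
  /-- the edges -/
  edges : Finset (Fin a × Fin b)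
  /-- the red edges -/
  red : Finset (Fin a × Fin b)
  red_subset : red ⊆ edges
  /-- the required number of red edges -/
  k : ℕ

/-- The set `M` of edges is a perfect matching: every vertex, on either side, is an endpoint of
exactly one edge in `M`. -/
def IsPerfectMatching (I : MatchingInstance) (M : Finset (Fin I.a × Fin I.b)) : Prop :=
  M ⊆ I.edges ∧ (∀ i, ∃! e, e ∈ M ∧ e.1 = i) ∧ (∀ j, ∃! e, e ∈ M ∧ e.2 = j)

/-- The graph has a perfect matching with exactly `k` red edges. -/
def HasExactMatching (I : MatchingInstance) : Prop :=
  ∃ M, IsPerfectMatching I M ∧ (M ∩ I.red).card = I.k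

/-- The entry of the adjacency matrix for a pair of vertices from the two sides. -/
def encodePair (isEdge isRed : Bool) : List Γ' :=
  [if isRed then Γ'.bit true else if isEdge then Γ'.bit false else Γ'.blank]

/-- The encoding of a matching instance: `k`, the sizes of the two sides, and the rows of the
bipartite adjacency matrix. -/
def encodeMatching (I : MatchingInstance) : List Γ' :=
  encodeBinary I.k ++ (encodeUnary I.a ++ (encodeUnary I.b ++
    concat fun i => Γ'.bra ::
      (concat (fun j => encodePair (decide ((i, j) ∈ I.edges)) (decide ((i, j) ∈ I.red))) ++
        [Γ'.ket])))

theorem encodeMatching_injective : Function.Injective encodeMatching := by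
  rintro ⟨a, b, G, R, hR, k⟩ ⟨a', b', G', R', hR', k'⟩ h
  obtain ⟨h1, h⟩ := encodeBinary_append_inj h
  obtain ⟨h2, h⟩ := encodeUnary_append_inj h
  obtain ⟨h3, h⟩ := encodeUnary_append_inj h
  dsimp only at h1 h2 h3
  subst h1 h2 h3
  let row : (Fin b → Γ') → List Γ' := fun s => Γ'.bra :: (concat (fun j => [s j]) ++ [Γ'.ket])
  have hrow : ∀ {s t : Fin b → Γ'} {x y : List Γ'}, row s ++ x = row t ++ y → s = t ∧ x = y := by
    intro s t x y hst
    simp only [row, List.cons_append, List.append_assoc, List.cons.injEq, true_and] at hst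
    obtain ⟨p, q⟩ := concat_append_inj (e := fun c : Γ' => [c]) (by simp) hst
    exact ⟨p, by simpa using q⟩
  have key := (concat_append_inj (e := row) (x := []) (y := []) hrow
    (s := fun i j => if decide ((i, j) ∈ R) = true then Γ'.bit true
      else if decide ((i, j) ∈ G) = true then Γ'.bit false else Γ'.blank)
    (t := fun i j => if decide ((i, j) ∈ R') = true then Γ'.bit true
      else if decide ((i, j) ∈ G') = true then Γ'.bit false else Γ'.blank)
    (by simpa [row, encodePair] using h)).1
  have hp : ∀ x : Fin a × Fin b, (x ∈ R ↔ x ∈ R') ∧ (x ∈ G ↔ x ∈ G') := by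
    rintro ⟨i, j⟩
    have hk := congrFun (congrFun key i) j
    have e1 := @hR (i, j)
    have e2 := @hR' (i, j)
    clear key hrow h row
    by_cases q1 : (i, j) ∈ R <;> by_cases q2 : (i, j) ∈ R' <;> by_cases q3 : (i, j) ∈ G <;>
      by_cases q4 : (i, j) ∈ G' <;> simp [q1, q2, q3, q4] at hk e1 e2 ⊢
  have hRR : R = R' := Finset.ext fun x => (hp x).1
  have hGG : G = G' := Finset.ext fun x => (hp x).2
  subst hRR hGG
  rfl

/-- Exact Perfect Bipartite Matching. -/
def exactPerfectBipartiteMatching : DecisionProblem where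
  Instance := MatchingInstance
  encode := encodeMatching
  encode_injective := encodeMatching_injective
  Yes := HasExactMatching

end ConformantVoting

/-! Only the first candidate `f` and the last candidate `l` of a vote matter, so a vote is an arc
from `f` to `l`, and the score of a candidate is its out-degree minus its in-degree. All scores
together sum to zero, so a winner has a score `T` between `0` and the number of voters. The
reductions to matching try every such `T`. They then ask for votes with which `p` scores exactly `T`
and every other candidate at most `T`, a flow problem that perfect matchings can express.

In the graph (`VoteGraph.entry`) both sides have the same vertices, and a perfect matching is a
permutation. A vote is a detour: a row of its first candidate is matched to the vertex of the vote,
and the vote's own row is matched to a unit column of its last candidate. Vertices matched to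
themselves stand for votes that are not cast. Counting the rows and columns of a candidate `c` shows
that its score is `T` minus the number of slack columns matched to its rows; `p` may use no slack
column (`exists_total`, `exists_perm`). Each vote that a voter gives up costs one red edge, and each
new vote costs `r` red edges, where `r` is the length of its chain (`card_red`). For manipulation,
giving up votes is forbidden and `r = 1`, so the red edges count the new votes. For bribery with `K`
bribes, `r = n + 1` and `K * (n + 2)` red edges are required, which forces both the number of votes
given up and the number of new votes to be `K`. All `K ≤ min n k` are tried.

In the other direction, let the graph have `n` vertices on each side. If it has unequal sides, or if
`k > n`, then there is no suitable matching and the empty list is produced. Otherwise an edge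
becomes an arc from its left to its right vertex, and a red edge becomes two arcs through a middle
vertex. A long path back to the left vertex closes these arcs to a cycle, so the votes become
available without changing any score. One further long path from the right vertex `i` to the left
vertex `i`, for each `i`, gives every right candidate a surplus and every left candidate a deficit
of one point. The preferred candidate is on no arc, so it wins exactly if the new votes make all
scores zero (`score_eq_zero`). With `n + k ≤ 2 * n` new votes a potential argument excludes all arcs
of the long paths (`card_first_lt`). Hence the new votes form a perfect matching, and their number
`n + k` says that it has `k` red edges (`balanced_iff`). For bribery, `n + k` voters who rank `p`
last are added, and exactly these have to be bribed.

Polynomial time is certified once for a small language. Its number terms have unary values, so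
bounded sums and loops take polynomial time, and its programs emit strings. Both are compiled to
programs on stacks and then to multi-stack Turing machines. The binary number `k` is compared digit
by digit with small numbers and is converted to unary only after it is known to be small. -/

namespace ConformantVoting

open Computability

/-! ### Structured programs on stacks -/

/-- The stack symbols of structured programs. The symbol `none` serves as the unit of unary
counters and as the end mark of the output. -/
abbrev Sym : Type := Option Γ'

open Turing

/-- The contents of the stacks of a structured program. -/
abbrev Stacks : Type := ℕ → List Sym

/-- Structured programs on stacks. -/
inductive StackProgram : Type
  | push (k : ℕ) (a : Sym)
  | pop (k : ℕ)
  | seq (P Q : StackProgram)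
  | case (k : ℕ) (f : Option Sym → StackProgram)
  | loop (k : ℕ) (f : Sym → StackProgram)

namespace StackProgram

/-- Big-step semantics with running times. The program `loop k f` pops the symbols `a` of the stack
`k` until it is empty, and runs `f a` for each of them. -/
inductive Runs : StackProgram → Stacks → Stacks → ℕ → Prop
  | push (k a s) : Runs (push k a) s (Function.update s k (a :: s k)) 1
  | pop (k s) : Runs (pop k) s (Function.update s k (s k).tail) 1
  | seq {P Q s s' s'' m n} : Runs P s s' m → Runs Q s' s'' n → Runs (seq P Q) s s'' (m + n)
  | case {k f s s' n} : Runs (f (s k).head?) s s' n → Runs (case k f) s s' (n + 1)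
  | loop_nil {k f s} : s k = [] → Runs (loop k f) s s 1
  | loop_cons {k f s s' s'' a l m n} : s k = a :: l → Runs (f a) (Function.update s k l) s' m →
      Runs (loop k f) s' s'' n → Runs (loop k f) s s'' (m + n + 1)

/-- All stacks used by the program have indices at most `N`. -/
def BoundedBy (N : ℕ) : StackProgram → Prop
  | push k _ => k ≤ N
  | pop k => k ≤ N
  | seq P Q => BoundedBy N P ∧ BoundedBy N Q
  | case k f => k ≤ N ∧ ∀ o, BoundedBy N (f o)
  | loop k f => k ≤ N ∧ ∀ a, BoundedBy N (f a)

theorem BoundedBy.mono {N N' : ℕ} (h : N ≤ N') : ∀ {P : StackProgram}, BoundedBy N P → BoundedBy N' P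
  | push _ _, hP => le_trans hP h
  | pop _, hP => le_trans hP h
  | seq _ _, hP => ⟨hP.1.mono h, hP.2.mono h⟩
  | case _ _, hP => ⟨hP.1.trans h, fun o => (hP.2 o).mono h⟩
  | loop _ _, hP => ⟨hP.1.trans h, fun o => (hP.2 o).mono h⟩

/-- Branching is over a finite alphabet, so a program mentions finitely many stacks, and a machine
with finitely many stacks can run it. -/
theorem exists_boundedBy (P : StackProgram) : ∃ N, BoundedBy N P := by
  induction P with
  | push k _ => exact ⟨k, le_rfl⟩
  | pop k => exact ⟨k, le_rfl⟩
  | seq P Q hP hQ =>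
    obtain ⟨N, hN⟩ := hP
    obtain ⟨N', hN'⟩ := hQ
    exact ⟨max N N', hN.mono (le_max_left _ _), hN'.mono (le_max_right _ _)⟩
  | case k f ih =>
    choose N hN using ih
    exact ⟨max k (Finset.univ.sup N), le_max_left _ _, fun o =>
      (hN o).mono (le_max_of_le_right (Finset.le_sup (Finset.mem_univ o)))⟩
  | loop k f ih =>
    choose N hN using ih
    exact ⟨max k (Finset.univ.sup N), le_max_left _ _, fun o =>
      (hN o).mono (le_max_of_le_right (Finset.le_sup (Finset.mem_univ o)))⟩

/-! ### Compilation to multi-stack Turing machines -/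

/-- The labels of the Turing machine code of a program. -/
def Label : StackProgram → Type
  | push _ _ => Unit
  | pop _ => Unit
  | seq P Q => Label P ⊕ Label Q
  | case _ f => Option (Σ o, Label (f o))
  | loop _ f => Option (Σ a, Label (f a))

instance fintypeLabel : (P : StackProgram) → Fintype (Label P)
  | push _ _ => inferInstanceAs (Fintype Unit)
  | pop _ => inferInstanceAs (Fintype Unit)
  | seq P Q =>
    letI := fintypeLabel P
    letI := fintypeLabel Q
    inferInstanceAs (Fintype (Label P ⊕ Label Q))
  | case _ f =>
    letI := fun o => fintypeLabel (f o)
    inferInstanceAs (Fintype (Option (Σ o, Label (f o))))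
  | loop _ f =>
    letI := fun o => fintypeLabel (f o)
    inferInstanceAs (Fintype (Option (Σ o, Label (f o))))

/-- The first label of the code of a program. -/
def entry : (P : StackProgram) → Label P
  | push _ _ => ()
  | pop _ => ()
  | seq P _ => Sum.inl (entry P)
  | case _ _ => none
  | loop _ _ => none

/-- The alphabets of the stacks of the Turing machine: an input stack, and the stacks of the
program. -/
abbrev Alphabet (N : ℕ) : Option (Fin (N + 1)) → Type
  | none => Γ'
  | some _ => Sym

/-- The Turing machine stack for a stack of the program. -/
abbrev stackIndex (N k : ℕ) : Option (Fin (N + 1)) := some (Fin.ofNat (N + 1) k)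

/-- The Turing machine code of a program: `ι` places its labels among all labels, and `next` is the
label to continue with. -/
def code (N : ℕ) {Λ : Type} :
    (P : StackProgram) → (Label P → Λ) → Λ → Label P → TM2.Stmt (Alphabet N) Λ (Option Sym)
  | push k a, _, next, _ => .push (stackIndex N k) (fun _ => a) (.goto fun _ => next)
  | pop k, _, next, _ => .pop (stackIndex N k) (fun v _ => v) (.goto fun _ => next)
  | seq P Q, ι, next, l =>
    match l with
    | Sum.inl l => code N P (fun l => ι (Sum.inl l)) (ι (Sum.inr (entry Q))) l
    | Sum.inr l => code N Q (fun l => ι (Sum.inr l)) next l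
  | case k f, ι, next, l =>
    match l with
    | none => .peek (stackIndex N k) (fun _ o => o) (.goto fun o => ι (some ⟨o, entry (f o)⟩))
    | some ⟨o, l⟩ => code N (f o) (fun l => ι (some ⟨o, l⟩)) next l
  | loop k f, ι, next, l =>
    match l with
    | none => .pop (stackIndex N k) (fun _ o => o) (.goto fun o =>
        match o with
        | none => next
        | some a => ι (some ⟨a, entry (f a)⟩))
    | some ⟨o, l⟩ => code N (f o) (fun l => ι (some ⟨o, l⟩)) (ι none) l

/-- The stacks of the Turing machine. -/
def machineStacks (N : ℕ) (x : List Γ') (s : Stacks) : (k : Option (Fin (N + 1))) →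
    List (Alphabet N k)
  | none => x
  | some i => s i

/-- `stackIndex` reduces modulo `N + 1`; the bound on `k` prevents two stacks from being identified.
-/
theorem machineStacks_stackIndex {N k : ℕ} (hk : k ≤ N) (x : List Γ') (s : Stacks) :
    machineStacks N x s (stackIndex N k) = s k := by
  simp [machineStacks, stackIndex, Nat.mod_eq_of_lt (Nat.lt_succ_of_le hk)]

theorem update_machineStacks {N k : ℕ} (hk : k ≤ N) (x : List Γ') (s : Stacks) (l : List Sym) :
    Function.update (machineStacks N x s) (stackIndex N k) l =
      machineStacks N x (Function.update s k l) := by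
  funext i
  rcases i with _ | i
  · simp [stackIndex, machineStacks]
  · have h : stackIndex N k = some i ↔ (i : ℕ) = k := by
      simp only [stackIndex, Option.some.injEq, Fin.ext_iff, Fin.val_ofNat,
        Nat.mod_eq_of_lt (Nat.lt_succ_of_le hk)]
      exact eq_comm
    by_cases hi : (i : ℕ) = k
    · have := h.2 hi
      rw [← this, Function.update_self]
      simp [stackIndex, machineStacks, Nat.mod_eq_of_lt (Nat.lt_succ_of_le hk)]
    · rw [Function.update_of_ne (fun e => hi (h.1 e.symm))]
      simp [machineStacks, hi]

/-- A machine takes `n` steps from a configuration to another one. -/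
def Steps {K : Type} [DecidableEq K] {Γ : K → Type} {Λ σ : Type} (M : Λ → TM2.Stmt Γ Λ σ) (n : ℕ)
    (c c' : TM2.Cfg Γ Λ σ) : Prop :=
  (flip bind (TM2.step M))^[n] (some c) = some c'

section Steps

variable {K : Type} [DecidableEq K] {Γ : K → Type} {Λ σ : Type} {M : Λ → TM2.Stmt Γ Λ σ}

theorem Steps.trans {m n : ℕ} {c c' c'' : TM2.Cfg Γ Λ σ} (h : Steps M m c c')
    (h' : Steps M n c' c'') : Steps M (m + n) c c'' := by
  unfold Steps at *
  rw [add_comm, Function.iterate_add_apply, h, h']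

theorem Steps.comm {m n : ℕ} {c c' : TM2.Cfg Γ Λ σ} (h : Steps M (m + n) c c') :
    Steps M (n + m) c c' := by
  rwa [add_comm]

theorem Steps.single {c c' : TM2.Cfg Γ Λ σ} (h : TM2.step M c = some c') : Steps M 1 c c' := h

end Steps

/-- The number of steps is preserved exactly, because each primitive and each test of a `case` or
`loop` is one machine step. The placement of the labels and the continuation vary in the induction:
the body of a loop continues at the head of the loop. The internal state on entry is arbitrary,
since every test overwrites it before branching on it. -/
theorem Runs.steps {N : ℕ} {Λ : Type} {M : Λ → TM2.Stmt (Alphabet N) Λ (Option Sym)}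
    {P : StackProgram} {s s' : Stacks} {n : ℕ} (h : Runs P s s' n) (hP : P.BoundedBy N)
    (ι : Label P → Λ) (next : Λ) (hM : ∀ l, M (ι l) = code N P ι next l) (x : List Γ')
    (v : Option Sym) :
    ∃ v', Steps M n ⟨some (ι (entry P)), v, machineStacks N x s⟩
      ⟨some next, v', machineStacks N x s'⟩ := by
  induction h generalizing next v with
  | push k a s =>
    refine ⟨v, Steps.single ?_⟩
    simp only [TM2.step, hM]
    simp only [code, TM2.stepAux]
    rw [machineStacks_stackIndex hP, update_machineStacks hP]
  | pop k s =>
    refine ⟨v, Steps.single ?_⟩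
    simp only [TM2.step, hM]
    simp only [code, TM2.stepAux]
    rw [machineStacks_stackIndex hP, update_machineStacks hP]
  | @seq P Q s s' s'' m n _ _ ihP ihQ =>
    obtain ⟨v', h'⟩ := ihP hP.1 (fun l => ι (Sum.inl l)) (ι (Sum.inr (entry Q)))
      (fun l => hM (Sum.inl l)) v
    obtain ⟨v'', h''⟩ := ihQ hP.2 (fun l => ι (Sum.inr l)) next (fun l => hM (Sum.inr l)) v'
    exact ⟨v'', h'.trans h''⟩
  | @case k f s s' n _ ih =>
    obtain ⟨v', h'⟩ := ih (hP.2 _) (fun l => ι (some ⟨_, l⟩)) next (fun l => hM (some ⟨_, l⟩))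
      (s k).head?
    refine ⟨v', ?_⟩
    refine (Steps.trans (Steps.single ?_) h').comm
    simp only [TM2.step, hM]
    simp only [code, entry, TM2.stepAux]
    rw [machineStacks_stackIndex hP.1]
  | @loop_nil k f s hs =>
    refine ⟨none, Steps.single ?_⟩
    simp only [TM2.step, hM]
    simp only [code, entry, TM2.stepAux]
    rw [machineStacks_stackIndex hP.1, update_machineStacks hP.1, hs]
    simp only [List.head?_nil, List.tail_nil, Option.some.injEq]
    rw [← hs, Function.update_eq_self]
  | @loop_cons k f s s' s'' a l m n hs _ _ ih ih' =>
    obtain ⟨v', h'⟩ := ih (hP.2 _) (fun l => ι (some ⟨_, l⟩)) (ι none)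
      (fun l => hM (some ⟨_, l⟩)) (some a)
    obtain ⟨v'', h''⟩ := ih' hP ι next hM v'
    refine ⟨v'', ?_⟩
    refine (Steps.trans (Steps.single ?_) (h'.trans h'')).comm
    simp only [TM2.step, hM]
    simp only [code, entry, TM2.stepAux]
    rw [machineStacks_stackIndex hP.1, update_machineStacks hP.1, hs]
    simp

/-- The labels of the machine of a program: a loop that moves the input to a stack of the program,
the code of the program, and the end. -/
inductive MachineLabel (P : StackProgram) : Type
  | read
  | move (a : Γ')
  | run (l : Label P)
  | done

instance fintypeMachineLabel (P : StackProgram) : Fintype (MachineLabel P) :=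
  Fintype.ofEquiv (Option Γ' ⊕ Option (Label P))
    { toFun := fun l => match l with
        | Sum.inl none => .read
        | Sum.inl (some a) => .move a
        | Sum.inr none => .done
        | Sum.inr (some l) => .run l
      invFun := fun l => match l with
        | .read => Sum.inl none
        | .move a => Sum.inl (some a)
        | .done => Sum.inr none
        | .run l => Sum.inr (some l)
      left_inv := by rintro ((_ | _) | (_ | _)) <;> rfl
      right_inv := by rintro (_ | _ | _ | _) <;> rfl }

/-- The Turing machine of a program: it moves the input to the stack `0`, runs the program, and
halts. -/
def machineCode (N : ℕ) (P : StackProgram) :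
    MachineLabel P → TM2.Stmt (Alphabet N) (MachineLabel P) (Option Sym)
  | .read => .pop none (fun _ (o : Option Γ') => o.map some) (.goto fun o =>
      match o with
      | some (some a) => .move a
      | _ => .run (entry P))
  | .move a => .push (stackIndex N 0) (fun _ => some a) (.goto fun _ => .read)
  | .run l => code N P .run .done l
  | .done => .load (fun _ => none) .halt

/-- A symbol costs two steps, a pop into the internal state and a push; one more step detects the
empty input. Moving from stack to stack reverses the input. -/
theorem steps_machineCode_read (N : ℕ) (P : StackProgram) (x : List Γ') (s : Stacks) (v : Option Sym) :
    Steps (machineCode N P) (2 * x.length + 1) ⟨some .read, v, machineStacks N x s⟩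
      ⟨some (.run (entry P)), none,
        machineStacks N [] (Function.update s 0 ((x.map some).reverse ++ s 0))⟩ := by
  have hu : ∀ (x y : List Γ') (s : Stacks), Function.update (machineStacks N x s) none y =
      machineStacks N y s := by
    intro x y s
    funext i
    rcases i with _ | i <;> simp [machineStacks]
  induction x generalizing s v with
  | nil =>
    refine Steps.single ?_
    simp only [TM2.step, machineCode, TM2.stepAux, hu]
    simp [machineStacks]
  | cons a x ih =>
    have h1 : Steps (machineCode N P) 1 ⟨some .read, v, machineStacks N (a :: x) s⟩
        ⟨some (.move a), some (some a), machineStacks N x s⟩ := by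
      refine Steps.single ?_
      simp only [TM2.step, machineCode, TM2.stepAux, hu]
      simp [machineStacks]
    have h2 : Steps (machineCode N P) 1 ⟨some (.move a), some (some a), machineStacks N x s⟩
        ⟨some .read, some (some a), machineStacks N x (Function.update s 0 (some a :: s 0))⟩ := by
      refine Steps.single ?_
      simp only [TM2.step, machineCode, TM2.stepAux]
      rw [machineStacks_stackIndex (Nat.zero_le _), update_machineStacks (Nat.zero_le _)]
    have h3 := (h1.trans h2).trans (ih (Function.update s 0 (some a :: s 0)) (some (some a)))
    simpa [add_comm, add_left_comm, mul_add, Nat.mul_succ] using h3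

/-- A function is computable in polynomial time if a structured program computes it: the program
finds the reversed input on the stack `0`, and leaves the output on the stack `1` and all other
stacks empty. -/
theorem nonempty_computableInPolyTime {α β : Type} {ea : α → List Γ'} {eb : β → List Sym}
    {f : α → β} (P : StackProgram) (q : Polynomial ℕ)
    (h : ∀ a, ∃ n ≤ q.eval (ea a).length,
      Runs P (Function.update (fun _ => []) 0 ((ea a).map some).reverse)
        (Function.update (fun _ => []) 1 (eb (f a))) n) :
    Nonempty (TM2ComputableInPolyTime ea eb f) := by
  obtain ⟨N, hN⟩ := exists_boundedBy P
  -- With the larger bound, the output stack `1` exists and does not wrap around to the stack `0`.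
  replace hN := hN.mono (Nat.le_succ N)
  have key : ∀ a, ∃ n ≤ (2 * Polynomial.X + 1 + q + 1 : Polynomial ℕ).eval (ea a).length,
      Steps (machineCode (N + 1) P) n
        ⟨some .read, none, machineStacks (N + 1) (ea a) fun _ => []⟩
        ⟨none, none, machineStacks (N + 1) [] (Function.update (fun _ => []) 1 (eb (f a)))⟩ := by
    intro a
    obtain ⟨n, hn, hr⟩ := h a
    have h1 := steps_machineCode_read (N + 1) P (ea a) (fun _ => []) none
    rw [List.append_nil] at h1
    obtain ⟨v, h2⟩ := hr.steps (M := machineCode (N + 1) P) hN .run .done (fun l => rfl) [] none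
    -- A final step resets the internal state, because the prescribed halting configuration contains
    -- the initial state.
    have h3 : Steps (machineCode (N + 1) P) 1 ⟨some .done, v, machineStacks (N + 1) []
        (Function.update (fun _ => []) 1 (eb (f a)))⟩ ⟨none, none, machineStacks (N + 1) []
        (Function.update (fun _ => []) 1 (eb (f a)))⟩ := Steps.single rfl
    refine ⟨_, ?_, (h1.trans h2).trans h3⟩
    simpa using hn
  choose n hn hs using key
  refine ⟨{
    tm := {
      K := Option (Fin (N + 2))
      k₀ := none
      k₁ := stackIndex (N + 1) 1
      Γ := Alphabet (N + 1)
      Λ := MachineLabel P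
      main := .read
      σ := Option Sym
      initialState := none
      Γk₀Fin := inferInstanceAs (Fintype Γ')
      m := machineCode (N + 1) P }
    inputAlphabet := Equiv.refl Γ'
    outputAlphabet := Equiv.refl Sym
    time := 2 * Polynomial.X + 1 + q + 1
    outputsFun := fun a => ⟨⟨n a, ?_⟩, hn a⟩ }⟩
  refine Eq.trans ?_ (Eq.trans (b := some _) (hs a) ?_)
  · refine congrArg (fun S : (k : _) → List (Alphabet (N + 1) k) =>
      (flip bind (TM2.step (machineCode (N + 1) P)))^[n a] (some ⟨some .read, none, S⟩))
      (funext fun i => ?_)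
    rcases i with _ | i
    · exact List.map_id _
    · rfl
  · refine congrArg (fun S : (k : _) → List (Alphabet (N + 1) k) =>
      some (⟨none, none, S⟩ : TM2.Cfg (Alphabet (N + 1)) (MachineLabel P) (Option Sym)))
      (funext fun i => ?_)
    rcases i with _ | i
    · simp [machineStacks, stackIndex]
    · by_cases hi : i = Fin.ofNat (N + 2) 1
      · subst hi
        simp [machineStacks, stackIndex]
      · have hi' : (i : ℕ) ≠ 1 := fun e => hi (Fin.ext (by simp [e]))
        simp only [machineStacks, ne_eq, hi', not_false_eq_true, Function.update_of_ne]
        split_ifs with e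
        · exact absurd (Option.some.inj e) hi
        · rfl

end StackProgram

/-! ### Running times of structured programs -/

namespace StackProgram

/-- The program runs from one state to another one in at most `C` steps. -/
def RunsIn (P : StackProgram) (s s' : Stacks) (C : ℕ) : Prop := ∃ n ≤ C, Runs P s s' n

/-- The program that does nothing. -/
def skip : StackProgram := seq (push 2 none) (pop 2)

/-- Remove all symbols from a stack. -/
def clear (k : ℕ) : StackProgram := loop k fun _ => skip

/-- Move all symbols from a stack to another one. -/
def move (k j : ℕ) : StackProgram := loop k fun a => push j a

theorem RunsIn.mono {P : StackProgram} {s s' : Stacks} {C C' : ℕ} (h : RunsIn P s s' C) (hC : C ≤ C') :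
    RunsIn P s s' C' := by
  obtain ⟨n, hn, h⟩ := h
  exact ⟨n, hn.trans hC, h⟩

theorem RunsIn.seq {P Q : StackProgram} {s s' s'' : Stacks} {C C' : ℕ} (h : RunsIn P s s' C)
    (h' : RunsIn Q s' s'' C') : RunsIn (seq P Q) s s'' (C + C') := by
  obtain ⟨n, hn, h⟩ := h
  obtain ⟨n', hn', h'⟩ := h'
  exact ⟨n + n', add_le_add hn hn', .seq h h'⟩

theorem runsIn_push (k : ℕ) (a : Sym) (s : Stacks) :
    RunsIn (push k a) s (Function.update s k (a :: s k)) 1 := ⟨1, le_rfl, .push ..⟩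

theorem runsIn_pop (k : ℕ) (s : Stacks) :
    RunsIn (pop k) s (Function.update s k (s k).tail) 1 := ⟨1, le_rfl, .pop ..⟩

theorem runsIn_skip (s : Stacks) : RunsIn skip s s 2 := by
  simpa [skip] using (runsIn_push 2 none s).seq (runsIn_pop 2 _)

theorem RunsIn.case {k : ℕ} {f : Option Sym → StackProgram} {s s' : Stacks} {C : ℕ}
    (h : RunsIn (f (s k).head?) s s' C) : RunsIn (case k f) s s' (C + 1) := by
  obtain ⟨n, hn, h⟩ := h
  exact ⟨n + 1, by omega, .case h⟩

/-- The invariant rule for loops: `S i` is the state after `i` iterations, and the body has to leave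
the rest of the stack `k` in place. The induction is on the number of remaining symbols, since
`Runs` unfolds a loop at its front. -/
theorem runsIn_loop {k : ℕ} {f : Sym → StackProgram} {C : ℕ} (S : ℕ → Stacks) {L : List Sym}
    (hk : ∀ i, S i k = L.drop i)
    (hf : ∀ i (h : i < L.length),
      RunsIn (f L[i]) (Function.update (S i) k (L.drop (i + 1))) (S (i + 1)) C) :
    RunsIn (loop k f) (S 0) (S L.length) (L.length * (C + 1) + 1) := by
  have key : ∀ j i, i + j = L.length → RunsIn (loop k f) (S i) (S L.length) (j * (C + 1) + 1) := by
    intro j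
    induction j with
    | zero =>
      intro i hi
      obtain rfl : i = L.length := by omega
      exact ⟨1, by omega, .loop_nil (by simp [hk])⟩
    | succ j ih =>
      intro i hi
      have h : i < L.length := by omega
      obtain ⟨n, hn, h1⟩ := hf i h
      obtain ⟨n', hn', h2⟩ := ih (i + 1) (by omega)
      refine ⟨n + n' + 1, ?_, .loop_cons ?_ h1 h2⟩
      · rw [Nat.succ_mul]
        omega
      · rw [hk, List.drop_eq_getElem_cons h]
  exact key _ 0 (by omega)

theorem runsIn_loop_units {k : ℕ} {f : Sym → StackProgram} {C : ℕ} (S : ℕ → Stacks) {n : ℕ}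
    (hk : ∀ i ≤ n, S i k = List.replicate (n - i) none)
    (hf : ∀ i < n, RunsIn (f none)
      (Function.update (S i) k (List.replicate (n - (i + 1)) none)) (S (i + 1)) C) :
    RunsIn (loop k f) (S 0) (S n) (n * (C + 1) + 1) := by
  have h := runsIn_loop (k := k) (f := f) (C := C)
    -- The states beyond `n` are not constrained by the hypotheses; empty stacks satisfy the general
    -- rule there.
    (fun i => if i ≤ n then S i else fun _ => []) (L := List.replicate n none)
    (fun i => by
      by_cases hi : i ≤ n
      · simp [hi, hk i hi]
      · simp [hi, show n - i = 0 by omega])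
    (fun i hi => by
      have hi' : i < n := by simpa using hi
      simpa [hi', hi'.le, Nat.succ_le_of_lt hi'] using hf i hi')
  simpa using h

theorem runsIn_clear (k : ℕ) (s : Stacks) :
    RunsIn (clear k) s (Function.update s k []) ((s k).length * 3 + 1) := by
  have h := runsIn_loop (k := k) (f := fun _ => skip) (C := 2)
    (L := s k)
    (fun i => Function.update s k ((s k).drop i)) (by simp)
    (fun i hi => by simpa using runsIn_skip _)
  simpa [clear] using h

theorem runsIn_move {k j : ℕ} (hkj : k ≠ j) (s : Stacks) :
    RunsIn (move k j) s (Function.update (Function.update s k []) j ((s k).reverse ++ s j))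
      ((s k).length * 2 + 1) := by
  have h := runsIn_loop (k := k) (f := fun a => push j a) (C := 1)
    (fun i => Function.update (Function.update s k ((s k).drop i)) j
      (((s k).take i).reverse ++ s j)) (L := s k) (by simp [hkj])
    (fun i hi => by
      convert runsIn_push j _ _ using 1
      funext l
      by_cases h1 : l = j
      · subst h1
        rw [Function.update_self, List.take_succ_eq_append_getElem hi, List.reverse_append]
        simp [hkj.symm]
      · by_cases h2 : l = k
        · subst h2
          simp [h1]
        · simp [h1, h2])
  simpa [move] using h

end StackProgram

/-! ### Unary terms -/

/-- Terms for natural numbers that depend on an input string and on number variables. -/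
inductive Tm : Type
  | const (n : ℕ)
  | var (v : ℕ)
  | len
  | letter (a : Γ') (t : Tm)
  | add (t u : Tm)
  | sub (t u : Tm)
  | sum (v : ℕ) (t u : Tm)
  | letIn (v : ℕ) (t u : Tm)
  | ite (c t u : Tm)
  | descend (v : ℕ) (n t u : Tm)

namespace Tm

/-- The value of a term. `sum v t u` is the sum of `u` over all values `v < t`, and `descend v n t u`
starts with `v := t` and iterates `v := min v u` for `n` times. -/
def eval (x : List Γ') : Tm → (ℕ → ℕ) → ℕ
  | const n, _ => n
  | var v, ρ => ρ v
  | len, _ => x.length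
  | letter a t, ρ => if x[eval x t ρ]? = some a then 1 else 0
  | add t u, ρ => eval x t ρ + eval x u ρ
  | sub t u, ρ => eval x t ρ - eval x u ρ
  | sum v t u, ρ => ∑ i ∈ Finset.range (eval x t ρ), eval x u (Function.update ρ v i)
  | letIn v t u, ρ => eval x u (Function.update ρ v (eval x t ρ))
  | ite c t u, ρ => if eval x c ρ = 0 then eval x u ρ else eval x t ρ
  | descend v n t u, ρ =>
    (fun y => min y (eval x u (Function.update ρ v y)))^[eval x n ρ] (eval x t ρ)

open StackProgram in
/-- The program that pushes as many units on the stack `r` as the value of the term says. The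
variable `v` is on the stack `m v`, and the stacks from `d` on are free. -/
def code : Tm → (m : ℕ → ℕ) → (d r : ℕ) → StackProgram
  | const 0, _, _, _ => skip
  | const (n + 1), m, d, r => (code (const n) m d r).seq (push r none)
  | var v, m, d, r =>
    (move (m v) d).seq (loop d fun _ => (push r none).seq (push (m v) none))
  | len, _, d, r => (loop 0 fun a => (push d a).seq (push r none)).seq (move d 0)
  | letter a t, m, d, r =>
    (code t m (d + 1) d).seq ((loop d fun _ => case 0 fun o =>
      match o with
      | none => skip
      | some b => (pop 0).seq (push (d + 1) b)).seq
    ((case 0 fun o => if o = some (some a) then push r none else skip).seq (move (d + 1) 0)))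
  | add t u, m, d, r => (code t m d r).seq (code u m d r)
  | sub t u, m, d, r =>
    (code t m (d + 1) d).seq ((code u m (d + 2) (d + 1)).seq
      ((loop (d + 1) fun _ => pop d).seq (move d r)))
  | sum v t u, m, d, r =>
    (code t m (d + 1) d).seq
      ((loop d fun _ => (code u (Function.update m v (d + 1)) (d + 2) r).seq (push (d + 1) none)).seq
        (clear (d + 1)))
  | letIn v t u, m, d, r =>
    (code t m (d + 1) d).seq ((code u (Function.update m v d) (d + 1) r).seq (clear d))
  | ite c t u, m, d, r =>
    (code c m (d + 1) d).seq (case d fun o =>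
      match o with
      | none => code u m (d + 1) r
      | some _ => (clear d).seq (code t m (d + 1) r))
  | descend v n t u, m, d, r =>
    (code n m (d + 1) d).seq ((code t m (d + 2) (d + 1)).seq
      ((loop d fun _ => (code u (Function.update m v (d + 1)) (d + 3) (d + 2)).seq
        ((loop (d + 2) fun _ => case (d + 1) fun o =>
          match o with
          | none => skip
          | some _ => (pop (d + 1)).seq (push (d + 3) none)).seq
        ((clear (d + 1)).seq (move (d + 3) (d + 1))))).seq
      (move (d + 1) r)))

end Tm

/-- Push `n` units on the stack `r`. -/
def pushUnits (s : Stacks) (r n : ℕ) : Stacks :=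
  Function.update s r (List.replicate n none ++ s r)

/-- The stacks represent the input on the stack `0` and the values of the variables on the stacks
given by `m`; the stacks from `d` on are empty. -/
structure Represents (x : List Γ') (ρ m : ℕ → ℕ) (d : ℕ) (s : Stacks) : Prop where
  two_lt : 2 < d
  input : s 0 = x.map some
  free : ∀ j, d ≤ j → s j = []
  lt : ∀ v, m v < d
  two_le : ∀ v, 2 ≤ m v
  val : ∀ v, s (m v) = List.replicate (ρ v) none

namespace Represents

variable {x : List Γ'} {ρ m : ℕ → ℕ} {d : ℕ} {s : Stacks}

theorem update (h : Represents x ρ m d s) {r : ℕ} (hr : r < d) (h0 : r ≠ 0) (hm : ∀ v, m v ≠ r)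
    (l : List Sym) : Represents x ρ m d (Function.update s r l) where
  two_lt := h.two_lt
  input := by rw [Function.update_of_ne h0.symm, h.input]
  free j hj := by rw [Function.update_of_ne (by omega), h.free j hj]
  lt := h.lt
  two_le := h.two_le
  val v := by rw [Function.update_of_ne (hm v), h.val]

theorem mono (h : Represents x ρ m d s) {d' : ℕ} (hd : d ≤ d') : Represents x ρ m d' s where
  two_lt := h.two_lt.trans_le hd
  input := h.input
  free j hj := h.free j (hd.trans hj)
  lt v := (h.lt v).trans_le hd
  two_le := h.two_le
  val := h.val

theorem ne (h : Represents x ρ m d s) {j : ℕ} (hj : d ≤ j) (v : ℕ) : m v ≠ j :=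
  ((h.lt v).trans_le hj).ne

theorem alloc (h : Represents x ρ m d s) (l : List Sym) :
    Represents x ρ m (d + 1) (Function.update s d l) :=
  (h.mono d.le_succ).update d.lt_succ_self (by have := h.two_lt; omega) (h.ne le_rfl) l

theorem bind (h : Represents x ρ m d s) (v n : ℕ) :
    Represents x (Function.update ρ v n) (Function.update m v d) (d + 1)
      (Function.update s d (List.replicate n none)) where
  two_lt := (h.alloc []).two_lt
  input := (h.alloc _).input
  free := (h.alloc _).free
  lt w := by
    by_cases hw : w = v
    · simp [hw]
    · simpa [hw] using (h.lt w).trans d.lt_succ_self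
  two_le w := by
    by_cases hw : w = v
    · simpa [hw] using h.two_lt.le
    · simpa [hw] using h.two_le w
  val w := by
    by_cases hw : w = v
    · simp [hw]
    · simpa [hw] using (h.alloc _).val w

end Represents

/-! ### Correctness and running time of the code of terms -/

namespace Tm

open StackProgram

/-- The polynomial `q` bounds the value of the term and the running time of its code. -/
def BoundedBy (t : Tm) (q : Polynomial ℕ) : Prop :=
  ∀ (x : List Γ') (ρ : ℕ → ℕ) (B : ℕ), x.length ≤ B → (∀ v, ρ v ≤ B) →
    t.eval x ρ ≤ q.eval B ∧ ∀ m d r s, Represents x ρ m d s → r < d → r ≠ 0 → (∀ v, m v ≠ r) →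
      RunsIn (t.code m d r) s (pushUnits s r (t.eval x ρ)) (q.eval B)

theorem pushUnits_zero (s : Stacks) (r : ℕ) : pushUnits s r 0 = s := by
  simp [pushUnits]

theorem pushUnits_pushUnits (s : Stacks) (r a b : ℕ) :
    pushUnits (pushUnits s r a) r b = pushUnits s r (a + b) := by
  simp [pushUnits, ← List.append_assoc, add_comm]

theorem pushUnits_of_nil {s : Stacks} {r : ℕ} (h : s r = []) (n : ℕ) :
    pushUnits s r n = Function.update s r (List.replicate n none) := by
  simp [pushUnits, h]

theorem runsIn_push_unit (s : Stacks) (r n : ℕ) :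
    RunsIn (push r none) (pushUnits s r n) (pushUnits s r (n + 1)) 1 := by
  have h := runsIn_push r none (pushUnits s r n)
  have e : pushUnits s r (n + 1) =
      Function.update (pushUnits s r n) r (none :: pushUnits s r n r) := by
    simp [pushUnits, List.replicate_succ]
  rwa [e]

theorem _root_.ConformantVoting.StackProgram.RunsIn.seq_of_eq {P Q : StackProgram}
    {s s' t s'' : Stacks} {C C' : ℕ} (h : RunsIn P s s' C) (h' : RunsIn Q t s'' C') (e : s' = t) :
    RunsIn (P.seq Q) s s'' (C + C') := h.seq (e ▸ h')

theorem _root_.ConformantVoting.StackProgram.RunsIn.of_eq {P : StackProgram} {s s' t : Stacks}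
    {C C' : ℕ} (h : RunsIn P s s' C) (e : s' = t) (hC : C ≤ C') : RunsIn P s t C' :=
  e ▸ h.mono hC

theorem _root_.ConformantVoting.StackProgram.RunsIn.of_eq_left {P : StackProgram} {s s' t : Stacks}
    {C : ℕ} (h : RunsIn P s s' C) (e : s = t) : RunsIn P t s' C := e ▸ h

theorem boundedBy_const (n : ℕ) : ∃ q, BoundedBy (const n) q := by
  refine ⟨(n + 2 : ℕ), fun x ρ B _ _ => ⟨by simp [eval], fun m d r s hs hr h0 hm => ?_⟩⟩
  simp only [Polynomial.eval_natCast, eval]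
  clear hs
  induction n with
  | zero => simpa [code, pushUnits_zero] using runsIn_skip s
  | succ n ih =>
    simp only [code]
    exact ih.seq (runsIn_push_unit s r n)

/-- Reading a variable empties its stack into the scratch stack `d`; the loop over `d` then refills
it while copying to `r`. This costs two and then three steps per unit. -/
theorem boundedBy_var (v : ℕ) : ∃ q, BoundedBy (var v) q := by
  refine ⟨5 * Polynomial.X + 2, fun x ρ B _ hρ => ⟨?_, fun m d r s hs hr h0 hm => ?_⟩⟩
  · have := hρ v
    simp [eval]
    omega
  · have hd : m v ≠ d := hs.ne le_rfl v
    have hv := hs.val v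
    have hf := hs.free d le_rfl
    have h1 := runsIn_move hd s
    have h2 := runsIn_loop_units (k := d) (n := ρ v)
      (f := fun _ => (push r none).seq (push (m v) none)) (C := 2)
      (fun i => Function.update (Function.update (pushUnits s r i) (m v) (List.replicate i none)) d
        (List.replicate (ρ v - i) none)) (fun i _ => by simp) (fun i hi => by
        have h3 := (runsIn_push r none (Function.update (Function.update (Function.update
          (pushUnits s r i) (m v) (List.replicate i none)) d (List.replicate (ρ v - i) none)) d
          (List.replicate (ρ v - (i + 1)) none))).seq (runsIn_push (m v) none _)
        refine h3.of_eq ?_ le_rfl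
        funext j
        simp only [pushUnits, Function.update_apply]
        grind)
    simp only [code, eval]
    refine (h1.seq_of_eq h2 ?_).of_eq ?_ ?_
    · funext j
      simp only [pushUnits, Function.update_apply]
      grind
    · funext j
      simp only [pushUnits, Function.update_apply]
      grind
    · have := hρ v
      rw [hv]
      simp
      omega

theorem boundedBy_len : ∃ q, BoundedBy len q := by
  refine ⟨5 * Polynomial.X + 2, fun x ρ B hB _ => ⟨?_, fun m d r s hs hr h0 hm => ?_⟩⟩
  · simp [eval]
    omega
  · have hd : 2 < d := hs.two_lt
    have hf := hs.free d le_rfl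
    have h1 := runsIn_loop (k := 0) (L := s 0)
      (f := fun a => (push d a).seq (push r none)) (C := 2)
      (fun i => Function.update (Function.update (pushUnits s r i) 0 ((s 0).drop i)) d
        ((s 0).take i).reverse) (fun i => by simp [show (0 : ℕ) ≠ d by omega]) (fun i hi => by
        have h3 := (runsIn_push d (s 0)[i] (Function.update (Function.update (Function.update
          (pushUnits s r i) 0 ((s 0).drop i)) d ((s 0).take i).reverse) 0
          ((s 0).drop (i + 1)))).seq (runsIn_push r none _)
        refine h3.of_eq ?_ le_rfl
        funext j
        rw [List.take_succ_eq_append_getElem hi, List.reverse_append]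
        simp only [pushUnits, Function.update_apply]
        grind)
    have hl : (s 0).length = x.length := by simp [hs.input]
    simp only [code, eval]
    refine ((h1.seq (runsIn_move (show d ≠ 0 by omega) _)).of_eq_left ?_).of_eq ?_ ?_
    · funext j
      simp only [pushUnits, Function.update_apply]
      grind
    · rw [← hl]
      funext j
      simp only [pushUnits, Function.update_apply]
      grind
    · simp
      omega

/-- Random access on a stack: the first `n` symbols are put aside on `d + 1`, the top is inspected,
and the symbols are moved back. If the position is too large, the input stack is empty at the
inspection and the test fails. -/
theorem boundedBy_letter (a : Γ') {t : Tm} {q : Polynomial ℕ} (ht : BoundedBy t q) :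
    ∃ q, BoundedBy (letter a t) q := by
  refine ⟨5 * q + 2 * Polynomial.X + 5, fun x ρ B hB hρ =>
    ⟨?_, fun m d r s hs hr h0 hm => ?_⟩⟩
  · simp only [eval, Polynomial.eval_add, Polynomial.eval_ofNat]
    split_ifs <;> omega
  · have hd : 2 < d := hs.two_lt
    have hf := hs.free d le_rfl
    have hf' := hs.free (d + 1) d.le_succ
    obtain ⟨hv, hc⟩ := ht x ρ B hB hρ
    have h1 := hc m (d + 1) d s (hs.mono d.le_succ) d.lt_succ_self (by omega) (hs.ne le_rfl)
    rw [pushUnits_of_nil hf] at h1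
    set n := eval x t ρ
    set X := x.map some with hX
    have hin : s 0 = X := hs.input
    have h2 := runsIn_loop_units (k := d) (n := n) (C := 3)
      (f := fun _ => case 0 fun o => match o with
        | none => skip
        | some b => (pop 0).seq (push (d + 1) b))
      (fun i => Function.update (Function.update (Function.update s d (List.replicate (n - i) none))
        0 (X.drop i)) (d + 1) (X.take i).reverse)
      (fun i _ => by simp [show d ≠ 0 by omega]) (fun i hi => by
        refine RunsIn.case (C := 2) ?_
        have e : (Function.update (Function.update (Function.update (Function.update s d
          (List.replicate (n - i) none)) 0 (X.drop i)) (d + 1) (X.take i).reverse) d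
          (List.replicate (n - (i + 1)) none)) 0 = X.drop i := by
          simp [show (0 : ℕ) ≠ d by omega]
        rw [e]
        by_cases hi : i < X.length
        · rw [List.drop_eq_getElem_cons hi]
          refine ((runsIn_pop _ _).seq (runsIn_push _ _ _)).of_eq ?_ le_rfl
          rw [List.take_succ_eq_append_getElem hi, List.reverse_append]
          funext j
          simp only [Function.update_apply]
          grind
        · rw [List.drop_eq_nil_of_le (by omega), List.drop_eq_nil_of_le (by omega),
            List.take_of_length_le (by omega), List.take_of_length_le (by omega)]
          refine (runsIn_skip _).of_eq ?_ le_rfl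
          funext j
          simp only [Function.update_apply]
          grind)
    have h3 : RunsIn (case 0 fun o => if o = some (some a) then push r none else skip)
        (Function.update (Function.update s 0 (X.drop n)) (d + 1) (X.take n).reverse)
        (pushUnits (Function.update (Function.update s 0 (X.drop n)) (d + 1) (X.take n).reverse) r
          (if x[n]? = some a then 1 else 0)) 3 := by
      refine RunsIn.case (C := 2) ?_
      have e : (Function.update (Function.update s 0 (X.drop n)) (d + 1) (X.take n).reverse) 0 =
          X.drop n := by simp
      rw [e, List.head?_drop]
      have e' : X[n]? = some (some a) ↔ x[n]? = some a := by
        simp [hX]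
      by_cases hx : x[n]? = some a
      · rw [if_pos (e'.2 hx), if_pos hx]
        exact (runsIn_push r none _).of_eq (by simp [pushUnits]) (by omega)
      · rw [if_neg (fun h => hx (e'.1 h)), if_neg hx, pushUnits_zero]
        exact runsIn_skip _
    simp only [code, eval]
    refine (h1.seq_of_eq (h2.seq_of_eq (h3.seq_of_eq
      (runsIn_move (show d + 1 ≠ 0 by omega) _) rfl) ?_) ?_).of_eq ?_ ?_
    · funext j
      simp only [Function.update_apply]
      grind
    · funext j
      simp only [Function.update_apply]
      grind
    · funext j
      have := List.take_append_drop n X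
      simp only [pushUnits, Function.update_apply]
      grind
    · have hr' : r ≠ d + 1 := by omega
      have hXl : X.length = x.length := by simp [hX]
      simp only [pushUnits, Function.update_apply]
      simp [hr'.symm]
      omega

theorem boundedBy_add {t u : Tm} {qt qu : Polynomial ℕ} (ht : BoundedBy t qt)
    (hu : BoundedBy u qu) : ∃ q, BoundedBy (add t u) q := by
  refine ⟨qt + qu, fun x ρ B hB hρ => ?_⟩
  obtain ⟨hv, hc⟩ := ht x ρ B hB hρ
  obtain ⟨hv', hc'⟩ := hu x ρ B hB hρ
  refine ⟨by simpa [eval] using add_le_add hv hv', fun m d r s hs hr h0 hm => ?_⟩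
  simp only [code, eval]
  refine ((hc m d r s hs hr h0 hm).seq (hc' m d r _ (hs.update hr h0 hm _) hr h0 hm)).of_eq
    (pushUnits_pushUnits ..) (by simp)

/-- Popping an empty stack does nothing, which is exactly truncated subtraction of unary numbers. -/
theorem boundedBy_sub {t u : Tm} {qt qu : Polynomial ℕ} (ht : BoundedBy t qt)
    (hu : BoundedBy u qu) : ∃ q, BoundedBy (sub t u) q := by
  refine ⟨3 * qt + 3 * qu + 2, fun x ρ B hB hρ => ?_⟩
  obtain ⟨hv, hc⟩ := ht x ρ B hB hρ
  obtain ⟨hv', hc'⟩ := hu x ρ B hB hρ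
  refine ⟨by simp [eval]; omega, fun m d r s hs hr h0 hm => ?_⟩
  have hd : 2 < d := hs.two_lt
  have hf := hs.free d le_rfl
  have hf' := hs.free (d + 1) d.le_succ
  have h1 := hc m (d + 1) d s (hs.mono d.le_succ) d.lt_succ_self (by omega) (hs.ne le_rfl)
  rw [pushUnits_of_nil hf] at h1
  have hs' := hs.alloc (List.replicate (eval x t ρ) none)
  have h2 := hc' m (d + 2) (d + 1) _ (hs'.mono (Nat.le_succ _)) (Nat.lt_succ_self _) (by omega)
    (hs'.ne le_rfl)
  rw [pushUnits_of_nil (hs'.free _ le_rfl)] at h2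
  set n := eval x t ρ
  set n' := eval x u ρ
  have h3 := runsIn_loop_units (k := d + 1) (n := n') (C := 1) (f := fun _ => pop d)
    (fun i => Function.update (Function.update s d (List.replicate (n - i) none)) (d + 1)
      (List.replicate (n' - i) none)) (fun i _ => by simp) (fun i hi => by
        refine (runsIn_pop _ _).of_eq ?_ le_rfl
        rw [← Nat.sub_sub n, ← List.tail_replicate]
        funext j
        simp only [Function.update_apply]
        grind)
  simp only [code, eval]
  refine (h1.seq (h2.seq_of_eq (h3.seq (runsIn_move (show d ≠ r by omega) _)) ?_)).of_eq ?_ ?_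
  · simp
  · funext j
    simp only [pushUnits, Function.update_apply]
    grind
  · simp
    omega

theorem boundedBy_ite {c t u : Tm} {qc qt qu : Polynomial ℕ} (hc : BoundedBy c qc)
    (ht : BoundedBy t qt) (hu : BoundedBy u qu) : ∃ q, BoundedBy (ite c t u) q := by
  refine ⟨4 * qc + qt + qu + 2, fun x ρ B hB hρ => ?_⟩
  obtain ⟨hvc, hcc⟩ := hc x ρ B hB hρ
  obtain ⟨hvt, hct⟩ := ht x ρ B hB hρ
  obtain ⟨hvu, hcu⟩ := hu x ρ B hB hρ
  refine ⟨by simp [eval]; split_ifs <;> omega, fun m d r s hs hr h0 hm => ?_⟩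
  have hd : 2 < d := hs.two_lt
  have hf := hs.free d le_rfl
  have h1 := hcc m (d + 1) d s (hs.mono d.le_succ) d.lt_succ_self (by omega) (hs.ne le_rfl)
  rw [pushUnits_of_nil hf] at h1
  simp only [code, eval]
  by_cases h : eval x c ρ = 0
  · rw [if_pos h]
    have e : Function.update s d (List.replicate (eval x c ρ) none) = s := by
      rw [h, List.replicate_zero, ← hf, Function.update_eq_self]
    rw [e] at h1
    refine (h1.seq (RunsIn.case (C := qu.eval B) ?_)).mono ?_
    · rw [hf]
      exact hcu m (d + 1) r s (hs.mono d.le_succ) (hr.trans d.lt_succ_self) h0 hm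
    · simp
      omega
  · rw [if_neg h]
    refine (h1.seq (RunsIn.case (C := qc.eval B * 3 + 1 + qt.eval B) ?_)).mono ?_
    · obtain ⟨k, hk⟩ := Nat.exists_eq_succ_of_ne_zero h
      have e : (Function.update s d (List.replicate (eval x c ρ) none) d).head? = some none := by
        simp [hk, List.replicate_succ]
      rw [e]
      have h2 := runsIn_clear d (Function.update s d (List.replicate (eval x c ρ) none))
      refine (h2.seq_of_eq
        (hct m (d + 1) r s (hs.mono d.le_succ) (hr.trans d.lt_succ_self) h0 hm) ?_).mono ?_
      · rw [Function.update_idem, ← hf, Function.update_eq_self]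
      · simp
        omega
    · simp
      omega

/-- Binding a variable raises the bound on the environment from `B` to `B + C`. This is why the
polynomial of the scope of a binder is composed with `X + qt`. -/
theorem update_le_add {ρ : ℕ → ℕ} {B n C v : ℕ} (hρ : ∀ v, ρ v ≤ B) (hn : n ≤ C) (w : ℕ) :
    Function.update ρ v n w ≤ B + C := by
  have := hρ w
  rw [Function.update_apply]
  split_ifs <;> omega

theorem boundedBy_letIn (v : ℕ) {t u : Tm} {qt qu : Polynomial ℕ}
    (ht : BoundedBy t qt) (hu : BoundedBy u qu) : ∃ q, BoundedBy (letIn v t u) q := by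
  refine ⟨4 * qt + qu.comp (Polynomial.X + qt) + 1, fun x ρ B hB hρ => ?_⟩
  obtain ⟨hvt, hct⟩ := ht x ρ B hB hρ
  obtain ⟨hvu, hcu⟩ := hu x (Function.update ρ v (eval x t ρ)) (B + qt.eval B)
    (hB.trans (Nat.le_add_right _ _)) (update_le_add hρ hvt)
  refine ⟨by simp [eval]; omega, fun m d r s hs hr h0 hm => ?_⟩
  have hd : 2 < d := hs.two_lt
  have hf := hs.free d le_rfl
  have h1 := hct m (d + 1) d s (hs.mono d.le_succ) d.lt_succ_self (by omega) (hs.ne le_rfl)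
  rw [pushUnits_of_nil hf] at h1
  have h2 := hcu _ (d + 1) r _ (hs.bind v (eval x t ρ)) (hr.trans d.lt_succ_self) h0
    (fun w => by
      rw [Function.update_apply]
      split_ifs
      · omega
      · exact hm w)
  simp only [code, eval]
  refine (h1.seq (h2.seq (runsIn_clear d _))).of_eq ?_ ?_
  · funext j
    simp only [pushUnits, Function.update_apply]
    grind
  · have e : pushUnits (Function.update s d (List.replicate (eval x t ρ) none)) r
        (eval x u (Function.update ρ v (eval x t ρ))) d = List.replicate (eval x t ρ) none := by
      simp only [pushUnits, Function.update_apply]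
      grind
    rw [e]
    simp
    omega

/-- The number of iterations is the value of `t`, which is itself polynomially bounded, and all
iterations share the bound `Q`. The loop counts `d` down and the summation variable on `d + 1` up.
-/
theorem boundedBy_sum (v : ℕ) {t u : Tm} {qt qu : Polynomial ℕ}
    (ht : BoundedBy t qt) (hu : BoundedBy u qu) : ∃ q, BoundedBy (sum v t u) q := by
  refine ⟨4 * qt + qt * (qu.comp (Polynomial.X + qt) + 2) + 2, fun x ρ B hB hρ => ?_⟩
  obtain ⟨hvt, hct⟩ := ht x ρ B hB hρ
  have hu' := fun i (hi : i < eval x t ρ) => hu x (Function.update ρ v i) (B + qt.eval B)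
    (hB.trans (Nat.le_add_right _ _)) (update_le_add hρ (hi.le.trans hvt))
  set Q := qu.eval (B + qt.eval B) with hQ
  refine ⟨?_, fun m d r s hs hr h0 hm => ?_⟩
  · have h1 : eval x (sum v t u) ρ ≤ ∑ i ∈ Finset.range (eval x t ρ), Q :=
      Finset.sum_le_sum fun i hi => (hu' i (Finset.mem_range.1 hi)).1
    have h2 : eval x t ρ * Q ≤ qt.eval B * (Q + 2) := Nat.mul_le_mul hvt (Nat.le_add_right _ _)
    rw [Finset.sum_const, Finset.card_range, smul_eq_mul] at h1
    simp [← hQ]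
    omega
  have hd : 2 < d := hs.two_lt
  have hf := hs.free d le_rfl
  have hf' := hs.free (d + 1) d.le_succ
  have h1 := hct m (d + 1) d s (hs.mono d.le_succ) d.lt_succ_self (by omega) (hs.ne le_rfl)
  rw [pushUnits_of_nil hf] at h1
  set n := eval x t ρ
  set a := fun i => eval x u (Function.update ρ v i) with ha
  have h2 := runsIn_loop_units (k := d) (n := n) (C := Q + 1)
    (f := fun _ => (code u (Function.update m v (d + 1)) (d + 2) r).seq (push (d + 1) none))
    (fun i => Function.update (Function.update (pushUnits s r (∑ j ∈ Finset.range i, a j)) d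
      (List.replicate (n - i) none)) (d + 1) (List.replicate i none)) (fun i _ => by simp)
    (fun i hi => by
      have h3 := (hu' i hi).2 (Function.update m v (d + 1)) (d + 2) r _
        (((hs.update hr h0 hm (List.replicate (∑ j ∈ Finset.range i, a j) none ++ s r)).alloc
          (List.replicate (n - (i + 1)) none)).bind v i) (by omega) h0
        (fun w => by
          rw [Function.update_apply]
          split_ifs
          · omega
          · exact hm w)
      refine ((h3.of_eq_left ?_).seq (runsIn_push _ _ _)).of_eq ?_ le_rfl
      · funext j
        simp only [pushUnits, Function.update_apply]
        grind
      · rw [Finset.sum_range_succ, add_comm _ (a i)]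
        have e : List.replicate (a i + ∑ j ∈ Finset.range i, a j) (none : Sym) =
            List.replicate (a i) none ++ List.replicate (∑ j ∈ Finset.range i, a j) none := by
          simp
        funext j
        simp only [pushUnits, Function.update_apply]
        grind)
  simp only [code, eval]
  refine (h1.seq_of_eq (h2.seq (runsIn_clear (d + 1) _)) ?_).of_eq ?_ ?_
  · rw [Finset.sum_range_zero]
    funext j
    simp only [pushUnits, Function.update_apply]
    grind
  · funext j
    simp only [pushUnits, Function.update_apply]
    grind
  · have h3 : n * (Q + 2) ≤ qt.eval B * (Q + 2) := Nat.mul_le_mul_right _ hvt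
    simp [← hQ, add_assoc]
    omega

/-- For each unit of `d + 2`, a unit moves from `d + 1` to `d + 3` as long as there is one, so `min
y z` units arrive; the rest of `d + 1` is discarded. -/
theorem runsIn_min (d y z : ℕ) (s : Stacks) (hy : s (d + 1) = List.replicate y none)
    (hz : s (d + 2) = List.replicate z none) (hs : s (d + 3) = []) :
    RunsIn ((loop (d + 2) fun _ => case (d + 1) fun o =>
      match o with
      | none => skip
      | some _ => (pop (d + 1)).seq (push (d + 3) none)).seq
      ((clear (d + 1)).seq (move (d + 3) (d + 1)))) s
      (Function.update (Function.update s (d + 1) (List.replicate (min y z) none)) (d + 2) [])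
      (4 * z + 5 * y + 3) := by
  have h1 := runsIn_loop_units (k := d + 2) (n := z) (C := 3)
    (f := fun _ => case (d + 1) fun o =>
      match o with
      | none => skip
      | some _ => (pop (d + 1)).seq (push (d + 3) none))
    (fun i => Function.update (Function.update (Function.update s (d + 1)
      (List.replicate (y - i) none)) (d + 2) (List.replicate (z - i) none)) (d + 3)
      (List.replicate (min y i) none)) (fun i _ => by simp) (fun i hi => by
      refine RunsIn.case (C := 2) ?_
      have e : (Function.update (Function.update (Function.update (Function.update s (d + 1)
          (List.replicate (y - i) none)) (d + 2) (List.replicate (z - i) none)) (d + 3)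
          (List.replicate (min y i) none)) (d + 2) (List.replicate (z - (i + 1)) none)) (d + 1) =
          List.replicate (y - i) none := by simp
      rw [e]
      by_cases hi : i < y
      · obtain ⟨k, hk⟩ : ∃ k, y - i = k + 1 := ⟨y - i - 1, by omega⟩
        have hk' : y - (i + 1) = k := by omega
        have hk'' : min y i = i := by omega
        have hk3 : min y (i + 1) = i + 1 := by omega
        rw [hk, hk', hk'', hk3, List.replicate_succ, List.head?_cons]
        refine ((runsIn_pop _ _).seq (runsIn_push _ _ _)).of_eq ?_ le_rfl
        funext j
        simp only [Function.update_apply]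
        grind
      · have hk : y - i = 0 := by omega
        have hk' : y - (i + 1) = 0 := by omega
        have hk'' : min y i = y := by omega
        have hk3 : min y (i + 1) = y := by omega
        rw [hk, hk', hk'', hk3]
        refine (runsIn_skip _).of_eq ?_ le_rfl
        funext j
        simp only [Function.update_apply]
        grind)
  refine ((h1.seq ((runsIn_clear (d + 1) _).seq
    (runsIn_move (show d + 3 ≠ d + 1 by omega) _))).of_eq_left ?_).of_eq ?_ ?_
  · funext j
    simp only [Function.update_apply]
    grind
  · funext j
    simp only [Function.update_apply]
    grind
  · simp
    omega

/-- Iterating a polynomially bounded map could produce superpolynomial values. Because of the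
minimum, all iterates stay below the start value, so one bound `Q` serves all of them. -/
theorem boundedBy_descend (v : ℕ) {n t u : Tm} {qn qt qu : Polynomial ℕ} (hn : BoundedBy n qn)
    (ht : BoundedBy t qt) (hu : BoundedBy u qu) : ∃ q, BoundedBy (descend v n t u) q := by
  refine ⟨qn + 3 * qt + qn * (5 * qu.comp (Polynomial.X + qt) + 5 * qt + 4) + 2,
    fun x ρ B hB hρ => ?_⟩
  obtain ⟨hvn, hcn⟩ := hn x ρ B hB hρ
  obtain ⟨hvt, hct⟩ := ht x ρ B hB hρ
  have hu' := fun y (hy : y ≤ eval x t ρ) => hu x (Function.update ρ v y) (B + qt.eval B)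
    (hB.trans (Nat.le_add_right _ _)) (update_le_add hρ (hy.trans hvt))
  set Q := qu.eval (B + qt.eval B) with hQ
  set N := eval x n ρ with hN
  set y := fun i =>
    (fun y => min y (eval x u (Function.update ρ v y)))^[i] (eval x t ρ) with hy
  have hy0 : ∀ i, y i ≤ eval x t ρ := by
    intro i
    induction i with
    | zero => exact le_rfl
    | succ i ih =>
      simp only [hy, Function.iterate_succ_apply']
      exact (min_le_left _ _).trans ih
  have hys : ∀ i, y (i + 1) = min (y i) (eval x u (Function.update ρ v (y i))) := fun i => by
    simp only [hy, Function.iterate_succ_apply']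
  have hev : eval x (descend v n t u) ρ = y N := rfl
  have hyN := hy0 N
  rw [hev]
  refine ⟨by simp; omega, fun m d r s hs hr h0 hm => ?_⟩
  have hd : 2 < d := hs.two_lt
  have hf := hs.free d le_rfl
  have hf1 := hs.free (d + 1) (by omega)
  have hf2 := hs.free (d + 2) (by omega)
  have hf3 := hs.free (d + 3) (by omega)
  have h1 := hcn m (d + 1) d s (hs.mono d.le_succ) d.lt_succ_self (by omega) (hs.ne le_rfl)
  rw [pushUnits_of_nil hf] at h1
  have hs' := hs.alloc (List.replicate N none)
  have h2 := hct m (d + 2) (d + 1) _ (hs'.mono (Nat.le_succ _)) (Nat.lt_succ_self _) (by omega)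
    (hs'.ne le_rfl)
  rw [pushUnits_of_nil (hs'.free _ le_rfl)] at h2
  have h3 := runsIn_loop_units (k := d) (n := N) (C := Q + (4 * Q + 5 * qt.eval B + 3))
    (f := fun _ => (code u (Function.update m v (d + 1)) (d + 3) (d + 2)).seq
        ((loop (d + 2) fun _ => case (d + 1) fun o =>
          match o with
          | none => skip
          | some _ => (pop (d + 1)).seq (push (d + 3) none)).seq
        ((clear (d + 1)).seq (move (d + 3) (d + 1)))))
    (fun i => Function.update (Function.update s d (List.replicate (N - i) none)) (d + 1)
      (List.replicate (y i) none)) (fun i _ => by simp) (fun i hi => by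
      have hs1 := (hs.alloc (List.replicate (N - (i + 1)) none)).bind v (y i)
      have h4 := (hu' (y i) (hy0 i)).2 _ (d + 3) (d + 2) _ (hs1.mono (Nat.le_succ _)) (by omega)
        (by omega) (hs1.ne le_rfl)
      rw [pushUnits_of_nil (hs1.free _ le_rfl)] at h4
      have h5 := (hu' (y i) (hy0 i)).1
      have h6 := (hy0 i).trans hvt
      refine ((h4.of_eq_left ?_).seq (runsIn_min d (y i)
        (eval x u (Function.update ρ v (y i))) _ ?_ ?_ ?_)).of_eq ?_ ?_
      · funext j
        simp only [Function.update_apply]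
        grind
      · simp
      · simp
      · simp [hf3]
      · rw [hys]
        funext j
        simp only [Function.update_apply]
        grind
      · omega)
  simp only [code]
  refine (h1.seq (h2.seq_of_eq (h3.seq (runsIn_move (show d + 1 ≠ r by omega) _)) ?_)).of_eq ?_ ?_
  · simp [hy]
  · funext j
    simp only [pushUnits, Function.update_apply]
    grind
  · have h4 : N * (Q + (4 * Q + 5 * qt.eval B + 3) + 1) ≤
        qn.eval B * (5 * Q + 5 * qt.eval B + 4) := Nat.mul_le_mul hvn (by omega)
    simp [← hQ]
    omega

theorem exists_boundedBy (t : Tm) : ∃ q, BoundedBy t q := by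
  induction t with
  | const n => exact boundedBy_const n
  | var v => exact boundedBy_var v
  | len => exact boundedBy_len
  | letter a t ih => exact boundedBy_letter a ih.choose_spec
  | add t u iht ihu => exact boundedBy_add iht.choose_spec ihu.choose_spec
  | sub t u iht ihu => exact boundedBy_sub iht.choose_spec ihu.choose_spec
  | sum v t u iht ihu => exact boundedBy_sum v iht.choose_spec ihu.choose_spec
  | letIn v t u iht ihu => exact boundedBy_letIn v iht.choose_spec ihu.choose_spec
  | ite c t u ihc iht ihu =>
    exact boundedBy_ite ihc.choose_spec iht.choose_spec ihu.choose_spec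
  | descend v n t u ihn iht ihu =>
    exact boundedBy_descend v ihn.choose_spec iht.choose_spec ihu.choose_spec

end Tm

/-! ### Emission programs -/

/-- Programs that emit strings depending on an input string and on number variables. -/
inductive Em : Type
  | skip
  | emit (a : Sym)
  | seq (e e' : Em)
  | loop (v : ℕ) (t : Tm) (e : Em)
  | letIn (v : ℕ) (t : Tm) (e : Em)
  | ite (c : Tm) (e e' : Em)

namespace Em

/-- The emitted string. `loop v t e` runs `e` for all values `v < t`. -/
def eval (x : List Γ') : Em → (ℕ → ℕ) → List Sym
  | skip, _ => []
  | emit a, _ => [a]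
  | seq e e', ρ => eval x e ρ ++ eval x e' ρ
  | loop v t e, ρ => (List.range (t.eval x ρ)).flatMap fun i => eval x e (Function.update ρ v i)
  | letIn v t e, ρ => eval x e (Function.update ρ v (t.eval x ρ))
  | ite c e e', ρ => if c.eval x ρ = 0 then eval x e' ρ else eval x e ρ

open StackProgram in
/-- The program that pushes the emitted string on the stack `1`. The variable `v` is on the stack
`m v`, and the stacks from `d` on are free. -/
def code : Em → (m : ℕ → ℕ) → (d : ℕ) → StackProgram
  | skip, _, _ => StackProgram.skip
  | emit a, _, _ => push 1 a
  | seq e e', m, d => (code e m d).seq (code e' m d)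
  | loop v t e, m, d =>
    (t.code m (d + 1) d).seq ((StackProgram.loop d fun _ =>
      (code e (Function.update m v (d + 1)) (d + 2)).seq (push (d + 1) none)).seq (clear (d + 1)))
  | letIn v t e, m, d =>
    (t.code m (d + 1) d).seq ((code e (Function.update m v d) (d + 1)).seq (clear d))
  | ite c e e', m, d =>
    (c.code m (d + 1) d).seq (case d fun o =>
      match o with
      | none => code e' m (d + 1)
      | some _ => (clear d).seq (code e m (d + 1)))

open StackProgram Tm

/-- The polynomial `q` bounds the running time of the code. -/
def BoundedBy (e : Em) (q : Polynomial ℕ) : Prop :=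
  ∀ (x : List Γ') (ρ : ℕ → ℕ) (B : ℕ), x.length ≤ B → (∀ v, ρ v ≤ B) →
    ∀ m d s, Represents x ρ m d s →
      RunsIn (e.code m d) s (Function.update s 1 ((e.eval x ρ).reverse ++ s 1)) (q.eval B)

theorem _root_.ConformantVoting.Represents.update_one {x : List Γ'} {ρ m : ℕ → ℕ} {d : ℕ}
    {s : Stacks} (h : Represents x ρ m d s) (l : List Sym) :
    Represents x ρ m d (Function.update s 1 l) :=
  h.update (by have := h.two_lt; omega) one_ne_zero (fun v => by have := h.two_le v; omega) l

theorem boundedBy_letIn (v : ℕ) {t : Tm} {e : Em} {qt qe : Polynomial ℕ}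
    (ht : Tm.BoundedBy t qt) (he : BoundedBy e qe) : ∃ q, BoundedBy (letIn v t e) q := by
  refine ⟨4 * qt + qe.comp (Polynomial.X + qt) + 1, fun x ρ B hB hρ m d s hs => ?_⟩
  obtain ⟨hvt, hct⟩ := ht x ρ B hB hρ
  have hce := he x (Function.update ρ v (t.eval x ρ)) (B + qt.eval B)
    (hB.trans (Nat.le_add_right _ _)) (update_le_add hρ hvt)
  have hd : 2 < d := hs.two_lt
  have hf := hs.free d le_rfl
  have h1 := hct m (d + 1) d s (hs.mono d.le_succ) d.lt_succ_self (by omega) (hs.ne le_rfl)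
  rw [pushUnits_of_nil hf] at h1
  have h2 := hce _ (d + 1) _ (hs.bind v (t.eval x ρ))
  simp only [code, eval]
  refine (h1.seq (h2.seq (runsIn_clear d _))).of_eq ?_ ?_
  · funext j
    simp only [Function.update_apply]
    grind
  · have : d ≠ 1 := by omega
    simp [this]
    omega

theorem boundedBy_ite {c : Tm} {e e' : Em} {qc qe qe' : Polynomial ℕ} (hc : Tm.BoundedBy c qc)
    (he : BoundedBy e qe) (he' : BoundedBy e' qe') : ∃ q, BoundedBy (ite c e e') q := by
  refine ⟨4 * qc + qe + qe' + 2, fun x ρ B hB hρ m d s hs => ?_⟩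
  obtain ⟨hvc, hcc⟩ := hc x ρ B hB hρ
  have hce := he x ρ B hB hρ
  have hce' := he' x ρ B hB hρ
  have hd : 2 < d := hs.two_lt
  have hf := hs.free d le_rfl
  have h1 := hcc m (d + 1) d s (hs.mono d.le_succ) d.lt_succ_self (by omega) (hs.ne le_rfl)
  rw [pushUnits_of_nil hf] at h1
  simp only [code, eval]
  by_cases h : c.eval x ρ = 0
  · rw [if_pos h]
    have e : Function.update s d (List.replicate (c.eval x ρ) none) = s := by
      rw [h, List.replicate_zero, ← hf, Function.update_eq_self]
    rw [e] at h1
    refine (h1.seq (RunsIn.case (C := qe'.eval B) ?_)).mono ?_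
    · rw [hf]
      exact hce' m (d + 1) s (hs.mono d.le_succ)
    · simp
      omega
  · rw [if_neg h]
    refine (h1.seq (RunsIn.case (C := qc.eval B * 3 + 1 + qe.eval B) ?_)).mono ?_
    · obtain ⟨k, hk⟩ := Nat.exists_eq_succ_of_ne_zero h
      have e : (Function.update s d (List.replicate (c.eval x ρ) none) d).head? = some none := by
        simp [hk, List.replicate_succ]
      rw [e]
      have h2 := runsIn_clear d (Function.update s d (List.replicate (c.eval x ρ) none))
      refine (h2.seq_of_eq (hce m (d + 1) s (hs.mono d.le_succ)) ?_).mono ?_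
      · rw [Function.update_idem, ← hf, Function.update_eq_self]
      · simp
        omega
    · simp
      omega

theorem boundedBy_loop (v : ℕ) {t : Tm} {e : Em} {qt qe : Polynomial ℕ}
    (ht : Tm.BoundedBy t qt) (he : BoundedBy e qe) : ∃ q, BoundedBy (loop v t e) q := by
  refine ⟨4 * qt + qt * (qe.comp (Polynomial.X + qt) + 2) + 2, fun x ρ B hB hρ m d s hs => ?_⟩
  obtain ⟨hvt, hct⟩ := ht x ρ B hB hρ
  have he' := fun i (hi : i < t.eval x ρ) => he x (Function.update ρ v i) (B + qt.eval B)
    (hB.trans (Nat.le_add_right _ _)) (update_le_add hρ (hi.le.trans hvt))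
  set Q := qe.eval (B + qt.eval B) with hQ
  have hd : 2 < d := hs.two_lt
  have hf := hs.free d le_rfl
  have hf' := hs.free (d + 1) d.le_succ
  have h1 := hct m (d + 1) d s (hs.mono d.le_succ) d.lt_succ_self (by omega) (hs.ne le_rfl)
  rw [pushUnits_of_nil hf] at h1
  set n := t.eval x ρ
  set a : ℕ → List Sym := fun i =>
    (List.range i).flatMap fun i => eval x e (Function.update ρ v i) with ha
  have has : ∀ i, a (i + 1) = a i ++ eval x e (Function.update ρ v i) := fun i => by
    simp [ha, List.range_succ]
  have h2 := runsIn_loop_units (k := d) (n := n) (C := Q + 1)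
    (f := fun _ => (code e (Function.update m v (d + 1)) (d + 2)).seq (push (d + 1) none))
    (fun i => Function.update (Function.update (Function.update s 1 ((a i).reverse ++ s 1)) d
      (List.replicate (n - i) none)) (d + 1) (List.replicate i none)) (fun i _ => by simp)
    (fun i hi => by
      have h3 := he' i hi (Function.update m v (d + 1)) (d + 2) _
        (((hs.update_one ((a i).reverse ++ s 1)).alloc
          (List.replicate (n - (i + 1)) none)).bind v i)
      refine ((h3.of_eq_left ?_).seq (runsIn_push _ _ _)).of_eq ?_ le_rfl
      · funext j
        simp only [Function.update_apply]
        grind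
      · rw [has, List.reverse_append]
        funext j
        simp only [Function.update_apply]
        grind)
  have ha0 : a 0 = [] := by simp [ha]
  simp only [code, eval]
  refine (h1.seq_of_eq (h2.seq (runsIn_clear (d + 1) _)) ?_).of_eq ?_ ?_
  · rw [ha0]
    funext j
    simp only [Function.update_apply]
    grind
  · funext j
    simp only [Function.update_apply]
    grind
  · have h3 : n * (Q + 2) ≤ qt.eval B * (Q + 2) := Nat.mul_le_mul_right _ hvt
    simp [← hQ, add_assoc]
    omega

theorem exists_boundedBy (e : Em) : ∃ q, BoundedBy e q := by
  induction e with
  | skip =>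
    refine ⟨2, fun x ρ B hB hρ m d s hs => ?_⟩
    simp only [code, eval]
    exact (runsIn_skip s).of_eq (by simp) (by simp)
  | emit a =>
    refine ⟨1, fun x ρ B hB hρ m d s hs => ?_⟩
    simp only [code, eval]
    exact (runsIn_push 1 a s).of_eq (by simp) (by simp)
  | seq e e' ih ih' =>
    obtain ⟨q, hq⟩ := ih
    obtain ⟨q', hq'⟩ := ih'
    refine ⟨q + q', fun x ρ B hB hρ m d s hs => ?_⟩
    simp only [code, eval]
    exact ((hq x ρ B hB hρ m d s hs).seq (hq' x ρ B hB hρ m d _ (hs.update_one _))).of_eq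
      (by simp) (by simp)
  | loop v t e ih => exact boundedBy_loop v t.exists_boundedBy.choose_spec ih.choose_spec
  | letIn v t e ih => exact boundedBy_letIn v t.exists_boundedBy.choose_spec ih.choose_spec
  | ite c e e' ih ih' =>
    exact boundedBy_ite c.exists_boundedBy.choose_spec ih.choose_spec ih'.choose_spec

/-- The output has to be reversed at the end, and the cost of this is governed by its length. -/
theorem length_eval_le (e : Em) : ∃ q : Polynomial ℕ, ∀ (x : List Γ') (ρ : ℕ → ℕ) (B : ℕ),
    x.length ≤ B → (∀ v, ρ v ≤ B) → (e.eval x ρ).length ≤ q.eval B := by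
  induction e with
  | skip => exact ⟨0, fun x ρ B hB hρ => by simp [eval]⟩
  | emit a => exact ⟨1, fun x ρ B hB hρ => by simp [eval]⟩
  | seq e e' ih ih' =>
    obtain ⟨q, hq⟩ := ih
    obtain ⟨q', hq'⟩ := ih'
    exact ⟨q + q', fun x ρ B hB hρ => by
      simpa [eval] using add_le_add (hq x ρ B hB hρ) (hq' x ρ B hB hρ)⟩
  | loop v t e ih =>
    obtain ⟨qt, ht⟩ := t.exists_boundedBy
    obtain ⟨q, hq⟩ := ih
    refine ⟨qt * q.comp (Polynomial.X + qt), fun x ρ B hB hρ => ?_⟩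
    have hvt := (ht x ρ B hB hρ).1
    simp only [eval, List.length_flatMap, Polynomial.eval_mul, Polynomial.eval_comp,
      Polynomial.eval_add, Polynomial.eval_X]
    refine (List.sum_le_card_nsmul _ (q.eval (B + qt.eval B)) ?_).trans ?_
    · intro y hy
      obtain ⟨i, hi, rfl⟩ := List.mem_map.1 hy
      exact hq x _ _ (hB.trans (Nat.le_add_right _ _))
        (update_le_add hρ ((List.mem_range.1 hi).le.trans hvt))
    · simpa using Nat.mul_le_mul_right _ hvt
  | letIn v t e ih =>
    obtain ⟨qt, ht⟩ := t.exists_boundedBy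
    obtain ⟨q, hq⟩ := ih
    refine ⟨q.comp (Polynomial.X + qt), fun x ρ B hB hρ => ?_⟩
    simpa [eval] using hq x _ _ (hB.trans (Nat.le_add_right _ _))
        (update_le_add hρ (ht x ρ B hB hρ).1)
  | ite c e e' ih ih' =>
    obtain ⟨q, hq⟩ := ih
    obtain ⟨q', hq'⟩ := ih'
    refine ⟨q + q', fun x ρ B hB hρ => ?_⟩
    have h := hq x ρ B hB hρ
    have h' := hq' x ρ B hB hρ
    simp only [eval, Polynomial.eval_add]
    split_ifs <;> omega

/-- Move the stack `k` to itself in reversed order, using the stacks `3` and `4`. -/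
def reverseStack (k : ℕ) : StackProgram := (move k 3).seq ((move 3 4).seq (move 4 k))

/-- Each of the three moves reverses the order, and an odd number of reversals is a reversal. -/
theorem runsIn_reverseStack {k : ℕ} (hk : k < 3) (l : List Sym) (s : Stacks) (h3 : s 3 = [])
    (h4 : s 4 = []) (hl : s k = l) :
    RunsIn (reverseStack k) s (Function.update s k l.reverse) (6 * l.length + 3) := by
  refine ((runsIn_move (show k ≠ 3 by omega) s).seq ((runsIn_move (show 3 ≠ 4 by omega) _).seq
    (runsIn_move (show 4 ≠ k by omega) _))).of_eq ?_ ?_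
  · funext j
    simp only [Function.update_apply]
    grind
  · simp [hl, h3, h4, show (4 : ℕ) ≠ k by omega]
    omega

/-- A function is computable in polynomial time if an emission program emits the code of its
value. -/
theorem nonempty_computableInPolyTime {α β : Type} {ea : α → List Γ'} {eb : β → List Sym}
    {f : α → β} (e : Em) (h : ∀ a, e.eval (ea a) (fun _ => 0) = eb (f a)) :
    Nonempty (TM2ComputableInPolyTime ea eb f) := by
  obtain ⟨q, hq⟩ := e.exists_boundedBy
  obtain ⟨q', hq'⟩ := e.length_eval_le
  -- The input arrives reversed and the output is built by pushing, hence also reversed; both are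
  -- turned around, and the input is erased because only the output may remain.
  refine StackProgram.nonempty_computableInPolyTime
    ((reverseStack 0).seq ((e.code (fun _ => 2) 3).seq ((clear 0).seq (reverseStack 1))))
    (9 * Polynomial.X + q + 6 * q' + 7) fun a => ?_
  set x := ea a
  have h1 := runsIn_reverseStack (k := 0) (by norm_num) (x.map some).reverse
    (Function.update (fun _ => []) 0 (x.map some).reverse) (by simp) (by simp) (by simp)
  rw [Function.update_idem, List.reverse_reverse] at h1
  -- Initially all variables share the empty stack `2`, which represents the value zero; every
  -- binder moves its variable to a fresh stack.
  have hs : Represents x (fun _ => 0) (fun _ => 2) 3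
      (Function.update (fun _ => []) 0 (x.map some)) :=
    { two_lt := by norm_num
      input := by simp
      free := fun j hj => by simp [show j ≠ 0 by omega]
      lt := by simp
      two_le := by simp
      val := by simp }
  have h2 := hq x (fun _ => 0) x.length le_rfl (by simp) _ _ _ hs
  have h2' := hq' x (fun _ => 0) x.length le_rfl (by simp)
  rw [h] at h2 h2'
  have h4 := runsIn_reverseStack (k := 1) (by norm_num) (eb (f a)).reverse
    (Function.update (fun _ => []) 1 (eb (f a)).reverse) (by simp) (by simp) (by simp)
  rw [Function.update_idem, List.reverse_reverse] at h4
  refine (h1.seq (h2.seq ((runsIn_clear 0 _).seq_of_eq h4 ?_))).mono ?_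
  · funext j
    simp only [Function.update_apply]
    grind
  · simp
    omega

end Em

/-! ### Reading the input -/

namespace Tm

/-- The truth value of `t = u`. -/
def eq (t u : Tm) : Tm := sub (const 1) (add (sub t u) (sub u t))

/-- The truth value of `t < u`. -/
def lt (t u : Tm) : Tm := sub (const 1) (sub (add t (const 1)) u)

/-- The conjunction of two truth values. -/
def and (t u : Tm) : Tm := ite t u (const 0)

/-- The negation of a truth value. -/
def not (t : Tm) : Tm := sub (const 1) t

/-- The product of two numbers. -/
def mul (t u : Tm) : Tm := letIn 100 t (letIn 101 u (sum 102 (var 100) (var 101)))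

/-- The number `t / 2`. -/
def half (t : Tm) : Tm :=
  letIn 100 t (sum 101 (var 100) (lt (add (add (var 101) (var 101)) (const 1)) (var 100)))

/-- The number `t / 2 ^ u`. -/
def shiftRight (t u : Tm) : Tm := descend 102 u t (half (var 102))

/-- The number `t % 2`. -/
def parity (t : Tm) : Tm := letIn 102 t (sub (var 102) (add (half (var 102)) (half (var 102))))

/-- The number of symbols `Γ'.bit true` between the `t`-th and the next comma of the input. -/
def block (t : Tm) : Tm :=
  letIn 100 t (sum 101 len (and (letter (Γ'.bit true) (var 101))
    (eq (sum 102 (var 101) (letter Γ'.comma (var 102))) (var 100))))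

/-- The number of symbols before the first comma of the input. -/
def prefixLength : Tm :=
  sum 101 len (not (sum 102 (add (var 101) (const 1)) (letter Γ'.comma (var 102))))

/-- The digit of the number `t` at position `u`, increased by one, or zero if the binary
representation has at most `u` digits. -/
def digit (t u : Tm) : Tm :=
  letIn 103 (shiftRight t u) (ite (var 103) (add (const 1) (parity (var 103))) (const 0))

/-- The digit of the binary number at the start of the input, as for `digit`. -/
def inputDigit (u : Tm) : Tm :=
  letIn 103 u (ite (lt (var 103) prefixLength)
    (add (const 1) (letter (Γ'.bit true) (var 103))) (const 0))

/-- The truth value of `k = t`, where `k` is the binary number at the start of the input. -/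
def isPrefix (t : Tm) : Tm :=
  letIn 104 t (eq (sum 105 (add len (var 104))
    (not (eq (digit (var 104) (var 105)) (inputDigit (var 105))))) (const 0))

/-- The truth value of `t ≤ k`, where `k` is the binary number at the start of the input. -/
def lePrefix (t : Tm) : Tm := eq (sum 106 t (isPrefix (var 106))) (const 0)

/-! ### Values of the derived terms -/

section eval

variable (x : List Γ') (ρ : ℕ → ℕ) (t u : Tm)

theorem eval_eq : eval x (eq t u) ρ = if eval x t ρ = eval x u ρ then 1 else 0 := by
  simp only [eq, eval]
  split_ifs <;> omega

theorem eval_lt : eval x (lt t u) ρ = if eval x t ρ < eval x u ρ then 1 else 0 := by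
  simp only [lt, eval]
  split_ifs <;> omega

theorem eval_and : eval x (and t u) ρ = if eval x t ρ = 0 then 0 else eval x u ρ := by
  simp only [and, eval]

theorem eval_not : eval x (not t) ρ = 1 - eval x t ρ := by
  simp only [not, eval]

/-- The second factor is evaluated after the variable `100` has been bound, so it is evaluated in
the updated environment. -/
theorem eval_mul : eval x (mul t u) ρ = eval x t ρ * eval x u (Function.update ρ 100 (eval x t ρ)) := by
  simp [mul, eval, Function.update]

/-- `n / 2` is the number of `i` with `2 * i + 1 < n`. -/
theorem eval_half : eval x (half t) ρ = eval x t ρ / 2 := by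
  simp only [half, eval, eval_lt]
  simp only [Function.update_apply, Nat.reduceEqDiff, reduceIte]
  rw [Finset.sum_boole, Nat.cast_id]
  have : (Finset.range (eval x t ρ)).filter (fun i => i + i + 1 < eval x t ρ) =
      Finset.range (eval x t ρ / 2) := by
    ext i
    simp only [Finset.mem_filter, Finset.mem_range]
    omega
  rw [this, Finset.card_range]

/-- Halving never increases a number, so the minimum in `descend` has no effect. -/
theorem eval_shiftRight : eval x (shiftRight t u) ρ = eval x t ρ / 2 ^ eval x u ρ := by
  simp only [shiftRight, eval, eval_half]
  simp only [Function.update_self]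
  generalize eval x u ρ = n
  induction n with
  | zero => simp
  | succ n ih =>
    rw [Function.iterate_succ_apply', ih, min_eq_right (Nat.div_le_self _ _), Nat.div_div_eq_div_mul,
      pow_succ]

theorem eval_parity : eval x (parity t) ρ = eval x t ρ % 2 := by
  simp only [parity, eval, eval_half, Function.update_self]
  omega

/-- The number of symbols `Γ'.bit true` between the `j`-th and the next comma. -/
def blockLength : List Γ' → ℕ → ℕ
  | [], _ => 0
  | a :: x, j =>
    if a = Γ'.comma then if j = 0 then 0 else blockLength x (j - 1)
    else if a = Γ'.bit true ∧ j = 0 then 1 + blockLength x j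
    else blockLength x j

/-- The left side counts the symbols `Γ'.bit true` that are preceded by exactly `j` commas, as a
term can do; the recursion on the right can be unfolded along an encoding. -/
theorem sum_eq_blockLength (x : List Γ') (j : ℕ) :
    (∑ i ∈ Finset.range x.length, if x[i]? = some (Γ'.bit true) ∧
      (∑ l ∈ Finset.range i, if x[l]? = some Γ'.comma then 1 else 0) = j then 1 else 0) =
    blockLength x j := by
  induction x generalizing j with
  | nil => rfl
  | cons a x ih =>
    rw [List.length_cons, Finset.sum_range_succ']
    simp only [Finset.sum_range_succ', List.getElem?_cons_succ, List.getElem?_cons_zero,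
      Option.some.injEq, Finset.range_zero, Finset.sum_empty]
    rw [blockLength]
    by_cases h1 : a = Γ'.comma
    · subst h1
      rcases j with _ | j
      · simp
      · simp [← ih]
    · by_cases h2 : a = Γ'.bit true ∧ j = 0
      · obtain ⟨rfl, rfl⟩ := h2
        simp [← ih, add_comm]
      · have h3 : ¬(a = Γ'.bit true ∧ 0 = j) := fun h => h2 ⟨h.1, h.2.symm⟩
        rw [if_neg h1, if_neg h2, if_neg h3, if_neg h1, ← ih]
        rfl

theorem eval_block : eval x (block t) ρ = blockLength x (eval x t ρ) := by
  rw [← sum_eq_blockLength]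
  simp only [block, eval, eval_and, eval_eq]
  refine Finset.sum_congr rfl fun i _ => ?_
  simp only [Function.update_apply, Nat.reduceEqDiff, reduceIte]
  split_ifs <;> simp_all

/-- The digit codes of a list of bits. -/
def digitCode (l : List Bool) (i : ℕ) : ℕ :=
  match l[i]? with
  | none => 0
  | some b => 1 + b.toNat

theorem digitCode_cons_zero (b : Bool) (l : List Bool) : digitCode (b :: l) 0 = 1 + b.toNat := rfl

theorem digitCode_cons_succ (b : Bool) (l : List Bool) (i : ℕ) :
    digitCode (b :: l) (i + 1) = digitCode l i := by
  simp [digitCode]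

/-- The code zero marks positions beyond the end, so lists of different lengths are distinguished as
well. -/
theorem digitCode_injective {l l' : List Bool} {n : ℕ} (hl : l.length ≤ n) (hl' : l'.length ≤ n)
    (h : ∀ i < n, digitCode l i = digitCode l' i) : l = l' := by
  refine List.ext_getElem? fun i => ?_
  by_cases hi : i < n
  · have := h i hi
    unfold digitCode at this
    generalize l[i]? = o at this
    generalize l'[i]? = o' at this
    rcases o with _ | _ | _ <;> rcases o' with _ | _ | _ <;> simp_all
  · rw [List.getElem?_eq_none (by omega), List.getElem?_eq_none (by omega)]

/-- `encodeNat` goes through `Num` and `PosNum`; this recursion makes the least significant bit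
accessible by arithmetic on `ℕ`. -/
theorem encodeNat_eq (n : ℕ) (hn : n ≠ 0) :
    encodeNat n = (decide (n % 2 = 1)) :: encodeNat (n / 2) := by
  have h0 : ∀ p : PosNum, encodeNat (p : ℕ) = encodePosNum p := fun p => by
    unfold encodeNat
    have : ((p : ℕ) : Num) = Num.pos p := by
      exact_mod_cast Num.of_to_nat (Num.pos p)
    rw [this]
    rfl
  obtain ⟨p, rfl⟩ : ∃ p : PosNum, (p : ℕ) = n :=
    by
      have h := Num.to_of_nat n
      rcases hN : (n : Num) with _ | p
      · rw [hN] at h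
        exact absurd h.symm hn
      · exact ⟨p, by rw [← h, hN]; rfl⟩
  rcases p with _ | p | p
  · rfl
  · rw [h0, encodePosNum, ← h0]
    have e1 : ((PosNum.bit1 p : PosNum) : ℕ) = p + p + 1 := rfl
    rw [e1, show ((p : ℕ) + p + 1) / 2 = p by omega]
    simp
    omega
  · rw [h0, encodePosNum, ← h0]
    have e1 : ((PosNum.bit0 p : PosNum) : ℕ) = p + p := rfl
    rw [e1, show ((p : ℕ) + p) / 2 = p by omega]
    simp
    omega

theorem digitCode_encodeNat (n i : ℕ) :
    digitCode (encodeNat n) i = if n / 2 ^ i = 0 then 0 else 1 + n / 2 ^ i % 2 := by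
  induction i generalizing n with
  | zero =>
    by_cases hn : n = 0
    · subst hn
      rfl
    · rw [encodeNat_eq n hn]
      simp only [digitCode, List.getElem?_cons_zero, pow_zero, Nat.div_one, if_neg hn]
      rcases Nat.mod_two_eq_zero_or_one n with h | h <;> simp [h]
  | succ i ih =>
    by_cases hn : n = 0
    · subst hn
      simp only [Nat.zero_div, if_true]
      rfl
    · rw [encodeNat_eq n hn, pow_succ', ← Nat.div_div_eq_div_mul, ← ih]
      simp [digitCode]

theorem length_encodeNat_le (n : ℕ) : (encodeNat n).length ≤ n := by
  by_contra! h
  have h1 := digitCode_encodeNat n n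
  rw [Nat.div_eq_of_lt n.lt_two_pow_self, if_pos rfl] at h1
  simp [digitCode, List.getElem?_eq_getElem h] at h1

theorem eval_digit : eval x (digit t u) ρ = digitCode (encodeNat (eval x t ρ)) (eval x u ρ) := by
  rw [digitCode_encodeNat]
  simp only [digit, eval, eval_shiftRight, eval_parity, Function.update_self]

theorem eval_prefixLength (k : ℕ) (y : List Γ') :
    eval (encodeBinary k ++ y) prefixLength ρ = (encodeNat k).length := by
  set l := encodeNat k
  have hx : encodeBinary k ++ y = l.map Γ'.bit ++ Γ'.comma :: y := by
    simp [encodeBinary, l]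
  rw [hx]
  have h1 : ∀ n ≤ l.length, (∑ i ∈ Finset.range n,
      if (l.map Γ'.bit ++ Γ'.comma :: y)[i]? = some Γ'.comma then 1 else 0) = 0 := by
    intro n hn
    refine Finset.sum_eq_zero fun i hi => ?_
    have hi' : i < l.length := (Finset.mem_range.1 hi).trans_le hn
    rw [List.getElem?_append_left (by simpa using hi')]
    simp [hi']
  have h2 : ∀ n, l.length < n → (∑ i ∈ Finset.range n,
      if (l.map Γ'.bit ++ Γ'.comma :: y)[i]? = some Γ'.comma then 1 else 0) ≠ 0 := by
    intro n hn h
    have := Finset.sum_eq_zero_iff.1 h l.length (Finset.mem_range.2 hn)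
    simp at this
  simp only [prefixLength, eval, eval_not, Function.update_apply, Nat.reduceEqDiff, reduceIte]
  have h3 : ∀ i, 1 - (∑ j ∈ Finset.range (i + 1),
      if (l.map Γ'.bit ++ Γ'.comma :: y)[j]? = some Γ'.comma then 1 else 0) =
      if i < l.length then 1 else 0 := by
    intro i
    split_ifs with h
    · rw [h1 _ h]
    · have := h2 (i + 1) (by omega)
      omega
  rw [Finset.sum_congr rfl fun i _ => h3 i, Finset.sum_boole, Nat.cast_id]
  have : (Finset.range (l.map Γ'.bit ++ Γ'.comma :: y).length).filter (· < l.length) =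
      Finset.range l.length := by
    ext i
    simp
    omega
  rw [this, Finset.card_range]

theorem eval_inputDigit (k : ℕ) (y : List Γ') :
    eval (encodeBinary k ++ y) (inputDigit u) ρ =
      digitCode (encodeNat k) (eval (encodeBinary k ++ y) u ρ) := by
  simp only [inputDigit, eval, eval_lt, eval_prefixLength, Function.update_self]
  generalize eval (encodeBinary k ++ y) u ρ = i
  unfold digitCode
  by_cases h : i < (encodeNat k).length
  · rw [encodeBinary, List.append_assoc, List.getElem?_append_left (by simpa using h)]
    rw [List.getElem?_map, List.getElem?_eq_getElem h]
    generalize (encodeNat k)[i] = b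
    rcases b <;> simp [h]
  · have h' : (encodeNat k)[i]? = none := List.getElem?_eq_none (by omega)
    rw [h']
    simp [h]

/-- The number `k` can be exponential in the length of the input, so it is never written in unary
here. Instead its digits are compared with those of the small number; the range `len + t` covers
both binary representations. -/
theorem eval_isPrefix (k : ℕ) (y : List Γ') :
    eval (encodeBinary k ++ y) (isPrefix t) ρ =
      if k = eval (encodeBinary k ++ y) t ρ then 1 else 0 := by
  simp only [isPrefix, eval, eval_eq, eval_not, eval_digit, eval_inputDigit, Function.update_apply,
    Nat.reduceEqDiff, reduceIte]
  generalize eval (encodeBinary k ++ y) t ρ = s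
  refine if_congr ?_ rfl rfl
  rw [Finset.sum_eq_zero_iff]
  constructor
  · intro h
    have h1 : encodeNat s = encodeNat k := by
      refine digitCode_injective (n := (encodeBinary k ++ y).length + s)
        ((length_encodeNat_le s).trans (Nat.le_add_left _ _)) (by simp [encodeBinary]; omega) ?_
      intro i hi
      have := h i (Finset.mem_range.2 hi)
      by_contra hne
      simp [hne] at this
    rw [← decode_encodeNat k, ← h1, decode_encodeNat]
  · rintro rfl i _
    simp

/-- A number is at most `k` if and only if no smaller number equals `k`; this needs only
polynomially many tests for equality. -/
theorem eval_lePrefix (k : ℕ) (y : List Γ') :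
    eval (encodeBinary k ++ y) (lePrefix t) ρ =
      if eval (encodeBinary k ++ y) t ρ ≤ k then 1 else 0 := by
  simp only [lePrefix, eval, eval_eq, eval_isPrefix, Function.update_self]
  refine if_congr ?_ rfl rfl
  rw [Finset.sum_eq_zero_iff]
  simp only [Finset.mem_range, ite_eq_right_iff, one_ne_zero, imp_false]
  constructor
  · intro h
    by_contra! hk
    exact h k hk rfl
  · intro h i hi
    omega

end eval

end Tm

/-! ### Emission of numbers -/

namespace Em

open Tm

/-- Emit a symbol. -/
def symbol (a : Γ') : Em := emit (some a)

/-- Emit a number in unary. -/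
def unary (t : Tm) : Em := (loop 100 t (symbol (Γ'.bit true))).seq (symbol Γ'.comma)

/-- Emit a number in binary. -/
def binary (t : Tm) : Em :=
  (letIn 100 t (loop 101 (var 100) (letIn 102 (digit (var 100) (var 101))
    (ite (var 102) (ite (Tm.eq (var 102) (const 2)) (symbol (Γ'.bit true))
      (symbol (Γ'.bit false))) skip)))).seq (symbol Γ'.comma)

variable (x : List Γ') (ρ : ℕ → ℕ) (t : Tm)

theorem eval_symbol (a : Γ') : eval x (symbol a) ρ = [some a] := rfl

theorem eval_unary : eval x (unary t) ρ = (encodeUnary (t.eval x ρ)).map some := by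
  simp only [unary, eval, eval_symbol, encodeUnary, List.map_append, List.map_replicate,
    List.map_cons, List.map_nil]
  rw [List.flatMap_def, List.map_const', List.length_range]
  simp

theorem flatMap_digitCode (l : List Bool) (n : ℕ) (hn : l.length ≤ n) :
    ((List.range n).flatMap fun i => if digitCode l i = 0 then [] else
      if digitCode l i = 2 then [some (Γ'.bit true)] else [some (Γ'.bit false)]) =
      l.map fun b => some (Γ'.bit b) := by
  induction l generalizing n with
  | nil => simp [digitCode]
  | cons b l ih =>
    obtain ⟨n, rfl⟩ : ∃ k, n = k + 1 := ⟨n - 1, by simp at hn; omega⟩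
    rw [List.range_succ_eq_map, List.flatMap_cons, List.flatMap_map, List.map_cons,
      ← ih n (by simpa using hn)]
    simp only [digitCode_cons_zero, digitCode_cons_succ]
    rcases b <;> simp

theorem eval_binary : eval x (binary t) ρ = (encodeBinary (t.eval x ρ)).map some := by
  simp only [binary, eval, eval_symbol, encodeBinary, List.map_append, List.map_map, eval_digit,
    Tm.eval, eval_eq, Function.update_apply, Nat.reduceEqDiff, reduceIte, List.map_cons,
    List.map_nil]
  rw [List.append_cancel_right_eq]
  refine Eq.trans ?_ (flatMap_digitCode _ _ (length_encodeNat_le _))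
  congr 1
  funext i
  by_cases h : digitCode (encodeNat (Tm.eval x t ρ)) i = 2 <;> simp [h]

end Em

/-! ### The matching graph of an election -/

/-- The contribution of a vote with first candidate `f` and last candidate `l` to the score of `c`. -/
def pairScore {α : Type} [DecidableEq α] (f l c : α) : ℤ :=
  (if c = f then 1 else 0) - (if c = l then 1 else 0)

theorem sum_pairScore {α : Type} [DecidableEq α] [Fintype α] (f l : α) :
    ∑ c, pairScore f l c = 0 := by
  simp [pairScore, Finset.sum_sub_distrib]

/-- The data of the matching graph: `m` candidates, `n` voters with their first and last candidates,
`N` copies of new votes, chains of length `r`, the score `T` of the preferred candidate `p`, and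
whether all voters have to keep their votes. -/
structure VoteGraph where
  m : ℕ
  n : ℕ
  N : ℕ
  r : ℕ
  T : ℕ
  fst : Fin n → Fin m
  lst : Fin n → Fin m
  p : Fin m
  forced : Bool

namespace VoteGraph

/-- The vertices on either side of the matching graph. -/
inductive Node (m n N r T : ℕ) : Type
  | unit (c : Fin m) (i : Fin (n + N))
  | slack (c : Fin m) (t : Fin T)
  | keep (v : Fin n)
  | chain (u : Fin n) (i : Fin N) (j : Fin r)

/-- The vertices as a sum type. -/
def Node.equiv (m n N r T : ℕ) : Node m n N r T ≃
    (Fin m × Fin (n + N)) ⊕ (Fin m × Fin T) ⊕ Fin n ⊕ (Fin n × Fin N × Fin r) where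
  toFun x := match x with
    | .unit c i => Sum.inl (c, i)
    | .slack c t => Sum.inr (Sum.inl (c, t))
    | .keep v => Sum.inr (Sum.inr (Sum.inl v))
    | .chain u i j => Sum.inr (Sum.inr (Sum.inr (u, i, j)))
  invFun x := match x with
    | Sum.inl (c, i) => .unit c i
    | Sum.inr (Sum.inl (c, t)) => .slack c t
    | Sum.inr (Sum.inr (Sum.inl v)) => .keep v
    | Sum.inr (Sum.inr (Sum.inr (u, i, j))) => .chain u i j
  left_inv := by rintro (_ | _ | _ | _) <;> rfl
  right_inv := by rintro (_ | _ | _ | _) <;> rfl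

instance (m n N r T : ℕ) : DecidableEq (Node m n N r T) :=
  (Node.equiv m n N r T).injective.decidableEq

instance (m n N r T : ℕ) : Fintype (Node m n N r T) := Fintype.ofEquiv _ (Node.equiv m n N r T).symm

theorem Node.sum_eq {m n N r T : ℕ} {A : Type} [AddCommMonoid A] (f : Node m n N r T → A) :
    ∑ x, f x = ∑ c, ∑ i, f (.unit c i) + (∑ c, ∑ t, f (.slack c t) + (∑ v, f (.keep v) +
      ∑ u, ∑ i, ∑ j, f (.chain u i j))) := by
  rw [← (Node.equiv m n N r T).symm.sum_comp, Fintype.sum_sum_type, Fintype.sum_sum_type,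
    Fintype.sum_sum_type, Fintype.sum_prod_type, Fintype.sum_prod_type, Fintype.sum_prod_type]
  simp only [Fintype.sum_prod_type]
  rfl

variable (G : VoteGraph)

/-- The vertices on either side of the matching graph. -/
abbrev V : Type := Node G.m G.n G.N G.r G.T

/-- The entries of the row of a candidate: `2` for a red edge, `1` for another edge, and `0`
otherwise. -/
def candidateEntry (c : Fin G.m) : G.V → ℕ
  | .unit d _ => if c = d then 1 else 0
  -- A slack column absorbs one point that a candidate lacks to `T`; the preferred candidate must
  -- reach `T` exactly.
  | .slack _ _ => if c = G.p then 0 else 1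
  | .keep v => if c = G.fst v then 1 else 0
  | .chain u _ j => if c = G.fst u ∧ (j : ℕ) = 0 then 2 else 0

/-- The entries of the adjacency matrix: `2` for a red edge, `1` for another edge, and `0`
otherwise. -/
def entry : G.V → G.V → ℕ
  | .unit c _, y => G.candidateEntry c y
  | .slack c _, y => G.candidateEntry c y
  | .keep v, .unit d _ => if d = G.lst v then 1 else 0
  | .keep _, .slack _ _ => 0
  -- A voter vertex matched to itself means that the vote is given up, at the price of one red edge.
  | .keep v, .keep v' => if v = v' ∧ G.forced = false then 2 else 0
  | .keep _, .chain _ _ _ => 0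
  | .chain u _ j, .unit d _ => if d = G.lst u ∧ (j : ℕ) + 1 = G.r then 1 else 0
  | .chain _ _ _, .slack _ _ => 0
  | .chain _ _ _, .keep _ => 0
  | .chain u i j, .chain u' i' j' =>
    -- A chain matched to itself is an unused copy of a vote. A used chain is shifted by one; its
    -- red entry edge and its `r - 1` red inner edges make `r` red edges.
    if u = u' ∧ i = i' then
      if (j : ℕ) = j' then 1 else if (j : ℕ) + 1 = j' then 2 else 0
    else 0

/-- The score of `c` if the voters in `X` keep their votes, and the new votes are those in `U`. -/
def total (X : Finset (Fin G.n)) (U : Finset (Fin G.n × Fin G.N)) (c : Fin G.m) : ℤ :=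
  ∑ v ∈ X, pairScore (G.fst v) (G.lst v) c + ∑ u ∈ U, pairScore (G.fst u.1) (G.lst u.1) c

/-! ### From a perfect matching to new votes -/

section matching

variable {G} {σ : Equiv.Perm G.V}


theorem keep_of_ne (hσ : ∀ x, G.entry x (σ x) ≠ 0)
    {v : Fin G.n} (h : σ (.keep v) ≠ .keep v) : ∃ i, σ (.keep v) = .unit (G.lst v) i := by
  have := hσ (.keep v)
  rcases hy : σ (.keep v) with ⟨d, i⟩ | _ | v' | _ <;> simp only [hy, entry] at this <;> grind

theorem chain_of_ne (hσ : ∀ x, G.entry x (σ x) ≠ 0)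
    {u : Fin G.n} {i : Fin G.N} {j : Fin G.r} (h : σ (.chain u i j) ≠ .chain u i j) :
    (∃ l, σ (.chain u i j) = .unit (G.lst u) l ∧ (j : ℕ) + 1 = G.r) ∨
      ∃ j', σ (.chain u i j) = .chain u i j' ∧ (j : ℕ) + 1 = j' := by
  have := hσ (.chain u i j)
  rcases hy : σ (.chain u i j) with ⟨d, l⟩ | _ | v' | ⟨u', i', j'⟩ <;>
    simp only [hy, entry] at this <;> grind

/-- A chain is shifted as a whole. The column `j + 1` can be matched only to the rows `j` and `j +
1` of the same chain, because candidates reach only its start. So a moving row `j + 1` leaves its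
column to row `j`, and a moving row `j` takes that column. -/
theorem chain_ne_iff (hσ : ∀ x, G.entry x (σ x) ≠ 0)
    (hr : 0 < G.r) {u : Fin G.n} {i : Fin G.N} (j : Fin G.r) :
    σ (.chain u i j) ≠ .chain u i j ↔ σ (.chain u i ⟨0, hr⟩) ≠ .chain u i ⟨0, hr⟩ := by
  obtain ⟨j, hj⟩ := j
  induction j with
  | zero => rfl
  | succ j ih =>
    rw [← ih (by omega)]
    constructor
    · intro h h'
      have h1 := hσ (σ.symm (.chain u i ⟨j + 1, hj⟩))
      rw [Equiv.apply_symm_apply] at h1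
      have h2 : σ (σ.symm (.chain u i ⟨j + 1, hj⟩)) = .chain u i ⟨j + 1, hj⟩ :=
        Equiv.apply_symm_apply _ _
      rcases hy : σ.symm (.chain u i ⟨j + 1, hj⟩) with ⟨d, l⟩ | _ | v' | ⟨u', i', j'⟩ <;>
        rw [hy] at h1 h2 <;> simp only [entry, candidateEntry] at h1
      · grind
      · grind
      · grind
      · have h3 : u' = u ∧ i' = i := by grind
        obtain ⟨rfl, rfl⟩ := h3
        have h4 : (j' : ℕ) = j + 1 ∨ (j' : ℕ) = j := by grind
        rcases h4 with h4 | h4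
        · obtain rfl : j' = ⟨j + 1, hj⟩ := Fin.ext h4
          exact h h2
        · have h5 : j' = ⟨j, by omega⟩ := Fin.ext h4
          rw [h5, h'] at h2
          simp at h2
    · intro h h'
      rcases chain_of_ne hσ h with ⟨l, _, h2⟩ | ⟨j', h1, h2⟩
      · simp only at h2
        omega
      · obtain rfl : j' = ⟨j + 1, hj⟩ := Fin.ext h2.symm
        rw [← h', σ.injective.eq_iff] at h1
        simp at h1

/-- Red edges are counted by their right endpoints. Units and slack columns have none, the column of
a voter has one if it is matched to itself, and a column of a chain has one exactly if its chain is
shifted. -/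
theorem card_red (hσ : ∀ x, G.entry x (σ x) ≠ 0) (hr : 0 < G.r) :
    (Finset.univ.filter fun x => G.entry x (σ x) = 2).card =
      (Finset.univ.filter fun v => σ (.keep v) = .keep v).card +
      G.r * (Finset.univ.filter fun u : Fin G.n × Fin G.N =>
        σ (.chain u.1 u.2 ⟨0, hr⟩) ≠ .chain u.1 u.2 ⟨0, hr⟩).card := by
  have h1 : ∀ y, G.entry (σ.symm y) y ≠ 0 := fun y => by
    simpa using hσ (σ.symm y)
  have h2 : (Finset.univ.filter fun x => G.entry x (σ x) = 2).card =
      ∑ y, if G.entry (σ.symm y) y = 2 then 1 else 0 := by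
    rw [Finset.card_filter, ← Equiv.sum_comp σ fun y => if G.entry (σ.symm y) y = 2 then 1 else 0]
    simp
  rw [h2, Node.sum_eq]
  have hu : ∀ c i, ¬ G.entry (σ.symm (.unit c i)) (.unit c i) = 2 := fun c i => by
    have := h1 (.unit c i)
    generalize σ.symm (.unit c i) = x at this ⊢
    rcases x <;> simp only [entry, candidateEntry] <;> grind
  have hs : ∀ c i, ¬ G.entry (σ.symm (.slack c i)) (.slack c i) = 2 := fun c i => by
    have := h1 (.slack c i)
    generalize σ.symm (.slack c i) = x at this ⊢
    rcases x <;> simp only [entry, candidateEntry] <;> grind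
  have hk : ∀ v, G.entry (σ.symm (.keep v)) (.keep v) = 2 ↔ σ (.keep v) = .keep v := fun v => by
    have := h1 (.keep v)
    rw [eq_comm (a := σ _), ← Equiv.symm_apply_eq]
    generalize σ.symm (.keep v) = x at this ⊢
    rcases x <;> simp only [entry, candidateEntry] at this ⊢ <;> grind
  have hc : ∀ u i j, G.entry (σ.symm (.chain u i j)) (.chain u i j) = 2 ↔
      σ (.chain u i ⟨0, hr⟩) ≠ .chain u i ⟨0, hr⟩ := fun u i j => by
    have := h1 (.chain u i j)
    rw [← chain_ne_iff hσ hr j, Ne, eq_comm (a := σ _), ← Equiv.symm_apply_eq]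
    generalize σ.symm (.chain u i j) = x at this ⊢
    rcases x <;> simp only [entry, candidateEntry] at this ⊢ <;> grind
  simp only [hu, hs, hk, hc, if_false, Finset.sum_const_zero, zero_add]
  rw [Finset.card_filter, Finset.card_filter, Fintype.sum_prod_type, Finset.mul_sum]
  simp only [Finset.sum_const, Finset.card_univ, Fintype.card_fin, smul_eq_mul, Finset.mul_sum]

/-- Conservation of flow at `c`. Give the rows and columns weights `φ` and `ψ` that mark those
belonging to `c`, with a vote vertex belonging to its first candidate. Summed over the edges, the
differences are the scores and the slack `s c` used by the rows of `c`. -/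
theorem exists_total (hσ : ∀ x, G.entry x (σ x) ≠ 0)
    (hr : 0 < G.r) : ∃ s : Fin G.m → ℕ, s G.p = 0 ∧ ∀ c, (G.T : ℤ) =
    G.total (Finset.univ.filter fun v => σ (.keep v) ≠ .keep v)
      (Finset.univ.filter fun u : Fin G.n × Fin G.N =>
        σ (.chain u.1 u.2 ⟨0, hr⟩) ≠ .chain u.1 u.2 ⟨0, hr⟩) c + s c := by
  let φ : Fin G.m → G.V → ℤ := fun c x => match x with
    | .unit d _ => if c = d then 1 else 0
    | .slack d _ => if c = d then 1 else 0
    | .keep v => if c = G.fst v then 1 else 0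
    | .chain u _ _ => if c = G.fst u then 1 else 0
  let ψ : Fin G.m → G.V → ℤ := fun c x => match x with
    | .unit d _ => if c = d then 1 else 0
    | .slack _ _ => 0
    | .keep v => if c = G.fst v then 1 else 0
    | .chain u _ _ => if c = G.fst u then 1 else 0
  let δ : Fin G.m → Fin G.m → G.V → ℕ := fun c d y => match y with
    | .slack _ _ => if c = d then 1 else 0
    | _ => 0
  have hcand : ∀ c d y, G.candidateEntry d y ≠ 0 →
      (if c = d then (1 : ℤ) else 0) - ψ c y = δ c d y := by
    intro c d y hy
    rcases y <;> simp only [candidateEntry, ψ, δ] at hy ⊢ <;> grind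
  have hp : ∀ d y, G.candidateEntry d y ≠ 0 → δ G.p d y = 0 := by
    intro d y hy
    rcases y <;> simp only [candidateEntry, δ] at hy ⊢ <;> grind
  refine ⟨fun c => ∑ d, ∑ i, δ c d (σ (.unit d i)) + ∑ d, ∑ t, δ c d (σ (.slack d t)), ?_, ?_⟩
  · have e1 : ∀ d i, δ G.p d (σ (.unit d i)) = 0 := fun d i => hp d _ (hσ (.unit d i))
    have e2 : ∀ d i, δ G.p d (σ (.slack d i)) = 0 := fun d i => hp d _ (hσ (.slack d i))
    simp [e1, e2]
  · intro c
    -- Since `σ` is a permutation, the sum is the total of `φ` minus that of `ψ`; they differ only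
    -- in the `T` slack rows of `c`.
    have h1 : ∑ x, (φ c x - ψ c (σ x)) = G.T := by
      rw [Finset.sum_sub_distrib, Equiv.sum_comp σ (ψ c), Node.sum_eq, Node.sum_eq]
      simp [φ, ψ]
    rw [← h1, Node.sum_eq, total]
    have e1 : ∀ d i, φ c (.unit d i) - ψ c (σ (.unit d i)) = δ c d (σ (.unit d i)) :=
      fun d i => hcand c d _ (hσ (.unit d i))
    have e2 : ∀ d i, φ c (.slack d i) - ψ c (σ (.slack d i)) = δ c d (σ (.slack d i)) :=
      fun d i => hcand c d _ (hσ (.slack d i))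
    have e3 : ∀ v, φ c (.keep v) - ψ c (σ (.keep v)) =
        if σ (.keep v) ≠ .keep v then pairScore (G.fst v) (G.lst v) c else 0 := fun v => by
      by_cases h : σ (.keep v) = .keep v
      · rw [h]
        simp [φ, ψ]
      · obtain ⟨i, hi⟩ := keep_of_ne hσ h
        rw [if_pos h, hi]
        simp [φ, ψ, pairScore]
    -- Within a shifted chain the weights agree; only its last row, matched to a unit of the last
    -- candidate, carries the score of the vote.
    have e4 : ∀ u i j, φ c (.chain u i j) - ψ c (σ (.chain u i j)) =
        if (j : ℕ) + 1 = G.r then if σ (.chain u i ⟨0, hr⟩) ≠ .chain u i ⟨0, hr⟩ then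
          pairScore (G.fst u) (G.lst u) c else 0 else 0 := fun u i j => by
      have hi := chain_ne_iff hσ hr (u := u) (i := i) j
      by_cases h : σ (.chain u i j) = .chain u i j
      · rw [if_neg (mt hi.2 (not_not.2 h)), h]
        simp [φ, ψ]
      · rw [if_pos (hi.1 h)]
        rcases chain_of_ne hσ h with ⟨l, hl, hj⟩ | ⟨j', hl, hj⟩
        · rw [hl, if_pos hj]
          simp [φ, ψ, pairScore]
        · rw [hl, if_neg (by omega)]
          simp [φ, ψ]
    have e5 : ∀ a : ℤ, ∑ j : Fin G.r, (if (j : ℕ) + 1 = G.r then a else 0) = a := fun a => by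
      rw [Finset.sum_eq_single ⟨G.r - 1, by omega⟩]
      · simp only
        rw [if_pos (by omega)]
      · intro j _ hj
        rw [if_neg]
        intro h
        exact hj (Fin.ext (by simp only; omega))
      · simp
    simp only [e1, e2, e3, e4, e5]
    rw [Finset.sum_filter, Finset.sum_filter, Fintype.sum_prod_type]
    push_cast
    ring

end matching

/-- Both families of fibre sizes sum to the size of `α`, so the inequalities are equalities, and
bijections between the fibres glue to a permutation. A matching is thereby reduced to counting
labels. -/
theorem exists_perm_of_label {α L : Type} [Fintype α] [Fintype L] [DecidableEq L] (l r : α → L)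
    (h : ∀ t, (Finset.univ.filter fun x => l x = t).card ≤ (Finset.univ.filter fun x => r x = t).card) :
    ∃ σ : Equiv.Perm α, ∀ x, r (σ x) = l x := by
  classical
  have hs : ∀ f : α → L, ∑ t, (Finset.univ.filter fun x => f x = t).card = Fintype.card α := fun f =>
    (Finset.card_eq_sum_card_fiberwise (t := Finset.univ) (by simp)).symm
  have he := (Finset.sum_eq_sum_iff_of_le fun t _ => h t).1 ((hs l).trans (hs r).symm)
  have e : ∀ t, Nonempty ({x // l x = t} ≃ {x // r x = t}) := fun t => by
    refine ⟨Fintype.equivOfCardEq ?_⟩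
    rw [Fintype.card_subtype, Fintype.card_subtype]
    exact he t (Finset.mem_univ t)
  exact ⟨Equiv.ofFiberEquiv fun t => (e t).some, fun x => Equiv.ofFiberEquiv_map _ x⟩

theorem exists_card_fiber {α ι : Type} [Fintype α] [Fintype ι] [DecidableEq ι] (f : ι → ℕ)
    (h : ∑ i, f i = Fintype.card α) :
    ∃ g : α → ι, ∀ i, (Finset.univ.filter fun x => g x = i).card = f i := by
  have e : α ≃ Σ i, Fin (f i) := Fintype.equivOfCardEq (by simp [h])
  refine ⟨fun x => (e x).1, fun i => ?_⟩
  rw [Finset.card_filter, Equiv.sum_comp e fun y => if y.1 = i then 1 else 0, Fintype.sum_sigma]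
  rw [Finset.sum_eq_single i]
  · simp
  · intro b _ hb
    simp [hb]
  · simp

theorem sum_fin_lt {a b : ℕ} (h : a ≤ b) : ∑ i : Fin b, (if (i : ℕ) < a then 1 else 0) = a := by
  rw [← Finset.card_filter, Fin.card_filter_val_lt]
  omega

theorem sum_fin_ge {a b : ℕ} (h : a ≤ b) : ∑ i : Fin b, (if (i : ℕ) < a then 0 else 1) = b - a := by
  have h1 := sum_fin_lt h
  have h2 : ∑ i : Fin b, ((if (i : ℕ) < a then 0 else 1) + if (i : ℕ) < a then 1 else 0) = b := by
    rw [Finset.sum_congr rfl fun i _ => (show _ = 1 by split_ifs <;> rfl)]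
    simp
  rw [Finset.sum_add_distrib] at h2
  omega

/-- The labels of the vertices in a matching that is built from the new votes. -/
abbrev Label : Type := Fin G.m ⊕ Fin G.m ⊕ G.V

/-! ### From new votes to a perfect matching -/

section labels

variable (X : Finset (Fin G.n)) (U : Finset (Fin G.n × Fin G.N)) (g : Fin G.m × Fin G.T → Fin G.m)

/-- The number of last places of `c`. -/
def lastPlaces (c : Fin G.m) : ℕ :=
  (X.filter fun v => G.lst v = c).card + (U.filter fun u => G.lst u.1 = c).card

/-- The number of first places of `c`. -/
def firstPlaces (c : Fin G.m) : ℕ :=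
  (X.filter fun v => G.fst v = c).card + (U.filter fun u => G.fst u.1 = c).card

/-- The labels of the left vertices. -/
def leftLabel : G.V → G.Label
  | .unit c _ => .inl c
  | .slack c _ => .inl c
  | .keep v => if v ∈ X then .inr (.inl (G.lst v)) else .inr (.inr (.keep v))
  | .chain u i j => if (u, i) ∈ U then
      if h : (j : ℕ) + 1 < G.r then .inr (.inr (.chain u i ⟨j + 1, h⟩)) else .inr (.inl (G.lst u))
      else .inr (.inr (.chain u i j))

/-- The labels of the right vertices. -/
def rightLabel : G.V → G.Label
  | .unit c i => if (i : ℕ) < G.lastPlaces X U c then .inr (.inl c) else .inl c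
  | .slack c t => .inl (g (c, t))
  | .keep v => if v ∈ X then .inl (G.fst v) else .inr (.inr (.keep v))
  | .chain u i j => if (u, i) ∈ U ∧ (j : ℕ) = 0 then .inl (G.fst u) else .inr (.inr (.chain u i j))

theorem total_eq (c : Fin G.m) : G.total X U c = G.firstPlaces X U c - G.lastPlaces X U c := by
  simp only [total, pairScore, firstPlaces, lastPlaces, Finset.sum_sub_distrib, Finset.card_filter,
    eq_comm (a := c)]
  push_cast
  ring

/-- This is why `n + N` units per candidate suffice: each last place of `c` occupies one unit
column. -/
theorem lastPlaces_le (c : Fin G.m) (hU : U.card ≤ G.N) : G.lastPlaces X U c ≤ G.n + G.N := by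
  have h1 := Finset.card_filter_le X fun v => G.lst v = c
  have h2 := Finset.card_filter_le U fun u => G.lst u.1 = c
  have h3 := Finset.card_le_univ X
  rw [Fintype.card_fin] at h3
  unfold lastPlaces
  omega

theorem sum_total : ∑ c, G.total X U c = 0 := by
  simp only [total, Finset.sum_add_distrib]
  rw [Finset.sum_comm, Finset.sum_comm (t := U)]
  simp [sum_pairScore]

end labels

/-- On the left there are `n + N + T` rows of `c`. On the right there are the unit columns not used
for last places, the `T - total` slack columns given to `c` by `g`, and the first places of `c`. The
counts agree because the score is the number of first places minus the number of last places. -/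
theorem card_out (hr : 0 < G.r) (X : Finset (Fin G.n)) (U : Finset (Fin G.n × Fin G.N))
    (g : Fin G.m × Fin G.T → Fin G.m) (hU : U.card ≤ G.N)
    (hg : ∀ c, ((Finset.univ.filter fun x => g x = c).card : ℤ) = G.T - G.total X U c) (c : Fin G.m) :
    (Finset.univ.filter fun x => G.leftLabel X U x = .inl c).card =
      (Finset.univ.filter fun x => G.rightLabel X U g x = .inl c).card := by
  rw [Finset.card_filter, Finset.card_filter, Node.sum_eq, Node.sum_eq]
  have l1 : ∀ d i, (if G.leftLabel X U (.unit d i) = .inl c then 1 else 0) = if d = c then 1 else 0 :=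
    fun d i => by simp [leftLabel]
  have l2 : ∀ d i, (if G.leftLabel X U (.slack d i) = .inl c then 1 else 0) = if d = c then 1 else 0 :=
    fun d i => by simp [leftLabel]
  have l3 : ∀ v, (if G.leftLabel X U (.keep v) = .inl c then 1 else 0) = 0 :=
    fun v => by simp only [leftLabel]; split_ifs <;> simp_all
  have l4 : ∀ u i j, (if G.leftLabel X U (.chain u i j) = .inl c then 1 else 0) = 0 :=
    fun u i j => by simp only [leftLabel]; split_ifs <;> simp_all
  have r1 : ∀ d i, (if G.rightLabel X U g (.unit d i) = .inl c then 1 else 0) =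
    if d = c then if (i : ℕ) < G.lastPlaces X U c then 0 else 1 else 0 :=
    fun d i => by simp only [rightLabel]; split_ifs <;> simp_all
  have r2 : ∀ d i, (if G.rightLabel X U g (.slack d i) = .inl c then 1 else 0) =
    if g (d, i) = c then 1 else 0 := fun d i => by simp [rightLabel]
  have r3 : ∀ v, (if G.rightLabel X U g (.keep v) = .inl c then 1 else 0) =
    if v ∈ X then if G.fst v = c then 1 else 0 else 0 :=
    fun v => by simp only [rightLabel]; split_ifs <;> simp_all
  have r4 : ∀ u i j, (if G.rightLabel X U g (.chain u i j) = .inl c then 1 else 0) =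
    if (j : ℕ) = 0 then if (u, i) ∈ U then if G.fst u = c then 1 else 0 else 0 else 0 :=
    fun u i j => by simp only [rightLabel]; split_ifs <;> simp_all
  have h0 : ∀ a : ℕ, ∑ j : Fin G.r, (if (j : ℕ) = 0 then a else 0) = a := fun a => by
    rw [Finset.sum_eq_single ⟨0, hr⟩] <;> simp +contextual [Fin.ext_iff]
  simp only [l1, l2, l3, l4, r1, r2, r3, r4, h0]
  have hm := G.lastPlaces_le X U c hU
  have ht := G.total_eq X U c
  have hgc := hg c
  rw [Finset.card_filter, Fintype.sum_prod_type] at hgc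
  have e1 : (G.firstPlaces X U c) = ∑ v, (if v ∈ X then if G.fst v = c then 1 else 0 else 0) +
      ∑ u, ∑ i, (if (u, i) ∈ U then if G.fst u = c then 1 else 0 else 0) := by
    rw [← Fintype.sum_prod_type fun x => if x ∈ U then if G.fst x.1 = c then 1 else 0 else 0]
    simp only [firstPlaces, Finset.card_filter, Finset.sum_ite_mem, Finset.univ_inter]
  have e2 : ∑ d : Fin G.m, ∑ i : Fin (G.n + G.N),
      (if d = c then if (i : ℕ) < G.lastPlaces X U c then 0 else 1 else 0) =
      G.n + G.N - G.lastPlaces X U c := by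
    rw [Finset.sum_eq_single c]
    · simp only [if_true]
      exact sum_fin_ge hm
    · intro d _ hd
      simp [hd]
    · simp
  rw [e2]
  simp only [Finset.sum_const, Finset.card_univ, Fintype.card_fin, smul_eq_mul, mul_ite, mul_one,
    mul_zero, Finset.sum_ite_eq', Finset.mem_univ, if_true]
  push_cast at hgc
  zify [hm] at e1 ⊢
  linarith

/-- The votes that end in `c` are matched with the unit columns of `c` with the smallest indices,
which `rightLabel` reserves for them. -/
theorem card_inn (hr : 0 < G.r) (X : Finset (Fin G.n)) (U : Finset (Fin G.n × Fin G.N))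
    (g : Fin G.m × Fin G.T → Fin G.m) (hU : U.card ≤ G.N)
    (c : Fin G.m) :
    (Finset.univ.filter fun x => G.leftLabel X U x = .inr (.inl c)).card =
      (Finset.univ.filter fun x => G.rightLabel X U g x = .inr (.inl c)).card := by
  rw [Finset.card_filter, Finset.card_filter, Node.sum_eq, Node.sum_eq]
  have l1 : ∀ d i, (if G.leftLabel X U (.unit d i) = .inr (.inl c) then 1 else 0) = 0 :=
    fun d i => by simp [leftLabel]
  have l2 : ∀ d i, (if G.leftLabel X U (.slack d i) = .inr (.inl c) then 1 else 0) = 0 :=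
    fun d i => by simp [leftLabel]
  have l3 : ∀ v, (if G.leftLabel X U (.keep v) = .inr (.inl c) then 1 else 0) =
    if v ∈ X then if G.lst v = c then 1 else 0 else 0 :=
    fun v => by simp only [leftLabel]; split_ifs <;> simp_all
  have l4 : ∀ u i j, (if G.leftLabel X U (.chain u i j) = .inr (.inl c) then 1 else 0) =
    if (j : ℕ) + 1 = G.r then if (u, i) ∈ U then if G.lst u = c then 1 else 0 else 0 else 0 :=
    fun u i j => by
      have := j.2
      simp only [leftLabel]
      split_ifs <;> simp_all <;> omega
  have r1 : ∀ d i, (if G.rightLabel X U g (.unit d i) = .inr (.inl c) then 1 else 0) =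
    if d = c then if (i : ℕ) < G.lastPlaces X U c then 1 else 0 else 0 :=
    fun d i => by simp only [rightLabel]; split_ifs <;> simp_all
  have r2 : ∀ d i, (if G.rightLabel X U g (.slack d i) = .inr (.inl c) then 1 else 0) = 0 :=
    fun d i => by simp [rightLabel]
  have r3 : ∀ v, (if G.rightLabel X U g (.keep v) = .inr (.inl c) then 1 else 0) = 0 :=
    fun v => by simp only [rightLabel]; split_ifs <;> simp_all
  have r4 : ∀ u i j, (if G.rightLabel X U g (.chain u i j) = .inr (.inl c) then 1 else 0) = 0 :=
    fun u i j => by simp only [rightLabel]; split_ifs <;> simp_all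
  have h0 : ∀ a : ℕ, ∑ j : Fin G.r, (if (j : ℕ) + 1 = G.r then a else 0) = a := fun a => by
    rw [Finset.sum_eq_single ⟨G.r - 1, by omega⟩]
    · rw [if_pos]
      simp only
      omega
    · intro j _ hj
      rw [if_neg]
      intro h
      exact hj (Fin.ext (by simp only; omega))
    · simp
  simp only [l1, l2, l3, l4, r1, r2, r3, r4, h0]
  have hm := G.lastPlaces_le X U c hU
  have e1 : (G.lastPlaces X U c) = ∑ v, (if v ∈ X then if G.lst v = c then 1 else 0 else 0) +
      ∑ u, ∑ i, (if (u, i) ∈ U then if G.lst u = c then 1 else 0 else 0) := by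
    rw [← Fintype.sum_prod_type fun x => if x ∈ U then if G.lst x.1 = c then 1 else 0 else 0]
    simp only [lastPlaces, Finset.card_filter, Finset.sum_ite_mem, Finset.univ_inter]
  have e2 : ∑ d : Fin G.m, ∑ i : Fin (G.n + G.N),
      (if d = c then if (i : ℕ) < G.lastPlaces X U c then 1 else 0 else 0) =
      G.lastPlaces X U c := by
    rw [Finset.sum_eq_single c]
    · simp only [if_true]
      exact sum_fin_lt hm
    · intro d _ hd
      simp [hd]
    · simp
  rw [e2, e1]
  simp

/-- The label of a column `y` prescribes `y` as the partner. At most one row carries it, and none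
does if `y` itself is labelled as a place for a candidate. -/
theorem card_node_le (X : Finset (Fin G.n)) (U : Finset (Fin G.n × Fin G.N))
    (g : Fin G.m × Fin G.T → Fin G.m) (y : G.V) :
    (Finset.univ.filter fun x => G.leftLabel X U x = .inr (.inr y)).card ≤
      (Finset.univ.filter fun x => G.rightLabel X U g x = .inr (.inr y)).card := by
  by_cases hy : G.rightLabel X U g y = .inr (.inr y)
  · refine le_trans (Finset.card_le_one.2 ?_) (Finset.card_pos.2 ⟨y, by simpa using hy⟩)
    intro a ha b hb
    simp only [Finset.mem_filter, Finset.mem_univ, true_and] at ha hb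
    rcases a <;> rcases b <;> simp only [leftLabel] at ha hb <;>
      (try split_ifs at ha hb) <;> simp_all <;> grind
  · rw [Finset.filter_eq_empty_iff.2]
    · simp
    · intro x _ hx
      apply hy
      rcases x <;> simp only [leftLabel] at hx
      · grind
      · grind
      · grind [rightLabel]
      · grind [rightLabel]


theorem card_filter_not {α : Type} [Fintype α] (X : Finset α) [DecidableEq α] :
    (Finset.univ.filter fun x => x ∉ X).card = Fintype.card α - X.card := by
  rw [← Finset.card_compl]
  congr 1
  ext x
  simp

/-- New votes with the required scores give a perfect matching. -/
theorem exists_perm (hr : 0 < G.r) (X : Finset (Fin G.n)) (U : Finset (Fin G.n × Fin G.N))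
    (hX : G.forced = true → X = Finset.univ) (hU : U.card ≤ G.N)
    (ht : ∀ c, G.total X U c ≤ G.T) (hp : G.total X U G.p = G.T) :
    ∃ σ : Equiv.Perm G.V, (∀ x, G.entry x (σ x) ≠ 0) ∧
      (Finset.univ.filter fun x => G.entry x (σ x) = 2).card = G.n - X.card + G.r * U.card := by
  -- The slack columns are distributed so that each candidate gets what it lacks to `T`. There are
  -- `m * T` of them, which is the total need because the scores sum to zero; `p` gets none.
  obtain ⟨g, hg⟩ := exists_card_fiber (α := Fin G.m × Fin G.T)
    (fun c => (G.T - G.total X U c).toNat) (by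
      zify
      rw [Finset.sum_congr rfl fun c _ => Int.toNat_of_nonneg (sub_nonneg.2 (ht c)),
        Finset.sum_sub_distrib, sum_total]
      simp)
  have hg' : ∀ c, ((Finset.univ.filter fun x => g x = c).card : ℤ) = G.T - G.total X U c := by
    intro c
    rw [hg c, Int.toNat_of_nonneg (sub_nonneg.2 (ht c))]
  have hgp : ∀ x, g x ≠ G.p := by
    have h := hg' G.p
    rw [hp, sub_self, Int.natCast_eq_zero, Finset.card_eq_zero, Finset.filter_eq_empty_iff] at h
    exact fun x => h (Finset.mem_univ x)
  obtain ⟨σ, hσ⟩ := exists_perm_of_label (G.leftLabel X U) (G.rightLabel X U g) (by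
    rintro (c | c | y)
    · exact (G.card_out hr X U g hU hg' c).le
    · exact (G.card_inn hr X U g hU c).le
    · exact G.card_node_le X U g y)
  have hc : ∀ c y, G.rightLabel X U g y = .inl c → G.candidateEntry c y ≠ 0 := by
    intro c y h
    rcases y with _ | ⟨d, t⟩ | _ | _ <;> simp only [rightLabel, candidateEntry] at h ⊢
    · split_ifs at h <;> simp_all
    · have := hgp (d, t)
      simp_all
    · split_ifs at h <;> simp_all
    · split_ifs at h <;> simp_all
  have hk : ∀ v, v ∉ X ↔ σ (.keep v) = .keep v := by
    intro v
    have h := hσ (.keep v)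
    generalize σ (.keep v) = y at h ⊢
    simp only [leftLabel] at h
    rcases y <;> simp only [rightLabel] at h <;> grind
  have hu : ∀ u : Fin G.n × Fin G.N, u ∈ U ↔
      σ (.chain u.1 u.2 ⟨0, hr⟩) ≠ .chain u.1 u.2 ⟨0, hr⟩ := by
    rintro ⟨u, i⟩
    have h := hσ (.chain u i ⟨0, hr⟩)
    generalize σ (.chain u i ⟨0, hr⟩) = y at h ⊢
    simp only [leftLabel] at h
    rcases y <;> simp only [rightLabel] at h <;> grind
  have he : ∀ x, G.entry x (σ x) ≠ 0 := by
    intro x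
    have h := hσ x
    rcases x with ⟨c, i⟩ | ⟨c, t⟩ | v | ⟨u, i, j⟩
    · exact hc c _ h
    · exact hc c _ h
    · by_cases hv : v ∈ X
      · generalize σ (.keep v) = y at h ⊢
        simp only [leftLabel, if_pos hv] at h
        rcases y <;> simp only [rightLabel] at h <;> grind [entry]
      · rw [(hk v).1 hv]
        have : G.forced = false := by
          by_contra hf
          rw [hX (by simpa using hf)] at hv
          simp at hv
        simp [entry, this]
    · generalize σ (.chain u i j) = y at h ⊢
      simp only [leftLabel] at h
      rcases y <;> simp only [rightLabel] at h <;> simp only [entry] <;> grind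
  refine ⟨σ, he, ?_⟩
  rw [card_red he hr]
  congr 2
  · rw [Finset.filter_congr fun v _ => (hk v).symm, card_filter_not, Fintype.card_fin]
  · rw [Finset.filter_congr fun u _ => (hu u).symm]
    simp

/-- A perfect matching gives new votes with the required scores. -/
theorem exists_votes (hr : 0 < G.r) {σ : Equiv.Perm G.V} (hσ : ∀ x, G.entry x (σ x) ≠ 0) :
    ∃ (X : Finset (Fin G.n)) (U : Finset (Fin G.n × Fin G.N)),
      (G.forced = true → X = Finset.univ) ∧
      (∀ c, G.total X U c ≤ G.T) ∧ G.total X U G.p = G.T ∧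
      (Finset.univ.filter fun x => G.entry x (σ x) = 2).card = G.n - X.card + G.r * U.card := by
  obtain ⟨s, hs, h⟩ := exists_total hσ hr
  refine ⟨Finset.univ.filter fun v => σ (.keep v) ≠ .keep v,
    Finset.univ.filter fun u : Fin G.n × Fin G.N =>
      σ (.chain u.1 u.2 ⟨0, hr⟩) ≠ .chain u.1 u.2 ⟨0, hr⟩, ?_, fun c => ?_, ?_, ?_⟩
  rotate_left
  · rw [h c]
    exact le_add_of_nonneg_right (by positivity)
  · rw [h G.p, hs]
    simp
  · rw [card_red hσ hr]
    congr 1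
    have := card_filter_not (Finset.univ.filter fun v => σ (.keep v) ≠ .keep v)
    rw [Fintype.card_fin] at this
    rw [← this]
    simp
  · intro hf
    refine Finset.filter_true_of_mem fun v _ hv => hσ (.keep v) ?_
    rw [hv]
    simp [entry, hf]

end VoteGraph

/-! ### Reading an election -/

namespace Tm

theorem blockLength_unary_zero (a : ℕ) (y : List Γ') : blockLength (encodeUnary a ++ y) 0 = a := by
  induction a with
  | zero => simp [encodeUnary, blockLength]
  | succ a ih =>
    have : encodeUnary (a + 1) ++ y = Γ'.bit true :: (encodeUnary a ++ y) := by
      simp [encodeUnary, List.replicate_succ]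
    rw [this, blockLength, ih]
    simp [add_comm]

theorem blockLength_unary_succ (a j : ℕ) (y : List Γ') :
    blockLength (encodeUnary a ++ y) (j + 1) = blockLength y j := by
  induction a with
  | zero => simp [encodeUnary, blockLength]
  | succ a ih =>
    have : encodeUnary (a + 1) ++ y = Γ'.bit true :: (encodeUnary a ++ y) := by
      simp [encodeUnary, List.replicate_succ]
    rw [this, blockLength, ih]
    simp

theorem blockLength_binary_succ (k j : ℕ) (y : List Γ') :
    blockLength (encodeBinary k ++ y) (j + 1) = blockLength y j := by
  unfold encodeBinary
  generalize encodeNat k = l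
  induction l with
  | nil => simp [blockLength]
  | cons b l ih =>
    rw [List.map_cons, List.cons_append, List.cons_append, blockLength]
    simpa using ih

theorem blockLength_bra (j : ℕ) (y : List Γ') : blockLength (Γ'.bra :: y) j = blockLength y j := by
  simp [blockLength]

theorem blockLength_ket (j : ℕ) (y : List Γ') : blockLength (Γ'.ket :: y) j = blockLength y j := by
  simp [blockLength]

end Tm

theorem concat_succ {n : ℕ} (s : Fin (n + 1) → List Γ') :
    concat s = s 0 ++ concat fun i => s i.succ := by
  simp [concat, List.ofFn_succ]

namespace Tm

theorem blockLength_concat_unary {n : ℕ} (f : Fin n → ℕ) (y : List Γ') :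
    (∀ i : Fin n, blockLength (concat (fun i => encodeUnary (f i)) ++ y) i = f i) ∧
      ∀ j, blockLength (concat (fun i => encodeUnary (f i)) ++ y) (n + j) = blockLength y j := by
  induction n with
  | zero => exact ⟨fun i => i.elim0, fun j => by simp [concat]⟩
  | succ n ih =>
    obtain ⟨h1, h2⟩ := ih fun i => f i.succ
    rw [concat_succ, List.append_assoc]
    constructor
    · intro i
      cases i using Fin.cases with
      | zero => exact blockLength_unary_zero _ _
      | succ i => rw [Fin.val_succ, blockLength_unary_succ, h1 i]
    · intro j
      rw [show n + 1 + j = n + j + 1 by ring, blockLength_unary_succ, h2 j]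

/-- Brackets do not affect the blocks between commas, so the votes form one array of unary numbers
with `m` entries per row. -/
theorem blockLength_concat_vote {m n : ℕ} (V : Fin n → Vote m) (y : List Γ') (v : Fin n) (q : Fin m) :
    blockLength (concat (fun v => encodeVote (V v)) ++ y) (v * m + q) = V v q := by
  induction n with
  | zero => exact v.elim0
  | succ n ih =>
    have h1 := blockLength_concat_unary (fun i => (V 0 i : ℕ))
      ([Γ'.ket] ++ (concat (fun i : Fin n => encodeVote (V i.succ)) ++ y))
    rw [concat_succ]
    simp only [encodeVote, List.cons_append, List.append_assoc, blockLength_bra] at h1 ⊢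
    cases v using Fin.cases with
    | zero =>
      rw [Fin.val_zero, zero_mul, zero_add]
      exact h1.1 q
    | succ v =>
      rw [Fin.val_succ, show ((v : ℕ) + 1) * m + q = m + (v * m + q) by ring]
      refine (h1.2 _).trans ?_
      rw [List.nil_append, blockLength_ket]
      exact ih (fun i => V i.succ) v

theorem blockLength_election (E : Election) :
    blockLength (encodeElection E) 0 = E.m ∧ blockLength (encodeElection E) 1 = E.n ∧
    blockLength (encodeElection E) 2 = E.p ∧
    ∀ (v : Fin E.n) (q : Fin E.m), blockLength (encodeElection E) (3 + v * E.m + q) = E.vote v q := by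
  unfold encodeElection
  refine ⟨blockLength_unary_zero _ _, ?_, ?_, fun v q => ?_⟩
  · rw [blockLength_unary_succ, blockLength_unary_zero]
  · rw [blockLength_unary_succ, blockLength_unary_succ, blockLength_unary_zero]
  · rw [show 3 + (v : ℕ) * E.m + q = v * E.m + q + 1 + 1 + 1 by ring, blockLength_unary_succ,
      blockLength_unary_succ, blockLength_unary_succ]
    simpa using blockLength_concat_vote E.vote [] v q

end Tm

/-! ### Scores -/

/-- The first candidate of a vote. -/
def Election.first (E : Election) (v : Vote E.m) : Fin E.m := v ⟨0, E.p.pos⟩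

/-- The last candidate of a vote. -/
def Election.last (E : Election) (v : Vote E.m) : Fin E.m := v ⟨E.m - 1, by have := E.p.pos; omega⟩

/-- Both sides are differences of indicators, so this also holds for a single candidate, who is
first and last at once. -/
theorem Election.score_eq (E : Election) {n : ℕ} (V : Fin n → Vote E.m) (c : Fin E.m) :
    score (firstLastVector E.m) V c = ∑ v, pairScore (E.first (V v)) (E.last (V v)) c := by
  refine Finset.sum_congr rfl fun v _ => ?_
  have hm := E.p.pos
  simp only [firstLastVector, pairScore, Election.first, Election.last, ← Equiv.symm_apply_eq,
    Fin.ext_iff]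
  congr 2
  exact propext (by omega)

/-- A candidate wins if and only if its score is an upper bound for all scores. -/
theorem mem_firstLast_iff (E : Election) {n : ℕ} (V : Fin n → Vote E.m) (p : Fin E.m) :
    p ∈ firstLast E.m n V ↔ ∃ T ≤ n, (∀ c, score (firstLastVector E.m) V c ≤ T) ∧
      score (firstLastVector E.m) V p = T := by
  constructor
  · intro h
    -- Since the scores sum to zero, the highest one is nonnegative. This makes it a natural number
    -- `T ≤ n`, of which there are few to try.
    have h0 : ∑ c, score (firstLastVector E.m) V c = 0 := by
      simp only [E.score_eq]
      rw [Finset.sum_comm]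
      simp [sum_pairScore]
    have h1 : 0 ≤ score (firstLastVector E.m) V p := by
      by_contra! hneg
      have : ∑ c, score (firstLastVector E.m) V c < 0 := by
        refine Finset.sum_neg (fun c _ => (h c).trans_lt hneg) ⟨p, Finset.mem_univ p⟩
      omega
    have h2 : score (firstLastVector E.m) V p ≤ n := by
      rw [E.score_eq]
      refine (Finset.sum_le_card_nsmul _ _ 1 fun v _ => ?_).trans (by simp)
      unfold pairScore
      split_ifs <;> norm_num
    exact ⟨(score (firstLastVector E.m) V p).toNat, by omega,
      fun c => by rw [Int.toNat_of_nonneg h1]; exact h c, (Int.toNat_of_nonneg h1).symm⟩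
  · rintro ⟨T, _, h1, h2⟩ c
    exact (h1 c).trans h2.ge

/-! ### Matching instances from lists of vertices -/

theorem flatMap_range {β : Type} (n : ℕ) (f : ℕ → List β) :
    (List.range n).flatMap f = (List.finRange n).flatMap fun i : Fin n => f i := by
  rw [← List.map_coe_finRange_eq_range, List.flatMap_map]

theorem concat_getElem {α : Type} (l : List α) (f : α → List Γ') :
    (concat fun i : Fin l.length => f (l[i])) = l.flatMap f := by
  rw [concat, List.flatMap_def]
  congr 1
  refine List.ext_getElem (by simp) fun i h1 h2 => ?_
  simp

/-- The matching instance whose vertices, on either side, are the members of a list, and whose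
adjacency matrix is given by a function. -/
def MatchingInstance.ofList {α : Type} (l : List α) (entry : α → α → ℕ) (k : ℕ) : MatchingInstance where
  a := l.length
  b := l.length
  edges := Finset.univ.filter fun x => entry l[x.1] l[x.2] ≠ 0
  red := Finset.univ.filter fun x => entry l[x.1] l[x.2] = 2
  red_subset := fun x hx => by
    simp only [Finset.mem_filter, Finset.mem_univ, true_and] at hx ⊢
    omega
  k := k

/-- The symbol for an entry of the adjacency matrix. -/
def entrySymbol (t : ℕ) : Γ' :=
  if t = 2 then Γ'.bit true else if t = 0 then Γ'.blank else Γ'.bit false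

theorem encodeMatching_ofList {α : Type} (l : List α) (entry : α → α → ℕ) (k : ℕ) :
    encodeMatching (.ofList l entry k) = encodeBinary k ++ (encodeUnary l.length ++
      (encodeUnary l.length ++ l.flatMap fun x =>
        Γ'.bra :: (l.flatMap (fun y => [entrySymbol (entry x y)]) ++ [Γ'.ket]))) := by
  rw [← concat_getElem l fun x => Γ'.bra :: (l.flatMap (fun y => [entrySymbol (entry x y)]) ++ [Γ'.ket])]
  simp only [← concat_getElem l fun y => [entrySymbol (entry _ y)]]
  have he : ∀ i j : Fin l.length, encodePair
      (decide ((i, j) ∈ Finset.univ.filter fun x : Fin l.length × Fin l.length =>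
        entry l[x.1] l[x.2] ≠ 0))
      (decide ((i, j) ∈ Finset.univ.filter fun x : Fin l.length × Fin l.length =>
        entry l[x.1] l[x.2] = 2)) = [entrySymbol (entry l[i] l[j])] := by
    intro i j
    simp only [encodePair, entrySymbol, Finset.mem_filter, Finset.mem_univ, true_and,
      decide_eq_true_eq, ne_eq, ite_not]
  simp only [← he]
  rfl

/-- With both sides identified with `α`, the partner function of a perfect matching is injective on
a finite type, hence a permutation; conversely, the graph of a permutation consisting of edges is a
perfect matching. -/
theorem hasExactMatching_iff {I : MatchingInstance} {α : Type} [Fintype α] [DecidableEq α]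
    (eA : Fin I.a ≃ α) (eB : Fin I.b ≃ α) :
    HasExactMatching I ↔ ∃ σ : Equiv.Perm α, (∀ x, (eA.symm x, eB.symm (σ x)) ∈ I.edges) ∧
      (Finset.univ.filter fun x => (eA.symm x, eB.symm (σ x)) ∈ I.red).card = I.k := by
  constructor
  · rintro ⟨M, ⟨hM, hA, hB⟩, hk⟩
    choose e he hu using hA
    have hinj : Function.Injective fun x => eB (e (eA.symm x)).2 := by
      intro x y hxy
      have h := (hB (e (eA.symm x)).2).unique ⟨(he _).1, rfl⟩
        ⟨(he (eA.symm y)).1, (eB.injective hxy).symm⟩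
      have h1 := (he (eA.symm x)).2
      rw [h, (he (eA.symm y)).2] at h1
      exact (eA.symm.injective h1).symm
    let σ : Equiv.Perm α := Equiv.ofBijective _ (Finite.injective_iff_bijective.1 hinj)
    have hσ : ∀ x, (eA.symm x, eB.symm (σ x)) = e (eA.symm x) := fun x => by
      simp only [σ, Equiv.ofBijective_apply, Equiv.symm_apply_apply]
      exact Prod.ext (he _).2.symm rfl
    refine ⟨σ, fun x => ?_, ?_⟩
    · rw [hσ]
      exact hM (he _).1
    · rw [← hk]
      refine Finset.card_bij (fun x _ => e (eA.symm x)) ?_ ?_ ?_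
      · intro x hx
        rw [Finset.mem_filter, hσ] at hx
        exact Finset.mem_inter.2 ⟨(he _).1, hx.2⟩
      · intro x _ y _ hxy
        have h := congrArg Prod.fst hxy
        rw [(he _).2, (he _).2] at h
        exact eA.symm.injective h
      · intro y hy
        have h := Finset.mem_inter.1 hy
        have h1 : e (eA.symm (eA y.1)) = y := by
          rw [Equiv.symm_apply_apply]
          exact (hu _ _ ⟨h.1, rfl⟩).symm
        refine ⟨eA y.1, ?_, h1⟩
        rw [Finset.mem_filter, hσ, h1]
        exact ⟨Finset.mem_univ _, h.2⟩
  · rintro ⟨σ, hσ, hk⟩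
    refine ⟨Finset.univ.image fun x => (eA.symm x, eB.symm (σ x)), ⟨?_, ?_, ?_⟩, ?_⟩
    · intro e he
      obtain ⟨x, _, rfl⟩ := Finset.mem_image.1 he
      exact hσ x
    · intro i
      refine ⟨(i, eB.symm (σ (eA i))), ⟨?_, rfl⟩, ?_⟩
      · exact Finset.mem_image.2 ⟨eA i, Finset.mem_univ _, by simp⟩
      · rintro e ⟨he, rfl⟩
        obtain ⟨x, _, rfl⟩ := Finset.mem_image.1 he
        simp
    · intro j
      refine ⟨(eA.symm (σ.symm (eB j)), j), ⟨?_, rfl⟩, ?_⟩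
      · exact Finset.mem_image.2 ⟨σ.symm (eB j), Finset.mem_univ _, by simp⟩
      · rintro e ⟨he, rfl⟩
        obtain ⟨x, _, rfl⟩ := Finset.mem_image.1 he
        simp
    · rw [← hk, ← Finset.filter_mem_eq_inter, Finset.filter_image, Finset.card_image_of_injective]
      intro x y hxy
      exact eA.symm.injective (congrArg Prod.fst hxy)

theorem hasExactMatching_ofList {α : Type} [Fintype α] [DecidableEq α] {l : List α} (hl : l.Nodup)
    (hc : ∀ x, x ∈ l) (entry : α → α → ℕ) (k : ℕ) :
    HasExactMatching (.ofList l entry k) ↔ ∃ σ : Equiv.Perm α, (∀ x, entry x (σ x) ≠ 0) ∧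
      (Finset.univ.filter fun x => entry x (σ x) = 2).card = k := by
  let e : Fin l.length ≃ α := hl.getEquivOfForallMemList l hc
  have he : ∀ x, l[e.symm x] = x := fun x => e.apply_symm_apply x
  rw [hasExactMatching_iff (I := .ofList l entry k) e e]
  have h1 : ∀ x y, (e.symm x, e.symm y) ∈ (MatchingInstance.ofList l entry k).edges ↔
      entry x y ≠ 0 := fun x y => by
    refine (Finset.mem_filter_univ _).trans ?_
    simp only [he]
  have h2 : ∀ x y, (e.symm x, e.symm y) ∈ (MatchingInstance.ofList l entry k).red ↔
      entry x y = 2 := fun x y => by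
    refine (Finset.mem_filter_univ _).trans ?_
    simp only [he]
  exact exists_congr fun σ => and_congr (forall_congr' fun x => h1 x (σ x)) (Iff.of_eq
    (congrArg (fun s : Finset α => s.card = k) (Finset.filter_congr fun x _ => h2 x (σ x))))

/-! ### Emission of the matching graph of an election -/

namespace VoteGraph

variable (G : VoteGraph)

/-- The list of all vertices on either side. -/
def nodes : List G.V :=
  ((List.finRange G.m).flatMap fun c => (List.finRange (G.n + G.N)).flatMap fun i => [.unit c i]) ++
  (((List.finRange G.m).flatMap fun c => (List.finRange G.T).flatMap fun t => [.slack c t]) ++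
  (((List.finRange G.n).flatMap fun v => [.keep v]) ++
  ((List.finRange G.n).flatMap fun u => (List.finRange G.N).flatMap fun i =>
    (List.finRange G.r).flatMap fun j => [.chain u i j])))

theorem mem_nodes (x : G.V) : x ∈ G.nodes := by
  rcases x <;> simp [nodes]

theorem nodup_flatMap_finRange {α : Type} {n : ℕ} {f : Fin n → List α} (h : ∀ i, (f i).Nodup)
    (hd : ∀ i j x, x ∈ f i → x ∈ f j → i = j) : ((List.finRange n).flatMap f).Nodup := by
  refine List.nodup_flatMap.2 ⟨fun i _ => h i, (List.nodup_finRange n).imp ?_⟩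
  intro i j hij x hi hj
  exact hij (hd i j x hi hj)

theorem nodup_nodes : G.nodes.Nodup := by
  refine List.nodup_append'.2 ⟨?_, List.nodup_append'.2 ⟨?_, List.nodup_append'.2 ⟨?_, ?_, ?_⟩, ?_⟩, ?_⟩
  · refine nodup_flatMap_finRange (fun c => nodup_flatMap_finRange (by simp) ?_) ?_ <;> simp_all
  · refine nodup_flatMap_finRange (fun c => nodup_flatMap_finRange (by simp) ?_) ?_ <;> simp_all
  · refine nodup_flatMap_finRange (by simp) ?_
    simp_all
  · refine nodup_flatMap_finRange (fun u => nodup_flatMap_finRange (fun i =>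
      nodup_flatMap_finRange (by simp) ?_) ?_) ?_ <;> simp_all
  all_goals
    intro x hx
    simp only [List.mem_flatMap, List.mem_append, List.mem_finRange, true_and, List.mem_singleton] at hx ⊢
    grind

/-- The code of a vertex. -/
def Node.code {m n N r T : ℕ} : Node m n N r T → ℕ × ℕ × ℕ × ℕ
  | .unit c i => (0, c, i, 0)
  | .slack c t => (1, c, t, 0)
  | .keep v => (2, v, 0, 0)
  | .chain u i j => (3, u, i, j)

/-- Assign the code of a vertex to four variables. -/
def assign {m n N r T : ℕ} (b : ℕ) (y : Node m n N r T) (ρ : ℕ → ℕ) : ℕ → ℕ :=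
  Function.update (Function.update (Function.update (Function.update ρ b y.code.1)
    (b + 1) y.code.2.1) (b + 2) y.code.2.2.1) (b + 3) y.code.2.2.2

/-- The variables from `1` to `7` hold the parameters of the graph, and the input holds the votes. -/
structure Params (x : List Γ') (ρ : ℕ → ℕ) : Prop where
  m : ρ 1 = G.m
  n : ρ 2 = G.n
  p : ρ 3 = G.p
  N : ρ 4 = G.N
  r : ρ 5 = G.r
  T : ρ 6 = G.T
  forced : ρ 7 = G.forced.toNat
  fst : ∀ v : Fin G.n, Tm.blockLength x (4 + v * G.m) = G.fst v
  lst : ∀ v : Fin G.n, Tm.blockLength x (3 + (v * G.m + G.m)) = G.lst v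

variable {G} {x : List Γ'} {ρ : ℕ → ℕ}

/-- The parameters occupy the variables `1` to `7`, so loops over vertices, which use larger
variables, do not disturb them. -/
theorem Params.update (h : G.Params x ρ) {v : ℕ} (hv : 8 ≤ v) (a : ℕ) :
    G.Params x (Function.update ρ v a) := by
  constructor
  all_goals first
    | exact h.fst
    | exact h.lst
    | (rw [Function.update_of_ne (by omega)]
       first | exact h.m | exact h.n | exact h.p | exact h.N | exact h.r | exact h.T | exact h.forced)

theorem Params.assign_node (h : G.Params x ρ) {b : ℕ} (hb : 8 ≤ b) (y : G.V) :
    G.Params x (assign b y ρ) :=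
  (((h.update hb _).update (by omega) _).update (by omega) _).update (by omega) _

open Tm in
/-- The first candidate in the vote of a voter. -/
def fstTm (t : Tm) : Tm := block (add (const 4) (mul t (var 1)))

open Tm in
/-- The last candidate in the vote of a voter. -/
def lstTm (t : Tm) : Tm := block (add (const 3) (add (mul t (var 1)) (var 1)))

theorem Params.eval_fstTm (h : G.Params x ρ) {t : Tm} {v : Fin G.n} (ht : t.eval x ρ = v) :
    (fstTm t).eval x ρ = G.fst v := by
  rw [fstTm, Tm.eval_block, ← h.fst]
  simp [Tm.eval, Tm.eval_mul, ht, h.m]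

theorem Params.eval_lstTm (h : G.Params x ρ) {t : Tm} {v : Fin G.n} (ht : t.eval x ρ = v) :
    (lstTm t).eval x ρ = G.lst v := by
  rw [lstTm, Tm.eval_block, ← h.lst]
  simp [Tm.eval, Tm.eval_mul, ht, h.m]

open Tm in
/-- The term for `candidateEntry`, for the candidate in the variable `11` and the right vertex in the
variables from `20` to `23`. -/
def candidateTm : Tm :=
  ite (eq (var 20) (const 0)) (eq (var 11) (var 21))
  (ite (eq (var 20) (const 1)) (not (eq (var 11) (var 3)))
  (ite (eq (var 20) (const 2)) (eq (var 11) (fstTm (var 21)))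
  (ite (and (eq (var 11) (fstTm (var 21))) (eq (var 23) (const 0))) (const 2) (const 0))))

open Tm in
/-- The term for `entry`, for the left vertex in the variables from `10` to `13` and the right vertex
in the variables from `20` to `23`. -/
def entryTm : Tm :=
  ite (lt (var 10) (const 2)) candidateTm
  (ite (eq (var 10) (const 2))
    (ite (eq (var 20) (const 0)) (eq (var 21) (lstTm (var 11)))
    (ite (and (eq (var 20) (const 2)) (and (eq (var 11) (var 21)) (not (var 7)))) (const 2) (const 0)))
  (ite (eq (var 20) (const 0))
    (and (eq (var 21) (lstTm (var 11))) (eq (add (var 13) (const 1)) (var 5)))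
  (ite (and (eq (var 20) (const 3)) (and (eq (var 11) (var 21)) (eq (var 12) (var 22))))
    (ite (eq (var 13) (var 23)) (const 1)
      (ite (eq (add (var 13) (const 1)) (var 23)) (const 2) (const 0)))
    (const 0))))

theorem Params.eval_candidateTm (h : G.Params x ρ) (c : Fin G.m) (z : G.V) (h11 : ρ 11 = c)
    (h20 : ρ 20 = z.code.1) (h21 : ρ 21 = z.code.2.1) (h23 : ρ 23 = z.code.2.2.2) :
    candidateTm.eval x ρ = G.candidateEntry c z := by
  rcases z with ⟨d, i⟩ | _ | v | ⟨u, i, j⟩ <;> simp only [Node.code] at h20 h21 h23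
  · simp [candidateTm, Tm.eval, Tm.eval_eq, h20, h21, h11, candidateEntry, Fin.ext_iff]
  · simp [candidateTm, Tm.eval, Tm.eval_eq, Tm.eval_not, h20, h11, h.p, candidateEntry, Fin.ext_iff]
    grind
  · have := h.eval_fstTm (t := .var 21) (v := v) h21
    simp [candidateTm, Tm.eval, Tm.eval_eq, h20, h11, candidateEntry, Fin.ext_iff, this]
  · have := h.eval_fstTm (t := .var 21) (v := u) h21
    simp [candidateTm, Tm.eval, Tm.eval_eq, Tm.eval_and, h20, h11, h23, candidateEntry, Fin.ext_iff,
      this]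
    grind

theorem Params.eval_entryTm (h : G.Params x ρ) (y z : G.V) :
    entryTm.eval x (assign 20 z (assign 10 y ρ)) = G.entry y z := by
  have h' := (h.assign_node (b := 10) (by norm_num) y).assign_node (b := 20) (by norm_num) z
  have h10 : assign 20 z (assign 10 y ρ) 10 = y.code.1 := by simp [assign]
  have h11 : assign 20 z (assign 10 y ρ) 11 = y.code.2.1 := by simp [assign]
  have h12 : assign 20 z (assign 10 y ρ) 12 = y.code.2.2.1 := by simp [assign]
  have h13 : assign 20 z (assign 10 y ρ) 13 = y.code.2.2.2 := by simp [assign]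
  have h20 : assign 20 z (assign 10 y ρ) 20 = z.code.1 := by simp [assign]
  have h21 : assign 20 z (assign 10 y ρ) 21 = z.code.2.1 := by simp [assign]
  have h22 : assign 20 z (assign 10 y ρ) 22 = z.code.2.2.1 := by simp [assign]
  have h23 : assign 20 z (assign 10 y ρ) 23 = z.code.2.2.2 := by simp [assign]
  generalize assign 20 z (assign 10 y ρ) = ρ' at *
  have hcand : ∀ c : Fin G.m, ρ' 11 = c → candidateTm.eval x ρ' = G.candidateEntry c z :=
    fun c hc => h'.eval_candidateTm c z hc h20 h21 h23
  rcases y with ⟨c, i⟩ | ⟨c, t⟩ | v | ⟨u, i, j⟩ <;> simp only [Node.code] at h10 h11 h12 h13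
  · simp [entryTm, Tm.eval, Tm.eval_lt, h10, entry, hcand c h11]
  · simp [entryTm, Tm.eval, Tm.eval_lt, h10, entry, hcand c h11]
  · have hl := h'.eval_lstTm (t := .var 11) (v := v) h11
    rcases z with ⟨d, i'⟩ | _ | v' | ⟨u', i', j'⟩ <;> simp only [Node.code] at h20 h21 h22 h23 <;>
      simp [entryTm, Tm.eval, Tm.eval_lt, Tm.eval_eq, Tm.eval_and, Tm.eval_not, h10, h11, h20, h21,
        h'.forced, entry, hl, Fin.ext_iff]
    rcases G.forced <;> simp
  · have hl := h'.eval_lstTm (t := .var 11) (v := u) h11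
    rcases z with ⟨d, i'⟩ | _ | v' | ⟨u', i', j'⟩ <;> simp only [Node.code] at h20 h21 h22 h23 <;>
      simp [entryTm, Tm.eval, Tm.eval_lt, Tm.eval_eq, Tm.eval_and, h10, h11, h12, h13, h20, h21,
        h22, h23, h'.r, entry, hl, Fin.ext_iff] <;> grind

open Tm Em in
/-- Run a program for all vertices, whose codes are assigned to the variables from `b` to `b + 3`. -/
def forNodes (b : ℕ) (e : Em) : Em :=
  (letIn b (const 0) (loop (b + 1) (var 1) (loop (b + 2) (add (var 2) (var 4))
    (letIn (b + 3) (const 0) e)))).seq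
  ((letIn b (const 1) (loop (b + 1) (var 1) (loop (b + 2) (var 6) (letIn (b + 3) (const 0) e)))).seq
  ((letIn b (const 2) (loop (b + 1) (var 2) (letIn (b + 2) (const 0)
    (letIn (b + 3) (const 0) e)))).seq
  (letIn b (const 3) (loop (b + 1) (var 2) (loop (b + 2) (var 4) (loop (b + 3) (var 5) e))))))

theorem Params.eval_forNodes (h : G.Params x ρ) {b : ℕ} (hb : 8 ≤ b) (e : Em) :
    (forNodes b e).eval x ρ = G.nodes.flatMap fun y => e.eval x (assign b y ρ) := by
  have hv : ∀ v < 8, v ≠ b ∧ v ≠ b + 1 ∧ v ≠ b + 2 := by omega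
  simp only [forNodes, Em.eval, Tm.eval, Function.update_apply, hv 1 (by norm_num),
    hv 2 (by norm_num), hv 4 (by norm_num), hv 5 (by norm_num), hv 6 (by norm_num), if_false,
    h.m, h.n, h.N, h.r, h.T, flatMap_range, nodes, List.flatMap_append, List.flatMap_assoc,
    List.flatMap_singleton]
  rfl

open Tm Em in
/-- Emit the matching instance, where the variable `8` holds the number of red edges. -/
def emitMatching : Em :=
  (binary (var 8)).seq
  (((forNodes 20 (symbol (Γ'.bit true))).seq (symbol Γ'.comma)).seq
  (((forNodes 20 (symbol (Γ'.bit true))).seq (symbol Γ'.comma)).seq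
  ((forNodes 10 ((symbol Γ'.bra).seq ((forNodes 20 (letIn 9 entryTm
    (ite (eq (var 9) (const 2)) (symbol (Γ'.bit true))
      (ite (eq (var 9) (const 0)) (symbol Γ'.blank) (symbol (Γ'.bit false)))))).seq
    (symbol Γ'.ket)))).seq (emit none))))

variable (G) in
/-- The matching instance of the graph. -/
def matching (k : ℕ) : MatchingInstance := .ofList G.nodes G.entry k

/-- The list of vertices is traversed once for each of the two unary sizes, and by two nested loops
for the matrix. -/
theorem Params.eval_emitMatching (h : G.Params x ρ) :
    emitMatching.eval x ρ = (encodeMatching (G.matching (ρ 8))).map some ++ [none] := by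
  have h1 : (forNodes 20 (.symbol (Γ'.bit true))).eval x ρ ++ [some Γ'.comma] =
      (encodeUnary G.nodes.length).map some := by
    rw [h.eval_forNodes (by norm_num)]
    simp only [Em.eval_symbol, encodeUnary, List.map_append, List.map_replicate, List.map_cons,
      List.map_nil]
    rw [List.flatMap_def, List.map_const']
    simp
  simp only [emitMatching, Em.eval, h1, Em.eval_symbol, Em.eval_binary, Tm.eval,
    h.eval_forNodes (b := 10) (by norm_num)]
  rw [matching, encodeMatching_ofList]
  simp only [List.map_append, List.append_assoc, List.map_flatMap, List.map_cons, List.map_nil,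
    List.cons_append, List.nil_append]
  congr 4
  refine List.flatMap_congr fun y _ => ?_
  rw [(h.assign_node (b := 10) (by norm_num) y).eval_forNodes (by norm_num)]
  congr 2
  refine List.flatMap_congr fun z _ => ?_
  simp only [Em.eval, Em.eval_symbol, Tm.eval, Tm.eval_eq, h.eval_entryTm, Function.update_self,
    entrySymbol]
  split_ifs <;> simp_all

/-- The matching instance is a yes-instance if and only if there are new votes with the required
scores. -/
theorem hasExactMatching_matching (hr : 0 < G.r) (k : ℕ) (hk : ∀ (X : Finset (Fin G.n))
      (U : Finset (Fin G.n × Fin G.N)), (G.forced = true → X = Finset.univ) →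
      G.n - X.card + G.r * U.card = k → U.card ≤ G.N) :
    HasExactMatching (G.matching k) ↔ ∃ (X : Finset (Fin G.n)) (U : Finset (Fin G.n × Fin G.N)),
      (G.forced = true → X = Finset.univ) ∧ (∀ c, G.total X U c ≤ G.T) ∧ G.total X U G.p = G.T ∧
      G.n - X.card + G.r * U.card = k := by
  rw [matching, hasExactMatching_ofList G.nodup_nodes G.mem_nodes]
  constructor
  · rintro ⟨σ, hσ, rfl⟩
    obtain ⟨X, U, h1, h2, h3, h4⟩ := G.exists_votes hr hσ
    exact ⟨X, U, h1, h2, h3, h4.symm⟩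
  -- The construction of a matching needs `U.card ≤ N`, which `hk` derives from the number of red
  -- edges.
  · rintro ⟨X, U, h1, h2, h3, rfl⟩
    exact G.exists_perm hr X U h1 (hk X U h1 rfl) h2 h3

end VoteGraph

/-! ### The reductions to exact perfect bipartite matching -/

/-- The matching graph of an election. -/
def Election.graph (E : Election) (N r T : ℕ) (forced : Bool) : VoteGraph where
  m := E.m
  n := E.n
  N := N
  r := r
  T := T
  fst v := E.first (E.vote v)
  lst v := E.last (E.vote v)
  p := E.p
  forced := forced

/-- In both problems one number precedes the election in the input, so every block index of the
election is shifted by one. -/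
theorem Election.params (E : Election) {x : List Γ'} (hx : ∀ j, Tm.blockLength x (j + 1) =
    Tm.blockLength (encodeElection E) j) {N r T : ℕ} {forced : Bool} {ρ : ℕ → ℕ} (h1 : ρ 1 = E.m)
    (h2 : ρ 2 = E.n) (h3 : ρ 3 = E.p) (h4 : ρ 4 = N) (h5 : ρ 5 = r) (h6 : ρ 6 = T)
    (h7 : ρ 7 = forced.toNat) : (E.graph N r T forced).Params x ρ where
  m := h1
  n := h2
  p := h3
  N := h4
  r := h5
  T := h6
  forced := h7
  fst v := by
    refine Eq.trans ?_ ((Tm.blockLength_election E).2.2.2 v ⟨0, E.p.pos⟩)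
    rw [← hx]
    congr 1
    change 4 + (v : ℕ) * E.m = 3 + v * E.m + 0 + 1
    ring
  lst v := by
    have hm := E.p.pos
    refine Eq.trans ?_ ((Tm.blockLength_election E).2.2.2 v ⟨E.m - 1, by omega⟩)
    rw [← hx]
    congr 1
    change 3 + ((v : ℕ) * E.m + E.m) = 3 + v * E.m + (E.m - 1) + 1
    omega

theorem Election.hasExactMatching_graph (E : Election) {N r T : ℕ} {forced : Bool} {k : ℕ}
    (hr : 0 < r) (hk : ∀ (X : Finset (Fin E.n)) (U : Finset (Fin E.n × Fin N)),
      (forced = true → X = Finset.univ) → E.n - X.card + r * U.card = k → U.card ≤ N) :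
    HasExactMatching ((E.graph N r T forced).matching k) ↔
      ∃ (X : Finset (Fin E.n)) (U : Finset (Fin E.n × Fin N)), (forced = true → X = Finset.univ) ∧
        (∀ c, ∑ v ∈ X, pairScore (E.first (E.vote v)) (E.last (E.vote v)) c +
          ∑ u ∈ U, pairScore (E.first (E.vote u.1)) (E.last (E.vote u.1)) c ≤ T) ∧
        ∑ v ∈ X, pairScore (E.first (E.vote v)) (E.last (E.vote v)) E.p +
          ∑ u ∈ U, pairScore (E.first (E.vote u.1)) (E.last (E.vote u.1)) E.p = T ∧
        E.n - X.card + r * U.card = k :=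
  VoteGraph.hasExactMatching_matching (G := E.graph N r T forced) hr k hk

theorem DecisionProblem.encodeList_map {B : DecisionProblem} {α : Type} (l : List α)
    (f : α → B.Instance) :
    B.encodeList (l.map f) = l.flatMap fun a => (B.encode (f a)).map some ++ [none] := by
  rw [DecisionProblem.encodeList, List.map_map, List.flatMap_def]
  rfl

namespace ManipulationInstance

variable (I : ManipulationInstance)

/-- The matching instances for manipulation, one for every score of the preferred candidate. -/
def matchings : List MatchingInstance :=
  (List.range (I.election.n + I.w + 1)).map fun T => (I.election.graph I.w 1 T true).matching I.w

open Tm Em VoteGraph in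
theorem nonempty_computable_matchings : Nonempty (TM2ComputableInPolyTime
    (conformantManipulation firstLast).encode exactPerfectBipartiteMatching.encodeList
      matchings) := by
  refine Em.nonempty_computableInPolyTime (letIn 1 (block (const 1)) (letIn 2 (block (const 2))
    (letIn 3 (block (const 3)) (letIn 4 (block (const 0)) (letIn 5 (const 1) (letIn 7 (const 1)
    (letIn 8 (var 4) (loop 6 (add (add (var 2) (var 4)) (const 1)) emitMatching)))))))) ?_
  intro I
  change Em.eval (encodeUnary I.w ++ encodeElection I.election) _ _ = _
  have hx := fun j => Tm.blockLength_unary_succ I.w j (encodeElection I.election)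
  obtain ⟨e1, e2, e3, -⟩ := Tm.blockLength_election I.election
  simp only [Em.eval, eval_block, Tm.eval, Function.update_apply, Nat.reduceEqDiff, reduceIte]
  have f1 := (hx 0).trans e1
  have f2 := (hx 1).trans e2
  have f3 := (hx 2).trans e3
  simp only [Nat.reduceAdd] at f1 f2 f3
  simp only [f1, f2, f3, Tm.blockLength_unary_zero]
  refine Eq.trans ?_ (DecisionProblem.encodeList_map (B := exactPerfectBipartiteMatching) _ _).symm
  refine List.flatMap_congr fun T _ => ?_
  rw [Params.eval_emitMatching (G := I.election.graph I.w 1 T true)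
    (I.election.params hx (by simp) (by simp) (by simp) (by simp) (by simp) (by simp) (by simp))]
  simp
  rfl

/-- All old votes are kept and chains have length one, so the number of red edges is the number of
new votes. Every vote is available in `w` copies, which is as often as it can be used. -/
theorem canManipulate_iff : CanManipulate firstLast I ↔ ∃ J ∈ I.matchings, HasExactMatching J := by
  obtain ⟨E, w⟩ := I
  have hscore : ∀ (W : Fin w → Vote E.m) c, score (firstLastVector E.m) (Fin.append E.vote W) c =
      ∑ v, pairScore (E.first (E.vote v)) (E.last (E.vote v)) c +
        ∑ i, pairScore (E.first (W i)) (E.last (W i)) c := by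
    intro W c
    rw [E.score_eq, Fin.sum_univ_add]
    simp only [Fin.append_left, Fin.append_right]
  have key : ∀ T, HasExactMatching ((E.graph w 1 T true).matching w) ↔ _ := fun T =>
    E.hasExactMatching_graph Nat.one_pos (by
      intro X U hX h
      rw [hX rfl] at h
      simpa using (by simpa using h : U.card = w).le)
  simp only [matchings, List.mem_map, List.mem_range, exists_exists_and_eq_and, key, CanManipulate,
    mem_firstLast_iff E, hscore]
  constructor
  · rintro ⟨W, hW, T, hT, h1, h2⟩
    choose g hg using hW
    -- The index of the manipulator selects the copy, so manipulators with equal votes use different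
    -- chains.
    have hinj : Function.Injective fun i => (g i, i) := fun i j h => congrArg Prod.snd h
    have htot : ∀ c, ∑ u ∈ Finset.univ.image (fun i => (g i, i)), pairScore (E.first (E.vote u.1)) (E.last (E.vote u.1)) c =
        ∑ i, pairScore (E.first (W i)) (E.last (W i)) c := by
      intro c
      rw [Finset.sum_image hinj.injOn]
      simp only [hg]
    refine ⟨T, Nat.lt_succ_of_le hT, Finset.univ, Finset.univ.image fun i => (g i, i), fun _ => rfl,
      fun c => ?_, ?_, ?_⟩
    · rw [htot]
      exact h1 c
    · rw [htot]
      exact h2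
    · rw [Finset.card_image_of_injective _ hinj]
      simp
  · rintro ⟨T, hT, X, U, hX, h1, h2, h3⟩
    obtain rfl := hX trivial
    have hU : U.card = w := by simpa using h3
    let e := (Finset.equivFinOfCardEq hU).symm
    have htot : ∀ c, ∑ u ∈ U, pairScore (E.first (E.vote u.1)) (E.last (E.vote u.1)) c =
        ∑ i, pairScore (E.first (E.vote (e i).1.1)) (E.last (E.vote (e i).1.1)) c := by
      intro c
      rw [← Finset.sum_coe_sort U, ← Equiv.sum_comp e]
    simp only [htot] at h1 h2
    exact ⟨fun i => E.vote (e i).1.1, fun i => ⟨_, rfl⟩, T, Nat.le_of_lt_succ hT, h1, h2⟩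

end ManipulationInstance

theorem dttReducible_manipulation_matching :
    DTTReducible (conformantManipulation firstLast) exactPerfectBipartiteMatching :=
  ⟨_, ManipulationInstance.nonempty_computable_matchings, ManipulationInstance.canManipulate_iff⟩

namespace BriberyInstance

variable (I : BriberyInstance)

/-- The matching instances for bribery, one for every number of bribes and every score of the
preferred candidate. -/
def matchings : List MatchingInstance :=
  (List.range (I.election.n + 1)).flatMap fun K => if K ≤ I.k then
    (List.range (I.election.n + I.election.n + 1)).map fun T =>
      (I.election.graph I.election.n (I.election.n + 1) T false).matching (K * (I.election.n + 2))
  else []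

open Tm Em VoteGraph in
-- The bribe limit is binary, so the loop is over all `K ≤ n`, each of them tested against the limit
-- by `lePrefix`.
theorem nonempty_computable_matchings : Nonempty (TM2ComputableInPolyTime
    (conformantBribery firstLast).encode exactPerfectBipartiteMatching.encodeList
      matchings) := by
  refine Em.nonempty_computableInPolyTime (letIn 1 (block (const 1)) (letIn 2 (block (const 2))
    (letIn 3 (block (const 3)) (letIn 4 (var 2) (letIn 5 (add (var 2) (const 1)) (letIn 7 (const 0)
    (loop 30 (add (var 2) (const 1)) (ite (lePrefix (var 30))
      (letIn 8 (mul (var 30) (add (var 2) (const 2)))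
        (loop 6 (add (add (var 2) (var 4)) (const 1)) emitMatching)) skip)))))))) ?_
  intro I
  change Em.eval (encodeBinary I.k ++ encodeElection I.election) _ _ = _
  have hx := fun j => Tm.blockLength_binary_succ I.k j (encodeElection I.election)
  obtain ⟨e1, e2, e3, -⟩ := Tm.blockLength_election I.election
  simp only [Em.eval, eval_block, eval_lePrefix, eval_mul, Tm.eval, Function.update_apply,
    Nat.reduceEqDiff, reduceIte]
  have f1 := (hx 0).trans e1
  have f2 := (hx 1).trans e2
  have f3 := (hx 2).trans e3
  simp only [Nat.reduceAdd] at f1 f2 f3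
  simp only [f1, f2, f3]
  have h : ∀ l : List MatchingInstance, exactPerfectBipartiteMatching.encodeList l =
      l.flatMap fun y => (encodeMatching y).map some ++ [none] := fun l => by
    rw [List.flatMap_def]
    rfl
  rw [h]
  refine Eq.trans ?_ List.flatMap_assoc.symm
  refine List.flatMap_congr fun K _ => ?_
  by_cases hK : K ≤ I.k
  · simp only [if_pos hK, one_ne_zero, if_false, List.flatMap_map]
    refine List.flatMap_congr fun T _ => ?_
    rw [Params.eval_emitMatching (G := I.election.graph I.election.n (I.election.n + 1) T false)
      (I.election.params hx (by simp) (by simp) (by simp) (by simp) (by simp) (by simp) (by simp))]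
    simp
  · simp [hK]

/-- Exactly `K` bribes amount to removing `K` votes and adding `K` votes that occurred initially;
which bribed voter gets which new vote is irrelevant for the scores. -/
theorem canBribe_iff : CanBribe firstLast I ↔ ∃ J ∈ I.matchings, HasExactMatching J := by
  obtain ⟨E, k⟩ := I
  -- The required number is `K + (n + 1) * K`. As both `n - X.card` and `K` are below `n + 1`,
  -- comparing remainders modulo `n + 1` separates the removed votes from the new ones.
  have hcard : ∀ K ≤ E.n, ∀ (X : Finset (Fin E.n)) (U : Finset (Fin E.n × Fin E.n)),
      E.n - X.card + (E.n + 1) * U.card = K * (E.n + 2) → U.card = K ∧ E.n - X.card = K := by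
    intro K hK X U h
    have h1 : E.n - X.card + (E.n + 1) * U.card = K + (E.n + 1) * K := by
      rw [h]
      ring
    have h2 : E.n - X.card = K := by
      have := congrArg (· % (E.n + 1)) h1
      simp only [Nat.add_mul_mod_self_left] at this
      rwa [Nat.mod_eq_of_lt (by omega), Nat.mod_eq_of_lt (by omega)] at this
    refine ⟨?_, h2⟩
    rw [h2, Nat.add_left_cancel_iff] at h1
    exact Nat.eq_of_mul_eq_mul_left (Nat.succ_pos _) h1
  have key : ∀ T K, K ≤ E.n →
      (HasExactMatching ((E.graph E.n (E.n + 1) T false).matching (K * (E.n + 2))) ↔ _) :=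
    fun T K hK => E.hasExactMatching_graph (Nat.succ_pos _) (fun X U _ h => (hcard K hK X U h).1.trans_le hK)
  have hmem : ∀ J, J ∈ matchings ⟨E, k⟩ ↔ ∃ K ≤ E.n, K ≤ k ∧ ∃ T ≤ E.n + E.n,
      (E.graph E.n (E.n + 1) T false).matching (K * (E.n + 2)) = J := by
    intro J
    simp only [matchings, List.mem_flatMap, List.mem_range, Nat.lt_succ_iff]
    refine exists_congr fun K => and_congr_right fun _ => ?_
    split_ifs with h <;> simp [h]
  simp only [CanBribe, mem_firstLast_iff E, E.score_eq, hmem]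
  constructor
  · rintro ⟨S, V, hS, h1, h2, T, hT, h3, h4⟩
    -- The source of the final vote is chosen for all voters, and as the voter itself outside `S`,
    -- so that both sums can be written with one function `g`.
    have hg : ∀ i, ∃ v, V i = E.vote v ∧ (i ∉ S → v = i) := by
      intro i
      by_cases hi : i ∈ S
      · obtain ⟨v, hv⟩ := h1 i hi
        exact ⟨v, hv, fun h => absurd hi h⟩
      · exact ⟨i, h2 i hi, fun _ => rfl⟩
    choose g hg hg' using hg
    have hinj : Function.Injective fun i => (g i, i) := fun i j h => congrArg Prod.snd h
    have htot : ∀ c, ∑ v ∈ Sᶜ, pairScore (E.first (E.vote v)) (E.last (E.vote v)) c +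
        ∑ u ∈ S.image (fun i => (g i, i)), pairScore (E.first (E.vote u.1)) (E.last (E.vote u.1)) c =
        ∑ v, pairScore (E.first (V v)) (E.last (V v)) c := by
      intro c
      rw [Finset.sum_image hinj.injOn, ← Finset.sum_add_sum_compl S, add_comm]
      refine congrArg₂ (· + ·) (Finset.sum_congr rfl fun i _ => ?_) (Finset.sum_congr rfl fun i hi => ?_)
      · rw [hg i]
      · rw [hg i, hg' i (Finset.mem_compl.1 hi)]
    have hSn : S.card ≤ E.n := by simpa using Finset.card_le_univ S
    refine ⟨_, ⟨S.card, hSn, hS, T, by omega, rfl⟩, (key T _ hSn).2 ⟨Sᶜ, S.image fun i => (g i, i),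
      by simp, fun c => (htot c).trans_le (h3 c), (htot _).trans h4, ?_⟩⟩
    rw [Finset.card_image_of_injective _ hinj, Finset.card_compl, Fintype.card_fin]
    rw [Nat.sub_sub_self hSn]
    ring
  · rintro ⟨_, ⟨K, hK, hKk, T, hT, rfl⟩, hJ⟩
    obtain ⟨X, U, _, h1, h2, h3⟩ := (key T K hK).1 hJ
    obtain ⟨hU, hX⟩ := hcard K hK X U h3
    have hc : (Xᶜ : Finset (Fin E.n)).card = U.card := by
      rw [Finset.card_compl, Fintype.card_fin, hU]
      exact hX
    -- There are as many voters who gave up their votes as new votes, so the latter can be handed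
    -- out to the former.
    let e : (Xᶜ : Finset (Fin E.n)) ≃ U := Finset.equivOfCardEq hc
    let V : Fin E.n → Vote E.m := fun i =>
      if h : i ∈ (Xᶜ : Finset (Fin E.n)) then E.vote (e ⟨i, h⟩).1.1 else E.vote i
    have hV : ∀ i ∈ X, V i = E.vote i := fun i hi => by simp [V, hi]
    have hV' : ∀ i : (Xᶜ : Finset (Fin E.n)), V i = E.vote (e i).1.1 := fun i => dif_pos i.2
    have htot : ∀ c, ∑ v ∈ X, pairScore (E.first (E.vote v)) (E.last (E.vote v)) c +
        ∑ u ∈ U, pairScore (E.first (E.vote u.1)) (E.last (E.vote u.1)) c =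
        ∑ v, pairScore (E.first (V v)) (E.last (V v)) c := by
      intro c
      rw [← Finset.sum_add_sum_compl X]
      refine congrArg₂ (· + ·) (Finset.sum_congr rfl fun i hi => ?_) ?_
      · rw [hV i hi]
      · rw [← Finset.sum_coe_sort U, ← Finset.sum_coe_sort Xᶜ, ← Equiv.sum_comp e]
        refine Finset.sum_congr rfl fun i _ => ?_
        rw [hV' i]
    have hp : ∑ v, pairScore (E.first (V v)) (E.last (V v)) E.p = T := (htot _).symm.trans h2
    refine ⟨Xᶜ, V, by omega, fun i hi => ⟨_, hV' ⟨i, hi⟩⟩, fun i hi => hV i (by simpa using hi),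
      T, ?_, fun c => (htot c).symm.trans_le (h1 c), hp⟩
    -- The list contains all `T` up to `2 * n`, but a score attained with `n` votes is at most `n`.
    have : (T : ℤ) ≤ E.n := by
      rw [← hp]
      refine (Finset.sum_le_card_nsmul _ _ 1 fun v _ => ?_).trans (by simp)
      unfold pairScore
      split_ifs <;> norm_num
    omega

end BriberyInstance

theorem dttReducible_bribery_matching :
    DTTReducible (conformantBribery firstLast) exactPerfectBipartiteMatching :=
  ⟨_, BriberyInstance.nonempty_computable_matchings, BriberyInstance.canBribe_iff⟩

/-! ### Elections with prescribed first and last candidates -/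

/-- The candidates in a vote with first candidate `f` and last candidate `l`. -/
def pairList {m : ℕ} (f l : Fin m) : List (Fin m) :=
  f :: ((List.finRange m).filter (fun c => c ≠ f ∧ c ≠ l) ++ [l])

theorem mem_pairList {m : ℕ} (f l c : Fin m) : c ∈ pairList f l := by
  simp only [pairList, List.mem_cons, List.mem_append, List.mem_filter, List.mem_finRange, true_and,
    decide_eq_true_eq, List.not_mem_nil, or_false]
  tauto

theorem nodup_pairList {m : ℕ} {f l : Fin m} (h : f ≠ l) : (pairList f l).Nodup := by
  refine List.nodup_cons.2 ⟨by simpa using h, List.nodup_append'.2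
    ⟨(List.nodup_finRange m).filter _, List.nodup_singleton l, ?_⟩⟩
  intro x hx hx'
  simp_all

theorem length_pairList {m : ℕ} {f l : Fin m} (h : f ≠ l) : (pairList f l).length = m := by
  have := Fintype.card_congr ((nodup_pairList h).getEquivOfForallMemList _ (mem_pairList f l))
  simpa using this

/-- A vote with first candidate `f` and last candidate `l`. -/
def pairVote (m f l : ℕ) : Vote m :=
  if h : f < m ∧ l < m ∧ f ≠ l then
    (finCongr (length_pairList (f := ⟨f, h.1⟩) (l := ⟨l, h.2.1⟩) (by simpa using h.2.2)).symm).trans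
      ((nodup_pairList (by simpa using h.2.2)).getEquivOfForallMemList _
        (mem_pairList ⟨f, h.1⟩ ⟨l, h.2.1⟩))
  -- This default is not reached for pairs of different candidates below `m`.
  else 1

section pairVote

variable {m f l : ℕ}


theorem pairVote_apply (hf : f < m) (hl : l < m) (h : f ≠ l) (i : Fin m) :
    pairVote m f l i = (pairList ⟨f, hf⟩ ⟨l, hl⟩)[(i : ℕ)]'(by
    rw [length_pairList (by simpa using h)]; exact i.2) := by
  rw [pairVote, dif_pos ⟨hf, hl, h⟩]
  rfl

theorem pairVote_first (hf : f < m) (hl : l < m) (h : f ≠ l) :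
    pairVote m f l ⟨0, by omega⟩ = ⟨f, hf⟩ := by
  rw [pairVote_apply hf hl h]
  rfl

theorem pairVote_last (hf : f < m) (hl : l < m) (h : f ≠ l) :
    pairVote m f l ⟨m - 1, by omega⟩ = ⟨l, hl⟩ := by
  rw [pairVote_apply hf hl h]
  have h1 := length_pairList (f := ⟨f, hf⟩) (l := ⟨l, hl⟩) (by simpa using h)
  have h2 : (pairList ⟨f, hf⟩ ⟨l, hl⟩).getLast (by simp [pairList]) = ⟨l, hl⟩ := by
    simp [pairList]
  rw [List.getLast_eq_getElem] at h2
  simp only [h1] at h2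
  exact h2

/-- The candidates between the first and the last one stand in increasing order, so a single loop
with a test emits them. -/
theorem encodeVote_pairVote (hf : f < m) (hl : l < m) (h : f ≠ l) : encodeVote (pairVote m f l) =
    Γ'.bra :: (encodeUnary f ++ ((List.range m).flatMap (fun c =>
      if c ≠ f ∧ c ≠ l then encodeUnary c else []) ++ (encodeUnary l ++ [Γ'.ket]))) := by
  have key : ∀ (L : List (Fin m)) (n : ℕ) (hn : L.length = n),
      (concat fun i : Fin n => encodeUnary (L[(i : ℕ)]'(by omega))) =
        L.flatMap fun c : Fin m => encodeUnary c := by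
    rintro L n rfl
    exact concat_getElem L fun c : Fin m => encodeUnary c
  have h3 : ∀ L : List (Fin m), (L.filter fun c => c ≠ ⟨f, hf⟩ ∧ c ≠ ⟨l, hl⟩).flatMap
      (fun c : Fin m => encodeUnary c) = L.flatMap fun c : Fin m =>
        if (c : ℕ) ≠ f ∧ (c : ℕ) ≠ l then encodeUnary c else [] := by
    intro L
    induction L with
    | nil => rfl
    | cons c L ih =>
      rw [List.flatMap_cons, ← ih, List.filter_cons]
      simp only [Fin.ext_iff, ne_eq, decide_eq_true_eq]
      split_ifs <;> simp
  rw [encodeVote]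
  simp only [pairVote_apply hf hl h]
  rw [key _ m (length_pairList (by simpa using h)), pairList, flatMap_range]
  simp only [List.flatMap_cons, List.flatMap_append, h3, List.flatMap_nil, List.append_nil,
    List.append_assoc]

end pairVote

/-- The score of `c` when the votes have the given first and last candidates. -/
def listScore (L : List (ℕ × ℕ)) (c : ℕ) : ℤ := (L.map fun q => pairScore q.1 q.2 c).sum

theorem listScore_append (L L' : List (ℕ × ℕ)) (c : ℕ) :
    listScore (L ++ L') c = listScore L c + listScore L' c := by
  simp [listScore]

theorem listScore_eq_sum (L : List (ℕ × ℕ)) (c : ℕ) :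
    listScore L c = ∑ v : Fin L.length, pairScore L[v].1 L[v].2 c := by
  rw [listScore, ← Fin.sum_univ_fun_getElem]
  rfl

/-- The election whose votes have the given first and last candidates. -/
def Election.ofPairs (m p : ℕ) (hp : p < m) (L : List (ℕ × ℕ)) : Election where
  m := m
  n := L.length
  vote v := pairVote m L[v].1 L[v].2
  p := ⟨p, hp⟩

/-- The pairs consist of different candidates. -/
def ValidPairs (m : ℕ) (L : List (ℕ × ℕ)) : Prop := ∀ q ∈ L, q.1 < m ∧ q.2 < m ∧ q.1 ≠ q.2

theorem score_pairVote {m : ℕ} {ι : ℕ} (q : Fin ι → ℕ × ℕ)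
    (hq : ∀ x, (q x).1 < m ∧ (q x).2 < m ∧ (q x).1 ≠ (q x).2) (c : Fin m) :
    score (firstLastVector m) (fun x => pairVote m (q x).1 (q x).2) c =
      ∑ x, pairScore (q x).1 (q x).2 (c : ℕ) := by
  -- The election without voters only supplies the number of candidates and a witness that there is
  -- one.
  have h := Election.score_eq ⟨m, 0, fun i => i.elim0, c⟩ (fun x => pairVote m (q x).1 (q x).2) c
  refine h.trans (Finset.sum_congr rfl fun x _ => ?_)
  obtain ⟨h1, h2, h3⟩ := hq x
  simp only [Election.first, Election.last, pairVote_first h1 h2 h3, pairVote_last h1 h2 h3, pairScore,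
    Fin.ext_iff]

/-- New votes from `L` that make all scores zero. -/
def Balanced (L : List (ℕ × ℕ)) (w : ℕ) : Prop :=
  ∃ q : Fin w → ℕ × ℕ, (∀ x, q x ∈ L) ∧ ∀ c, listScore L c + ∑ x, pairScore (q x).1 (q x).2 c = 0

theorem pairScore_eq_zero {f l c : ℕ} (h1 : f ≠ c) (h2 : l ≠ c) : pairScore f l c = 0 := by
  simp [pairScore, h1.symm, h2.symm]

theorem sum_pairScore_range {f l m : ℕ} (hf : f < m) (hl : l < m) (φ : ℕ → ℤ) :
    ∑ c ∈ Finset.range m, φ c * pairScore f l c = φ f - φ l := by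
  simp [pairScore, mul_sub, Finset.sum_sub_distrib, hf, hl]

/-- If the scores of all candidates are at most the score of `p`, and `p` is never ranked first, then
all scores are zero. -/
theorem score_eq_zero {m p : ℕ} {L : List (ℕ × ℕ)} (hL : ValidPairs m L) {n : ℕ} {q : Fin n → ℕ × ℕ}
    (hq : ∀ x, q x ∈ L) (hf : ∀ q ∈ L, q.1 ≠ p)
    (h : ∀ c < m, ∑ x, pairScore (q x).1 (q x).2 c ≤ ∑ x, pairScore (q x).1 (q x).2 p) (c : ℕ) :
    ∑ x, pairScore (q x).1 (q x).2 c = 0 := by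
  have h0 : ∑ c ∈ Finset.range m, ∑ x, pairScore (q x).1 (q x).2 c = 0 := by
    rw [Finset.sum_comm]
    refine Finset.sum_eq_zero fun x _ => ?_
    have := sum_pairScore_range (hL _ (hq x)).1 (hL _ (hq x)).2.1 fun _ => 1
    simpa using this
  -- A candidate that is never first can only lose points, so all scores are nonpositive; since they
  -- sum to zero, all of them vanish.
  have h1 : ∑ x, pairScore (q x).1 (q x).2 p ≤ 0 := by
    refine Finset.sum_nonpos fun x _ => ?_
    have := hf _ (hq x)
    unfold pairScore
    rw [if_neg (Ne.symm this)]
    split_ifs <;> norm_num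
  by_cases hc : c < m
  · exact (Finset.sum_eq_zero_iff_of_nonpos fun c hc => (h c (Finset.mem_range.1 hc)).trans h1).1 h0 c
      (Finset.mem_range.2 hc)
  · refine Finset.sum_eq_zero fun x _ => pairScore_eq_zero ?_ ?_
    · have := (hL _ (hq x)).1
      omega
    · have := (hL _ (hq x)).2.1
      omega

/-! ### Winning as a balance condition -/

section balanced

variable {m p w : ℕ} (hp : p < m) {L : List (ℕ × ℕ)}

/-- As `p` is never ranked first, it wins only if all scores are zero; conversely, everybody wins if
all scores are zero. -/
theorem canManipulate_ofPairs (hL : ValidPairs m L) (hf : ∀ q ∈ L, q.1 ≠ p) :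
    CanManipulate firstLast ⟨.ofPairs m p hp L, w⟩ ↔ Balanced L w := by
  have hiff : CanManipulate firstLast ⟨.ofPairs m p hp L, w⟩ ↔ ∃ W : Fin w → Vote m,
      (∀ i, ∃ v : Fin L.length, W i = pairVote m L[v].1 L[v].2) ∧
      ∀ c : Fin m, score (firstLastVector m)
          (Fin.append (fun v : Fin L.length => pairVote m L[v].1 L[v].2) W) c ≤
        score (firstLastVector m)
          (Fin.append (fun v : Fin L.length => pairVote m L[v].1 L[v].2) W) ⟨p, hp⟩ := Iff.rfl
  have hmem : ∀ q : Fin w → ℕ × ℕ, (∀ x, q x ∈ L) →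
      ∀ x, Fin.append (fun v : Fin L.length => L[v]) q x ∈ L := by
    intro q hq x
    refine Fin.addCases (fun i => ?_) (fun i => ?_) x
    · rw [Fin.append_left]
      exact List.getElem_mem _
    · rw [Fin.append_right]
      exact hq i
  have hscore : ∀ q : Fin w → ℕ × ℕ, (∀ x, q x ∈ L) → ∀ c : Fin m,
      score (firstLastVector m) (Fin.append (fun v : Fin L.length => pairVote m L[v].1 L[v].2)
        fun x => pairVote m (q x).1 (q x).2) c =
      listScore L c + ∑ x, pairScore (q x).1 (q x).2 (c : ℕ) := by
    intro q hq c
    have h := score_pairVote (m := m) (Fin.append (fun v : Fin L.length => L[v]) q)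
      (fun x => hL _ (hmem q hq x)) c
    rw [Fin.sum_univ_add] at h
    simp only [Fin.append_left, Fin.append_right] at h
    rw [listScore_eq_sum, ← h]
    congr 1
    funext x
    refine Fin.addCases (fun i => ?_) (fun i => ?_) x
    · rw [Fin.append_left, Fin.append_left]
    · rw [Fin.append_right, Fin.append_right]
  rw [hiff]
  constructor
  · rintro ⟨W, hW, h⟩
    choose g hg using hW
    have hq : ∀ x, L[g x] ∈ L := fun x => List.getElem_mem _
    refine ⟨fun x => L[g x], hq, ?_⟩
    obtain rfl : W = fun x => pairVote m (L[g x]).1 (L[g x]).2 := funext hg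
    simp only [hscore _ hq] at h
    have h3 := score_eq_zero hL (hmem _ hq) hf
    simp only [Fin.sum_univ_add, Fin.append_left, Fin.append_right, ← listScore_eq_sum] at h3
    exact h3 fun c hc => h ⟨c, hc⟩
  · rintro ⟨q, hq, h⟩
    refine ⟨fun x => pairVote m (q x).1 (q x).2, fun x => ?_, fun c => ?_⟩
    · obtain ⟨i, hi, hiq⟩ := List.mem_iff_getElem.1 (hq x)
      exact ⟨⟨i, hi⟩, by simp [hiq]⟩
    · rw [hscore q hq, hscore q hq, h, h]

/-- The `w` additional voters each cost `p` a point that it cannot regain, so all of them have to be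
bribed. This uses up the limit and turns them into manipulators with votes from `L`. -/
theorem canBribe_ofPairs (hp0 : 0 < p) (hL : ValidPairs m L) (hf : ∀ q ∈ L, q.1 ≠ p ∧ q.2 ≠ p) :
    CanBribe firstLast ⟨.ofPairs m p hp (L ++ List.replicate w (0, p)), w⟩ ↔ Balanced L w := by
  obtain ⟨L', hL'⟩ : ∃ L', L' = L ++ List.replicate w (0, p) := ⟨_, rfl⟩
  rw [← hL']
  have hiff : CanBribe firstLast ⟨.ofPairs m p hp L', w⟩ ↔ ∃ (S : Finset (Fin L'.length))
      (V : Fin L'.length → Vote m), S.card ≤ w ∧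
      (∀ i ∈ S, ∃ v : Fin L'.length, V i = pairVote m L'[v].1 L'[v].2) ∧
      (∀ i ∉ S, V i = pairVote m L'[i].1 L'[i].2) ∧
      ∀ c : Fin m, score (firstLastVector m) V c ≤ score (firstLastVector m) V ⟨p, hp⟩ := Iff.rfl
  have hlen : L.length + w = L'.length := by simp [hL']
  have hmem' : ∀ q ∈ L', q ∈ L ∨ q = (0, p) := by
    intro q hq
    rw [hL', List.mem_append] at hq
    exact hq.imp id List.eq_of_mem_replicate
  have hvalid : ValidPairs m L' := by
    intro q hq
    rcases hmem' q hq with h | rfl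
    · exact hL q h
    · exact ⟨hp0.trans hp, hp, hp0.ne⟩
  have hf' : ∀ q ∈ L', q.1 ≠ p := by
    intro q hq
    rcases hmem' q hq with h | rfl
    · exact (hf q h).1
    · exact hp0.ne
  have hold : ∀ i : Fin L'.length, (h : (i : ℕ) < L.length) → L'[i] = L[(i : ℕ)] := by
    intro i h
    simp [hL', List.getElem_append_left h]
  have hnew : ∀ i : Fin L'.length, L.length ≤ (i : ℕ) → L'[i] = (0, p) := by
    intro i h
    simp [hL', List.getElem_append_right h]
  let J : Finset (Fin L'.length) := Finset.univ.filter fun i => L.length ≤ (i : ℕ)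
  have hJ : J.card = w := by
    have h1 := Finset.card_filter_add_card_filter_not (s := (Finset.univ : Finset (Fin L'.length)))
      fun i => (i : ℕ) < L.length
    rw [Fin.card_filter_val_lt] at h1
    simp only [not_lt, Finset.card_univ, Fintype.card_fin] at h1
    change (Finset.univ.filter fun i : Fin L'.length => L.length ≤ (i : ℕ)).card = w
    omega
  have hsum : ∀ (q : Fin L'.length → ℕ × ℕ) (c : ℕ),
      (∀ i : Fin L'.length, (h : (i : ℕ) < L.length) → q i = L[(i : ℕ)]) →
      ∑ i, pairScore (q i).1 (q i).2 c = listScore L c +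
        ∑ x : Fin w, pairScore (q (finCongr hlen (Fin.natAdd _ x))).1
          (q (finCongr hlen (Fin.natAdd _ x))).2 c := by
    intro q c hq
    rw [← Equiv.sum_comp (finCongr hlen), Fin.sum_univ_add, listScore_eq_sum]
    congr 1
    refine Finset.sum_congr rfl fun i _ => ?_
    have hi := hq (finCongr hlen (Fin.castAdd w i)) (by simp)
    rw [hi]
    rfl
  rw [hiff]
  constructor
  · rintro ⟨S, V, hS, h1, h2, h3⟩
    have hg : ∀ i, ∃ v : Fin L'.length, V i = pairVote m L'[v].1 L'[v].2 ∧ (i ∉ S → v = i) := by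
      intro i
      by_cases hi : i ∈ S
      · obtain ⟨v, hv⟩ := h1 i hi
        exact ⟨v, hv, fun h => absurd hi h⟩
      · exact ⟨i, h2 i hi, fun _ => rfl⟩
    choose g hg hg' using hg
    obtain ⟨q, hqg⟩ : ∃ q : Fin L'.length → ℕ × ℕ, ∀ i, q i = L'[g i] := ⟨_, fun _ => rfl⟩
    have hq : ∀ i, q i ∈ L' := fun i => by
      rw [hqg]
      exact List.getElem_mem _
    obtain rfl : V = fun i => pairVote m (q i).1 (q i).2 := funext fun i => by rw [hg i, hqg]
    simp only [score_pairVote q fun x => hvalid _ (hq x)] at h3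
    have h4 := score_eq_zero hvalid hq hf' fun c hc => h3 ⟨c, hc⟩
    -- The score of `p` is zero and is a sum of nonpositive terms, so no final vote ranks `p` last.
    have h5 : ∀ i, q i ∈ L := by
      intro i
      have hi := (Finset.sum_eq_zero_iff_of_nonpos fun i _ => by
        have := hf' _ (hq i)
        unfold pairScore
        rw [if_neg (Ne.symm this)]
        split_ifs <;> norm_num).1 (h4 p) i (Finset.mem_univ i)
      rcases hmem' _ (hq i) with h | h
      · exact h
      · rw [h] at hi
        simp [pairScore, hp0.ne'] at hi
    -- An additional voter who is not bribed would still rank `p` last.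
    have h6 : J ⊆ S := by
      intro i hi
      by_contra hiS
      have hi' : L.length ≤ (i : ℕ) := (Finset.mem_filter.1 hi).2
      have h7 := h5 i
      have h8 : q i = (0, p) := by
        rw [hqg, ← hnew i hi']
        simp only [hg' i hiS]
      rw [h8] at h7
      exact (hf _ h7).2 rfl
    have h7 : J = S := Finset.eq_of_subset_of_card_le h6 (by omega)
    refine ⟨fun x => q (finCongr hlen (Fin.natAdd _ x)), fun x => h5 _, fun c => ?_⟩
    rw [← hsum q c, h4]
    intro i hi
    have hiS : i ∉ S := by
      rw [← h7]
      intro h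
      have := (Finset.mem_filter.1 h).2
      omega
    rw [hqg, ← hold i hi]
    simp only [hg' i hiS]
  · rintro ⟨q, hq, h⟩
    -- The original voters keep their votes, and the additional ones adopt the balancing votes in
    -- order.
    let r : Fin L'.length → ℕ × ℕ := fun i =>
      if hi : (i : ℕ) < L.length then L[(i : ℕ)] else q ⟨i - L.length, by omega⟩
    have hr : ∀ i, r i ∈ L := by
      intro i
      by_cases hi : (i : ℕ) < L.length
      · simp [r, hi]
      · simp only [r, hi, dif_neg, not_false_eq_true]
        exact hq _
    have hr0 : ∀ c, ∑ i, pairScore (r i).1 (r i).2 c = 0 := by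
      intro c
      rw [hsum r c fun i hi => dif_pos hi, ← h c]
      congr 1
      refine Finset.sum_congr rfl fun x _ => ?_
      have : r (finCongr hlen (Fin.natAdd _ x)) = q x := by
        simp [r]
      rw [this]
    refine ⟨J, fun i => pairVote m (r i).1 (r i).2, hJ.le, fun i _ => ?_, fun i hi => ?_, fun c => ?_⟩
    · obtain ⟨j, hj, hjr⟩ := List.mem_iff_getElem.1 (hr i)
      refine ⟨⟨j, by omega⟩, ?_⟩
      rw [hold ⟨j, by omega⟩ hj]
      simp only [hjr]
    · have hi' : (i : ℕ) < L.length := by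
        by_contra hlt
        exact hi (Finset.mem_filter.2 ⟨Finset.mem_univ i, by omega⟩)
      rw [hold i hi']
      simp [r, hi']
    · rw [score_pairVote r fun x => hL _ (hr x), score_pairVote r fun x => hL _ (hr x), hr0, hr0]

end balanced

/-! ### The election of a bipartite graph -/

/-- Scores telescope along paths: the votes on a path have the same effect as a single vote from its
start to its end. -/
theorem pairScore_add {α : Type} [DecidableEq α] (a b d c : α) :
    pairScore a b c + pairScore b d c = pairScore a d c := by
  unfold pairScore
  ring

theorem listScore_cons (q : ℕ × ℕ) (L : List (ℕ × ℕ)) (c : ℕ) :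
    listScore (q :: L) c = pairScore q.1 q.2 c + listScore L c := by
  simp [listScore]

theorem listScore_nil (c : ℕ) : listScore [] c = 0 := rfl

theorem listScore_flatMap_range (n : ℕ) (f : ℕ → List (ℕ × ℕ)) (c : ℕ) :
    listScore ((List.range n).flatMap f) c = ∑ i ∈ Finset.range n, listScore (f i) c := by
  induction n with
  | zero => rfl
  | succ n ih =>
    rw [List.range_succ, List.flatMap_append, listScore_append, ih, Finset.sum_range_succ]
    simp

theorem listScore_chain (x s c : ℕ) :
    listScore ((List.range s).flatMap fun t => [(x + t, x + t + 1)]) c = pairScore x (x + s) c := by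
  rw [listScore_flatMap_range]
  induction s with
  | zero => simp [pairScore]
  | succ s ih =>
    rw [Finset.sum_range_succ, ih, listScore_cons, listScore_nil, add_zero, pairScore_add, add_assoc]

namespace BipartiteElection

/-- The votes on the path that leads from the right vertex `j` to the left vertex `i`. -/
def path (n j i : ℕ) : List (ℕ × ℕ) :=
  (2 * n + j, 3 * n) :: (((List.range (2 * n)).flatMap fun t => [(3 * n + t, 3 * n + t + 1)]) ++
    [(3 * n + 2 * n, i)])

/-- The votes for a pair of vertices, where `t = 2` for a red edge and `t = 1` for another edge. -/
def cell (n t i j : ℕ) : List (ℕ × ℕ) :=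
  if t = 0 then [] else
    (if t = 2 then [(i, n + i), (n + i, 2 * n + j)] else [(i, 2 * n + j)]) ++ path n j i

/-- The votes for a bipartite graph. -/
def pairs (n : ℕ) (e : ℕ → ℕ → ℕ) : List (ℕ × ℕ) :=
  ((List.range n).flatMap fun i => (List.range n).flatMap fun j => cell n (e i j) i j) ++
    (List.range n).flatMap fun i => path n i i

theorem listScore_path (n j i c : ℕ) : listScore (path n j i) c = pairScore (2 * n + j) i c := by
  rw [path, listScore_cons, listScore_append, listScore_chain, listScore_cons, listScore_nil, add_zero,
    pairScore_add, pairScore_add]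

/-- The votes of an edge and the path back form a closed cycle, so they become available without
changing the scores. -/
theorem listScore_cell (n t i j c : ℕ) : listScore (cell n t i j) c = 0 := by
  unfold cell
  split_ifs <;> simp only [listScore_append, listScore_cons, listScore_nil, listScore_path,
    add_zero, pairScore_add] <;> simp [pairScore]

/-- Only the additional paths remain. They give every right candidate one point too many and every
left candidate one too few, which the new votes have to repair. -/
theorem listScore_pairs (n : ℕ) (e : ℕ → ℕ → ℕ) (c : ℕ) :
    listScore (pairs n e) c = ∑ i : Fin n, pairScore (2 * n + i) (i : ℕ) c := by
  simp only [pairs, listScore_append, listScore_flatMap_range, listScore_cell, listScore_path,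
    Finset.sum_const_zero, zero_add]
  rw [Finset.sum_range]

/-- The potential of a candidate. -/
def potential (n c : ℕ) : ℤ :=
  -- Along a path the potential falls by one with each of its `2 * n + 2` votes, from `0` at the
  -- right vertex to `-(2 * n + 2)` at the left vertex.
  if c < n then -(2 * n + 2) else if c < 3 * n then 0 else 3 * n - c - 1

/-- The votes on a path, and the votes for the edges. -/
theorem mem_pairs {n : ℕ} {e : ℕ → ℕ → ℕ} {q : ℕ × ℕ} (hq : q ∈ pairs n e) :
    (2 * n ≤ q.1 ∧ q.1 < 5 * n + 1 ∧ q.2 < 5 * n + 1 ∧ q.1 ≠ q.2 ∧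
      potential n q.1 - potential n q.2 = 1) ∨
    ∃ i j : Fin n, (e i j ≠ 0 ∧ e i j ≠ 2 ∧ q = ((i : ℕ), 2 * n + j)) ∨
      (e i j = 2 ∧ (q = ((i : ℕ), n + i) ∨ q = (n + i, 2 * n + (j : ℕ)))) := by
  have hpath : ∀ i < n, ∀ j < n, q ∈ path n j i → (2 * n ≤ q.1 ∧ q.1 < 5 * n + 1 ∧
      q.2 < 5 * n + 1 ∧ q.1 ≠ q.2 ∧ potential n q.1 - potential n q.2 = 1) := by
    intro i hi j hj h
    simp only [path, List.mem_cons, List.mem_append, List.mem_flatMap, List.mem_range,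
      List.not_mem_nil, or_false] at h
    rcases h with rfl | ⟨t, ht, rfl⟩ | rfl
    all_goals
      simp only [potential]
      refine ⟨by omega, by omega, by omega, by omega, ?_⟩
      split_ifs <;> omega
  simp only [pairs, List.mem_append, List.mem_flatMap, List.mem_range] at hq
  rcases hq with ⟨i, hi, j, hj, h⟩ | ⟨i, hi, h⟩
  · unfold cell at h
    split_ifs at h with h1 h2
    · simp at h
    · rcases List.mem_append.1 h with h | h
      · simp only [List.mem_cons, List.not_mem_nil, or_false] at h
        exact .inr ⟨⟨i, hi⟩, ⟨j, hj⟩, .inr ⟨h2, h⟩⟩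
      · exact .inl (hpath i hi j hj h)
    · rcases List.mem_append.1 h with h | h
      · simp only [List.mem_cons, List.not_mem_nil, or_false] at h
        exact .inr ⟨⟨i, hi⟩, ⟨j, hj⟩, .inl ⟨h1, h2, h⟩⟩
      · exact .inl (hpath i hi j hj h)
  · exact .inl (hpath i hi i hi h)

theorem cell_subset {n : ℕ} {e : ℕ → ℕ → ℕ} (i j : Fin n) {q : ℕ × ℕ}
    (hq : q ∈ cell n (e i j) i j) : q ∈ pairs n e := by
  refine List.mem_append_left _ (List.mem_flatMap.2 ⟨i, List.mem_range.2 i.2, ?_⟩)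
  exact List.mem_flatMap.2 ⟨j, List.mem_range.2 j.2, hq⟩

theorem validPairs (n : ℕ) (e : ℕ → ℕ → ℕ) : ValidPairs (5 * n + 2) (pairs n e) := by
  intro q hq
  rcases mem_pairs hq with h | ⟨i, j, ⟨_, _, rfl⟩ | ⟨_, rfl | rfl⟩⟩
  all_goals omega

theorem ne_of_mem_pairs {n : ℕ} {e : ℕ → ℕ → ℕ} (q : ℕ × ℕ) (hq : q ∈ pairs n e) :
    q.1 ≠ 5 * n + 1 ∧ q.2 ≠ 5 * n + 1 := by
  rcases mem_pairs hq with h | ⟨i, j, ⟨_, _, rfl⟩ | ⟨_, rfl | rfl⟩⟩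
  all_goals omega

/-- Balance in terms of degrees: the new votes must be a flow with one unit of supply at each left
vertex and one unit of demand at each right vertex. -/
theorem card_first_sub_card_last {n w : ℕ} {e : ℕ → ℕ → ℕ} {q : Fin w → ℕ × ℕ}
    (hs : ∀ c, listScore (pairs n e) c + ∑ x, pairScore (q x).1 (q x).2 c = 0) (c : ℕ) :
    ((Finset.univ.filter fun x => (q x).1 = c).card : ℤ) -
      (Finset.univ.filter fun x => (q x).2 = c).card =
      (if c < n then 1 else 0) - if 2 * n ≤ c ∧ c < 3 * n then 1 else 0 := by
  have h1 := hs c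
  rw [listScore_pairs] at h1
  simp only [pairScore, Finset.sum_sub_distrib, eq_comm (a := c), ← Finset.natCast_card_filter] at h1
  have h2 : (Finset.univ.filter fun i : Fin n => (i : ℕ) = c).card = if c < n then 1 else 0 := by
    split_ifs with h
    · rw [Finset.card_eq_one]
      exact ⟨⟨c, h⟩, by ext i; simp [Fin.ext_iff]⟩
    · rw [Finset.card_eq_zero, Finset.filter_eq_empty_iff]
      intro i _
      omega
  have h3 : (Finset.univ.filter fun i : Fin n => 2 * n + (i : ℕ) = c).card =
      if 2 * n ≤ c ∧ c < 3 * n then 1 else 0 := by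
    split_ifs with h
    · rw [Finset.card_eq_one]
      exact ⟨⟨c - 2 * n, by omega⟩, by ext i; simp [Fin.ext_iff]; omega⟩
    · rw [Finset.card_eq_zero, Finset.filter_eq_empty_iff]
      intro i _
      omega
  rw [h2, h3] at h1
  push_cast at h1
  linarith

theorem card_middle {n w : ℕ} {e : ℕ → ℕ → ℕ} {q : Fin w → ℕ × ℕ}
    (hs : ∀ c, listScore (pairs n e) c + ∑ x, pairScore (q x).1 (q x).2 c = 0) (i : Fin n) :
    (Finset.univ.filter fun x => (q x).1 = n + i).card =
    (Finset.univ.filter fun x => (q x).2 = n + i).card := by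
  have h := card_first_sub_card_last hs (n + i)
  rw [if_neg (by omega), if_neg (by omega)] at h
  omega

/-! ### From balancing votes to a perfect matching -/

section forward

variable {n k : ℕ} {e : ℕ → ℕ → ℕ} {q : Fin (n + k) → ℕ × ℕ}


/-- No vote on a path is used, and every left vertex is ranked first once. -/
theorem card_first_lt (hk : k ≤ n) (hq : ∀ x, q x ∈ pairs n e)
    (hs : ∀ c, listScore (pairs n e) c + ∑ x, pairScore (q x).1 (q x).2 c = 0) :
    (Finset.univ.filter fun x => (q x).1 < n).card = n ∧
    ∀ x, (q x).1 < 2 * n := by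
  -- The balance equations are weighted with the potential; each vote then contributes the potential
  -- difference of its ends.
  have h1 : ∑ c ∈ Finset.range (5 * n + 2), potential n c *
      (listScore (pairs n e) c + ∑ x, pairScore (q x).1 (q x).2 c) = 0 :=
    Finset.sum_eq_zero fun c _ => by rw [hs, mul_zero]
  simp only [listScore_pairs, mul_add, Finset.sum_add_distrib, Finset.mul_sum] at h1
  rw [Finset.sum_comm, Finset.sum_comm (s := Finset.range _)] at h1
  rw [Finset.sum_congr rfl fun i _ => sum_pairScore_range (by omega) (by omega) _,
    Finset.sum_congr rfl fun x _ => sum_pairScore_range (validPairs n e _ (hq x)).1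
      (validPairs n e _ (hq x)).2.1 _] at h1
  have h2 : ∀ i : Fin n, potential n (2 * n + i) - potential n i = 2 * n + 2 := by
    intro i
    simp only [potential]
    split_ifs <;> omega
  have h3 : ∀ x, potential n (q x).1 - potential n (q x).2 =
      -(2 * n + 2) * (if (q x).1 < n then 1 else 0) + if 2 * n ≤ (q x).1 then 1 else 0 := by
    intro x
    rcases mem_pairs (hq x) with h | ⟨i, j, ⟨_, _, h⟩ | ⟨_, h | h⟩⟩
    · rw [h.2.2.2.2, if_neg (by omega), if_pos h.1]
      ring
    · rw [h]
      simp only [potential]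
      split_ifs <;> omega
    · rw [h]
      simp only [potential]
      split_ifs <;> omega
    · rw [h]
      simp only [potential]
      split_ifs <;> omega
  simp only [h2, h3, Finset.sum_add_distrib, ← Finset.mul_sum, Finset.sum_const, Finset.card_univ,
    Fintype.card_fin, ← Finset.natCast_card_filter] at h1
  have h4 : (Finset.univ.filter fun x => 2 * n ≤ (q x).1).card ≤ n + k := by
    simpa using Finset.card_le_univ (Finset.univ.filter fun x => 2 * n ≤ (q x).1)
  generalize ha : (Finset.univ.filter fun x => (q x).1 < n).card = a at h1 ⊢
  generalize hh : (Finset.univ.filter fun x => 2 * n ≤ (q x).1).card = h at h1 h4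
  -- Votes on paths contribute `1`, votes that start in a left vertex contribute `-(2 * n + 2)`, and
  -- votes that start in a middle vertex contribute nothing; the initial surplus contributes `n * (2
  -- * n + 2)`.
  have h5 : (h : ℤ) = (2 * n + 2) * (a - n) := by
    simp only [nsmul_eq_mul] at h1
    linear_combination h1
  -- As `0 ≤ h ≤ n + k ≤ 2 * n`, the only multiple of `2 * n + 2` available for `h` is zero.
  have h6 : a = n := by
    have h7 : ((a : ℤ) - n) < 1 := by
      by_contra! hge
      nlinarith
    have h8 : (0 : ℤ) ≤ a - n := by
      by_contra! hlt
      nlinarith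
    omega
  refine ⟨h6, fun x => ?_⟩
  have h9 : h = 0 := by
    rw [h6, sub_self, mul_zero] at h5
    exact_mod_cast h5
  rw [h9, Finset.card_eq_zero, Finset.filter_eq_empty_iff] at hh
  exact not_le.1 (hh (Finset.mem_univ x))

theorem exists_edge (hk : k ≤ n) (hq : ∀ x, q x ∈ pairs n e)
    (hs : ∀ c, listScore (pairs n e) c + ∑ x, pairScore (q x).1 (q x).2 c = 0) (x : Fin (n + k)) :
    ∃ i j : Fin n,
    (e i j ≠ 0 ∧ e i j ≠ 2 ∧ q x = ((i : ℕ), 2 * n + j)) ∨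
      (e i j = 2 ∧ (q x = ((i : ℕ), n + i) ∨ q x = (n + i, 2 * n + (j : ℕ)))) := by
  have h1 := (card_first_lt hk hq hs).2 x
  rcases mem_pairs (hq x) with h | h
  · omega
  · exact h

/-- Left vertices are ranked last only by votes on paths, which are not used; so the supply of one
unit is the number of first places. -/
theorem card_left (hk : k ≤ n) (hq : ∀ x, q x ∈ pairs n e)
    (hs : ∀ c, listScore (pairs n e) c + ∑ x, pairScore (q x).1 (q x).2 c = 0) (i : Fin n) :
    (Finset.univ.filter fun x => (q x).1 = i).card = 1 := by
  have h := card_first_sub_card_last hs i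
  have h1 : (Finset.univ.filter fun x => (q x).2 = i).card = 0 := by
    rw [Finset.card_eq_zero, Finset.filter_eq_empty_iff]
    intro x _ hx
    obtain ⟨i', j, ⟨_, _, h⟩ | ⟨_, h | h⟩⟩ := exists_edge hk hq hs x <;> rw [h] at hx <;>
      simp only at hx <;> omega
  rw [h1, if_pos i.2, if_neg (by omega)] at h
  omega

/-- Right vertices are ranked first only by votes on paths, which are not used; so the demand of one
unit is the number of last places. -/
theorem card_right (hk : k ≤ n) (hq : ∀ x, q x ∈ pairs n e)
    (hs : ∀ c, listScore (pairs n e) c + ∑ x, pairScore (q x).1 (q x).2 c = 0) (j : Fin n) :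
    (Finset.univ.filter fun x => (q x).2 = 2 * n + j).card = 1 := by
  have h := card_first_sub_card_last hs (2 * n + j)
  have h1 : (Finset.univ.filter fun x => (q x).1 = 2 * n + j).card = 0 := by
    rw [Finset.card_eq_zero, Finset.filter_eq_empty_iff]
    intro x _ hx
    have := (card_first_lt hk hq hs).2 x
    omega
  rw [h1, if_neg (by omega), if_pos (by omega)] at h
  omega

/-- The unit of flow that leaves `i` is followed to a right vertex: directly along an edge that is
not red, or through the middle vertex `n + i` and out along a red edge at `i`. The middle vertex is
used exactly in the second case. The vote `y` is the one that enters the right vertex. -/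
theorem exists_matched (hk : k ≤ n) (hq : ∀ x, q x ∈ pairs n e)
    (hs : ∀ c, listScore (pairs n e) c + ∑ x, pairScore (q x).1 (q x).2 c = 0) (i : Fin n) :
    ∃ (j : Fin n) (y : Fin (n + k)), e i j ≠ 0 ∧
    (q y).2 = 2 * n + j ∧ ((q y).1 = i ∨ (q y).1 = n + i) ∧
    (Finset.univ.filter fun x => (q x).1 = n + i).card = if e i j = 2 then 1 else 0 := by
  obtain ⟨x, hx⟩ := Finset.card_eq_one.1 (card_left hk hq hs i)
  have hmem : ∀ y, (q y).1 = i ↔ y = x := fun y =>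
    ⟨fun h => Finset.mem_singleton.1 (hx.subset (Finset.mem_filter.2 ⟨Finset.mem_univ y, h⟩)), by
      rintro rfl
      exact (Finset.mem_filter.1 (hx.superset (Finset.mem_singleton_self _))).2⟩
  have hx1 : (q x).1 = i := (hmem x).2 rfl
  have hx2 : ∀ y, (q y).1 = i → y = x := fun y => (hmem y).1
  -- The middle vertex is entered only from `i`, and only one vote starts in `i`.
  have hmid : ∀ y, (q y).2 = n + i → y = x := by
    intro y hy
    refine hx2 y ?_
    obtain ⟨i', j, ⟨_, _, h⟩ | ⟨_, h | h⟩⟩ := exists_edge hk hq hs y <;> rw [h] at hy ⊢ <;>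
      simp only at hy ⊢ <;> omega
  have hm := card_middle hs i
  obtain ⟨i', j, ⟨h1, h2, h⟩ | ⟨h1, h | h⟩⟩ := exists_edge hk hq hs x
  · have hi : i' = i := Fin.ext (by rw [h] at hx1; exact hx1)
    subst hi
    refine ⟨j, x, h1, by rw [h], .inl hx1, ?_⟩
    rw [if_neg h2, hm, Finset.card_eq_zero, Finset.filter_eq_empty_iff]
    intro y _ hy
    rw [hmid y hy, h] at hy
    simp only at hy
    omega
  · have hi : i' = i := Fin.ext (by rw [h] at hx1; exact hx1)
    subst hi
    have h3 : (Finset.univ.filter fun x => (q x).1 = n + i').card = 1 := by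
      rw [hm, Finset.card_eq_one]
      refine ⟨x, Finset.eq_singleton_iff_unique_mem.2 ⟨?_, ?_⟩⟩
      · exact Finset.mem_filter.2 ⟨Finset.mem_univ x, by rw [h]⟩
      · exact fun y hy => hmid y (Finset.mem_filter.1 hy).2
    obtain ⟨y, hy⟩ := Finset.card_pos.1 (h3.symm ▸ Nat.one_pos)
    have hy1 : (q y).1 = n + i' := (Finset.mem_filter.1 hy).2
    -- The vertex `j` attached to the vote into the middle vertex is only some red neighbour; the
    -- partner is determined by the vote `y` out of the middle vertex.
    obtain ⟨i'', j', ⟨_, _, h4⟩ | ⟨h5, h4 | h4⟩⟩ := exists_edge hk hq hs y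
    · rw [h4] at hy1
      simp only at hy1
      omega
    · rw [h4] at hy1
      simp only at hy1
      omega
    · have hi : i'' = i' := Fin.ext (by rw [h4] at hy1; simpa using hy1)
      subst hi
      exact ⟨j', y, by omega, by rw [h4], .inr hy1, by rw [h3, if_pos h5]⟩
  · rw [h] at hx1
    simp only at hx1
    omega

/-- The partner map is injective: a right vertex is entered by one vote only, and the start of that
vote determines `i`. Of the `n + k` votes, `n` start in left vertices, so `k` start in middle
vertices, one for each red edge. -/
theorem exists_perm_of_balanced (hk : k ≤ n) (hq : ∀ x, q x ∈ pairs n e)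
    (hs : ∀ c, listScore (pairs n e) c + ∑ x, pairScore (q x).1 (q x).2 c = 0) :
    ∃ σ : Equiv.Perm (Fin n), (∀ i : Fin n, e i (σ i) ≠ 0) ∧
    (Finset.univ.filter fun i : Fin n => e i (σ i) = 2).card = k := by
  choose τ y h1 h2 h3 h4 using exists_matched hk hq hs
  have hinj : Function.Injective τ := by
    intro i i' h
    have h5 : y i = y i' := Finset.card_le_one.1 (card_right hk hq hs (τ i)).le _
      (Finset.mem_filter.2 ⟨Finset.mem_univ _, h2 i⟩) _
      (Finset.mem_filter.2 ⟨Finset.mem_univ _, h ▸ h2 i'⟩)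
    have h6 := h3 i
    have h7 := h3 i'
    rw [h5] at h6
    exact Fin.ext (by omega)
  refine ⟨Equiv.ofBijective τ (Finite.injective_iff_bijective.1 hinj), h1, ?_⟩
  simp only [Equiv.ofBijective_apply]
  have h5 : ∀ x, (1 : ℕ) = (if (q x).1 < n then 1 else 0) +
      ∑ i : Fin n, if (q x).1 = n + i then 1 else 0 := by
    intro x
    have h6 := (card_first_lt hk hq hs).2 x
    by_cases h7 : (q x).1 < n
    · rw [if_pos h7, Finset.sum_eq_zero fun i _ => if_neg (by omega), add_zero]
    · rw [if_neg h7, Finset.sum_eq_single ⟨(q x).1 - n, by omega⟩]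
      · rw [if_pos (by simp only; omega)]
      · intro i _ hi
        rw [if_neg]
        intro h
        exact hi (Fin.ext (by simp only; omega))
      · simp
  have h6 : n + k = ∑ x : Fin (n + k), 1 := by simp
  rw [Finset.sum_congr rfl fun x _ => h5 x, Finset.sum_add_distrib, Finset.sum_comm,
    ← Finset.card_filter, (card_first_lt hk hq hs).1] at h6
  simp only [← Finset.card_filter, h4] at h6
  omega

end forward

/-- The first `n` votes leave the left vertices, and the last `k` complete the red edges from the
middle vertices. They telescope to one vote from `i` to the partner of `i`, for each `i`, which
cancels the surplus because `σ` permutes the right vertices. -/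
theorem balanced_of_perm {n k : ℕ} {e : ℕ → ℕ → ℕ} (σ : Equiv.Perm (Fin n))
    (h : ∀ i : Fin n, e i (σ i) ≠ 0) (hk : (Finset.univ.filter fun i : Fin n => e i (σ i) = 2).card = k) :
    Balanced (pairs n e) (n + k) := by
  let ρ := (Finset.equivFinOfCardEq hk).symm
  have hρ : ∀ t, e (ρ t).1 (σ (ρ t).1) = 2 := fun t => (Finset.mem_filter.1 (ρ t).2).2
  refine ⟨Fin.append (fun i : Fin n => if e i (σ i) = 2 then ((i : ℕ), n + (i : ℕ)) else (i, 2 * n + σ i))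
    fun t => (n + (ρ t).1, 2 * n + σ (ρ t).1), fun x => ?_, fun c => ?_⟩
  · refine Fin.addCases (fun i => ?_) (fun t => ?_) x
    · rw [Fin.append_left]
      refine cell_subset i (σ i) ?_
      rw [cell, if_neg (h i)]
      refine List.mem_append_left _ ?_
      split_ifs <;> simp
    · rw [Fin.append_right]
      refine cell_subset (ρ t).1 (σ (ρ t).1) ?_
      simp [cell, hρ]
  · rw [listScore_pairs, Fin.sum_univ_add]
    simp only [Fin.append_left, Fin.append_right]
    have h1 : ∑ t : Fin k, pairScore (n + ((ρ t).1 : ℕ)) (2 * n + (σ (ρ t).1 : ℕ)) c =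
        ∑ i : Fin n, if e i (σ i) = 2 then pairScore (n + (i : ℕ)) (2 * n + (σ i : ℕ)) c else 0 := by
      rw [Equiv.sum_comp ρ fun i => pairScore (n + (i.1 : ℕ)) (2 * n + (σ i.1 : ℕ)) c,
        Finset.sum_coe_sort _ fun i : Fin n => pairScore (n + (i : ℕ)) (2 * n + (σ i : ℕ)) c,
        Finset.sum_filter]
    have h2 : ∀ i : Fin n, pairScore (if e i (σ i) = 2 then ((i : ℕ), n + (i : ℕ)) else
          ((i : ℕ), 2 * n + (σ i : ℕ))).1 (if e i (σ i) = 2 then ((i : ℕ), n + (i : ℕ)) else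
          ((i : ℕ), 2 * n + (σ i : ℕ))).2 c +
        (if e i (σ i) = 2 then pairScore (n + (i : ℕ)) (2 * n + (σ i : ℕ)) c else 0) =
        pairScore (i : ℕ) (2 * n + (σ i : ℕ)) c := by
      intro i
      split_ifs
      · exact pairScore_add _ _ _ _
      · exact add_zero _
    rw [h1, ← Finset.sum_add_distrib, Finset.sum_congr rfl fun i _ => h2 i]
    simp only [pairScore, Finset.sum_sub_distrib]
    rw [Equiv.sum_comp σ fun j => if c = 2 * n + (j : ℕ) then (1 : ℤ) else 0]
    ring

theorem balanced_iff {n k : ℕ} (hk : k ≤ n) (e : ℕ → ℕ → ℕ) : Balanced (pairs n e) (n + k) ↔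
    ∃ σ : Equiv.Perm (Fin n), (∀ i : Fin n, e i (σ i) ≠ 0) ∧
      (Finset.univ.filter fun i : Fin n => e i (σ i) = 2).card = k :=
  ⟨fun ⟨_, hq, hs⟩ => exists_perm_of_balanced hk hq hs, fun ⟨σ, h, h'⟩ => balanced_of_perm σ h h'⟩

end BipartiteElection

/-! ### Reading a bipartite graph -/

namespace MatchingInstance

variable (I : MatchingInstance)

/-- The entries of the adjacency matrix: `2` for a red edge, `1` for another edge, and `0`
otherwise. -/
def entry (i j : ℕ) : ℕ :=
  if h : i < I.a ∧ j < I.b then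
    if (⟨i, h.1⟩, ⟨j, h.2⟩) ∈ I.red then 2 else if (⟨i, h.1⟩, ⟨j, h.2⟩) ∈ I.edges then 1 else 0
  else 0

theorem entry_ne_zero (i : Fin I.a) (j : Fin I.b) : I.entry i j ≠ 0 ↔ (i, j) ∈ I.edges := by
  have := @I.red_subset (i, j)
  simp only [entry, i.2, j.2, and_self, dif_pos, Fin.eta]
  split_ifs <;> simp_all

theorem entry_eq_two (i : Fin I.a) (j : Fin I.b) : I.entry i j = 2 ↔ (i, j) ∈ I.red := by
  simp only [entry, i.2, j.2, and_self, dif_pos, Fin.eta]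
  split_ifs <;> simp_all

theorem card_eq_of_hasExactMatching {I : MatchingInstance} (h : HasExactMatching I) : I.b = I.a := by
  obtain ⟨M, ⟨_, hA, hB⟩, _⟩ := h
  have h1 : M.card = I.a := by
    have := Finset.card_eq_sum_card_fiberwise (f := Prod.fst) (s := M) (t := Finset.univ) (by simp)
    rw [this, Finset.sum_congr rfl fun i _ => Finset.card_eq_one.2 ?_]
    · simp
    · obtain ⟨e, he, hu⟩ := hA i
      exact ⟨e, Finset.eq_singleton_iff_unique_mem.2
        ⟨Finset.mem_filter.2 he, fun y hy => hu y (Finset.mem_filter.1 hy)⟩⟩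
  have h2 : M.card = I.b := by
    have := Finset.card_eq_sum_card_fiberwise (f := Prod.snd) (s := M) (t := Finset.univ) (by simp)
    rw [this, Finset.sum_congr rfl fun j _ => Finset.card_eq_one.2 ?_]
    · simp
    · obtain ⟨e, he, hu⟩ := hB j
      exact ⟨e, Finset.eq_singleton_iff_unique_mem.2
        ⟨Finset.mem_filter.2 he, fun y hy => hu y (Finset.mem_filter.1 hy)⟩⟩
  omega

/-- The two side conditions are necessary and easy to test; the second one allows `k` to be written
in unary. -/
theorem hasExactMatching_iff_perm : HasExactMatching I ↔ (I.b = I.a ∧ I.k ≤ I.a) ∧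
    ∃ σ : Equiv.Perm (Fin I.a), (∀ i : Fin I.a, I.entry i (σ i) ≠ 0) ∧
      (Finset.univ.filter fun i : Fin I.a => I.entry i (σ i) = 2).card = I.k := by
  by_cases hb : I.b = I.a
  · rw [hasExactMatching_iff (Equiv.refl _) (finCongr hb)]
    have h1 : ∀ i j : Fin I.a, ((Equiv.refl (Fin I.a)).symm i, (finCongr hb).symm j) ∈ I.edges ↔
        I.entry i j ≠ 0 := fun i j => (I.entry_ne_zero i ((finCongr hb).symm j)).symm
    have h2 : ∀ i j : Fin I.a, ((Equiv.refl (Fin I.a)).symm i, (finCongr hb).symm j) ∈ I.red ↔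
        I.entry i j = 2 := fun i j => (I.entry_eq_two i ((finCongr hb).symm j)).symm
    simp only [h1, h2]
    constructor
    · rintro ⟨σ, h3, h4⟩
      refine ⟨⟨hb, ?_⟩, σ, h3, h4⟩
      rw [← h4]
      simpa using Finset.card_le_univ (Finset.univ.filter fun i : Fin I.a => I.entry i (σ i) = 2)
    · exact fun h => h.2
  · exact ⟨fun h => absurd (card_eq_of_hasExactMatching h) hb, fun h => absurd h.1.1 hb⟩

end MatchingInstance

theorem getElem?_concat {n l : ℕ} {s : Fin n → List Γ'} (hs : ∀ i, (s i).length = l) (i : Fin n)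
    {j : ℕ} (hj : j < l) : (concat s)[i * l + j]? = (s i)[j]? := by
  induction n with
  | zero => exact i.elim0
  | succ n ih =>
    rw [concat_succ]
    cases i using Fin.cases with
    | zero =>
      rw [Fin.val_zero, zero_mul, zero_add, List.getElem?_append_left (by rw [hs]; exact hj)]
    | succ i =>
      rw [Fin.val_succ, Nat.succ_mul, List.getElem?_append_right (by rw [hs]; omega), hs,
        show (i : ℕ) * l + l + j - l = i * l + j by omega]
      exact ih (fun i => hs _) i

theorem length_concat {n l : ℕ} {s : Fin n → List Γ'} (hs : ∀ i, (s i).length = l) :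
    (concat s).length = n * l := by
  induction n with
  | zero => simp [concat]
  | succ n ih =>
    rw [concat_succ, List.length_append, hs, ih fun i => hs _]
    ring

/-- Each matrix entry is one symbol and each row has two brackets, so positions can be computed: the
three numbers with their commas come first, rows have length `b + 2`, and the opening bracket
accounts for the `+ 1`. -/
theorem getElem?_encodeMatching (I : MatchingInstance) (i : Fin I.a) (j : Fin I.b) :
    (encodeMatching I)[(encodeNat I.k).length + 1 + (I.a + 1) + (I.b + 1) +
      (i * (I.b + 2) + (j + 1))]? = some (entrySymbol (I.entry i j)) := by
  unfold encodeMatching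
  have e1 : (encodeBinary I.k).length = (encodeNat I.k).length + 1 := by simp [encodeBinary]
  have e2 : ∀ a, (encodeUnary a).length = a + 1 := by simp [encodeUnary]
  rw [List.getElem?_append_right (by rw [e1]; omega), List.getElem?_append_right (by rw [e1, e2]; omega),
    List.getElem?_append_right (by rw [e1, e2, e2]; omega), e1, e2, e2]
  have hrow : ∀ i : Fin I.a, (concat fun j => encodePair (decide ((i, j) ∈ I.edges))
      (decide ((i, j) ∈ I.red))).length = I.b := fun i => by
    rw [length_concat (l := 1) (fun _ => rfl), mul_one]
  rw [show (encodeNat I.k).length + 1 + (I.a + 1) + (I.b + 1) + (i * (I.b + 2) + (j + 1)) -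
    ((encodeNat I.k).length + 1) - (I.a + 1) - (I.b + 1) = i * (I.b + 2) + (j + 1) by omega]
  rw [getElem?_concat (l := I.b + 2) (fun i => by
    rw [List.length_cons, List.length_append, hrow]
    rfl) i (by omega)]
  rw [List.getElem?_cons_succ, List.getElem?_append_left (by rw [hrow]; exact j.2)]
  have h := getElem?_concat (l := 1) (s := fun j => encodePair (decide ((i, j) ∈ I.edges))
      (decide ((i, j) ∈ I.red))) (fun _ => rfl) j Nat.one_pos
  rw [mul_one, add_zero] at h
  rw [h]
  simp only [encodePair, entrySymbol, MatchingInstance.entry, i.2, j.2, and_self, dif_pos, Fin.eta,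
    decide_eq_true_eq, List.getElem?_cons_zero]
  split_ifs <;> simp_all

theorem blockLength_encodeMatching (I : MatchingInstance) :
    Tm.blockLength (encodeMatching I) 1 = I.a ∧ Tm.blockLength (encodeMatching I) 2 = I.b := by
  unfold encodeMatching
  rw [Tm.blockLength_binary_succ, Tm.blockLength_binary_succ, Tm.blockLength_unary_zero,
    Tm.blockLength_unary_succ, Tm.blockLength_unary_zero]
  exact ⟨rfl, rfl⟩

/-! ### Emission of the election of a bipartite graph -/

namespace BipartiteElection

open Tm Em

/-- The term for the entry of the adjacency matrix at the position in the variables `10` and `11`. -/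
def cellTm : Tm :=
  letIn 15 (add (var 2) (add (mul (var 10) (add (var 1) (const 2))) (add (var 11) (const 1))))
    (add (add (letter (Γ'.bit true) (var 15)) (letter (Γ'.bit true) (var 15)))
      (letter (Γ'.bit false) (var 15)))

/-- Run a program for a pair of candidates, in the variables `20` and `21`. -/
def withPair (t u : Tm) (e : Em) : Em := letIn 20 t (letIn 21 u e)

/-- The term for the product with the number of vertices. -/
def times (a : ℕ) (t : Tm) : Tm := add (mul (const a) (var 1)) t

/-- Run a program for all pairs in a path. -/
def forPath (u : Tm) (e : Em) : Em :=
  (withPair (times 2 u) (times 3 (const 0)) e).seq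
  ((loop 12 (times 2 (const 0)) (withPair (times 3 (var 12)) (times 3 (add (var 12) (const 1))) e)).seq
  (withPair (times 3 (times 2 (const 0))) (var 10) e))

/-- Run a program for all pairs of candidates. The variable `5` holds the number of additional votes
that rank the preferred candidate last. -/
def forPairs (e : Em) : Em :=
  (loop 10 (var 1) (loop 11 (var 1) (letIn 14 cellTm (ite (var 14)
    ((ite (eq (var 14) (const 2))
      ((withPair (var 10) (times 1 (var 10)) e).seq (withPair (times 1 (var 10)) (times 2 (var 11)) e))
      (withPair (var 10) (times 2 (var 11)) e)).seq
    (forPath (var 11) e)) skip)))).seq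
  ((loop 10 (var 1) (forPath (var 10) e)).seq
  (loop 13 (var 5) (withPair (const 0) (times 5 (const 1)) e)))

/-- The program emits a string that depends on the pair in the variables `20` and `21`. -/
def Emits (x : List Γ') (n : ℕ) (e : Em) (F : ℕ × ℕ → List Sym) : Prop :=
  ∀ ρ : ℕ → ℕ, ρ 1 = n → e.eval x ρ = F (ρ 20, ρ 21)

section

variable {x : List Γ'} {n : ℕ} {e : Em} {F : ℕ × ℕ → List Sym} {ρ : ℕ → ℕ}

theorem eval_times (a : ℕ) (t : Tm) (h : ρ 1 = n) : (times a t).eval x ρ = a * n + t.eval x ρ := by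
  simp [times, Tm.eval, eval_mul, h]

/-- The second term is evaluated after the variable `20` has been set, so its value must not depend
on that variable. -/
theorem Emits.eval_withPair (hF : Emits x n e F) (h : ρ 1 = n) {t u : Tm} {f l : ℕ}
    (ht : t.eval x ρ = f) (hu : ∀ a, u.eval x (Function.update ρ 20 a) = l) :
    (withPair t u e).eval x ρ = F (f, l) := by
  simp only [withPair, Em.eval, ht, hu]
  rw [hF _ (by simp [h])]
  simp

theorem Emits.eval_forPath (hF : Emits x n e F) (h : ρ 1 = n) {u : Tm} {i j : ℕ} (hi : ρ 10 = i)
    (hu : u.eval x ρ = j) : (forPath u e).eval x ρ = (path n j i).flatMap F := by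
  simp only [forPath, Em.eval, path, List.flatMap_cons, List.flatMap_append, List.flatMap_nil,
    List.append_nil, List.flatMap_assoc]
  refine congrArg₂ (· ++ ·) ?_ (congrArg₂ (· ++ ·) ?_ ?_)
  · refine hF.eval_withPair h ?_ fun a => ?_
    · rw [eval_times _ _ h, hu]
    · rw [eval_times (n := n) _ _ (by simp [h])]
      rfl
  · rw [eval_times _ _ h]
    refine List.flatMap_congr fun t _ => ?_
    have h' : Function.update ρ 12 t 1 = n := by simp [h]
    refine hF.eval_withPair h' ?_ fun a => ?_
    · rw [eval_times _ _ h']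
      simp [Tm.eval]
    · rw [eval_times (n := n) _ _ (by simp [h])]
      simp [Tm.eval, add_assoc]
  · refine hF.eval_withPair h ?_ fun a => ?_
    · rw [eval_times _ _ h, eval_times _ _ h]
      rfl
    · simp [Tm.eval, hi]

theorem Emits.eval_forPairs (hF : Emits x n e F) (h : ρ 1 = n) {g : ℕ → ℕ → ℕ}
    (hg : ∀ ρ' : ℕ → ℕ, ρ' 1 = n → ρ' 2 = ρ 2 → ρ' 10 < n → ρ' 11 < n →
      cellTm.eval x ρ' = g (ρ' 10) (ρ' 11)) :
    (forPairs e).eval x ρ = (pairs n g ++ List.replicate (ρ 5) (0, 5 * n + 1)).flatMap F := by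
  simp only [forPairs, Em.eval, pairs, List.flatMap_append, List.flatMap_assoc, List.append_assoc,
    Tm.eval, h]
  refine congrArg₂ (· ++ ·) ?_ (congrArg₂ (· ++ ·) ?_ ?_)
  · refine List.flatMap_congr fun i hi => ?_
    simp only [Function.update_apply, Nat.reduceEqDiff, reduceIte, h]
    refine List.flatMap_congr fun j hj => ?_
    rw [List.mem_range] at hi hj
    rw [hg _ (by simp [h]) (by simp) (by simpa using hi) (by simpa using hj)]
    simp only [Function.update_apply, Nat.reduceEqDiff, reduceIte, eval_eq, Tm.eval]
    obtain ⟨ρ', hρ'⟩ : ∃ ρ', ρ' = Function.update (Function.update (Function.update ρ 10 i) 11 j) 14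
      (g i j) := ⟨_, rfl⟩
    have h1 : ρ' 1 = n := by simp [hρ', h]
    have h10 : ρ' 10 = i := by simp [hρ']
    have h11 : ρ' 11 = j := by simp [hρ']
    rw [← hρ', cell]
    have e1 : (withPair (var 10) (times 1 (var 10)) e).eval x ρ' = F (i, n + i) := by
      refine hF.eval_withPair h1 h10 fun a => ?_
      rw [eval_times (n := n) _ _ (by simp [h1])]
      simp [Tm.eval, h10]
    have e2 : (withPair (times 1 (var 10)) (times 2 (var 11)) e).eval x ρ' = F (n + i, 2 * n + j) := by
      refine hF.eval_withPair h1 ?_ fun a => ?_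
      · rw [eval_times _ _ h1]
        simp [Tm.eval, h10]
      · rw [eval_times (n := n) _ _ (by simp [h1])]
        simp [Tm.eval, h11]
    have e3 : (withPair (var 10) (times 2 (var 11)) e).eval x ρ' = F (i, 2 * n + j) := by
      refine hF.eval_withPair h1 h10 fun a => ?_
      rw [eval_times (n := n) _ _ (by simp [h1])]
      simp [Tm.eval, h11]
    rw [e1, e2, e3, hF.eval_forPath h1 (u := var 11) h10 h11]
    by_cases h3 : g i j = 0
    · simp [h3]
    · by_cases h4 : g i j = 2 <;> simp [h3, h4]
  · refine List.flatMap_congr fun i _ => ?_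
    exact hF.eval_forPath (by simp [h]) (by simp) (by simp [Tm.eval])
  · have h1 : ∀ t, (withPair (const 0) (times 5 (const 1)) e).eval x (Function.update ρ 13 t) =
        F (0, 5 * n + 1) := fun t => by
      refine hF.eval_withPair (by simp [h]) rfl fun a => ?_
      rw [eval_times (n := n) _ _ (by simp [h])]
      rfl
    simp only [h1]
    rw [List.flatMap_def, List.flatMap_def, List.map_const', List.length_range, List.map_replicate]

end

/-- Emit the vote for the pair in the variables `20` and `21`. -/
def emitVote : Em :=
  (symbol Γ'.bra).seq ((unary (var 20)).seq ((loop 22 (times 5 (const 2))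
    (ite (and (not (eq (var 22) (var 20))) (not (eq (var 22) (var 21)))) (unary (var 22)) skip)).seq
  ((unary (var 21)).seq (symbol Γ'.ket))))

/-- Emit the election, with the numbers of votes and candidates. -/
def emitElection : Em :=
  (unary (times 5 (const 2))).seq (((forPairs (symbol (Γ'.bit true))).seq (symbol Γ'.comma)).seq
  ((unary (times 5 (const 1))).seq (forPairs emitVote)))

/-- The election of a bipartite graph, with additional votes that rank the preferred candidate last. -/
def election (n : ℕ) (g : ℕ → ℕ → ℕ) (w : ℕ) : Election :=
  .ofPairs (5 * n + 2) (5 * n + 1) (Nat.lt_succ_self _)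
    (pairs n g ++ List.replicate w (0, 5 * n + 1))

theorem emits_emitVote (x : List Γ') (n : ℕ) : Emits x n emitVote fun q =>
    (Γ'.bra :: (encodeUnary q.1 ++ ((List.range (5 * n + 2)).flatMap (fun c =>
      if c ≠ q.1 ∧ c ≠ q.2 then encodeUnary c else []) ++ (encodeUnary q.2 ++ [Γ'.ket])))).map some := by
  intro ρ h
  simp only [emitVote, Em.eval, eval_symbol, eval_unary, eval_times _ _ h, eval_and, eval_not, eval_eq,
    Tm.eval, Function.update_apply, Nat.reduceEqDiff, reduceIte, List.map_cons, List.map_append,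
    List.map_flatMap, List.map_nil, List.cons_append, List.nil_append]
  congr 3
  refine List.flatMap_congr fun c _ => ?_
  by_cases h1 : c = ρ 20 <;> by_cases h2 : c = ρ 21 <;> simp [h1, h2]

theorem eval_emitElection {x : List Γ'} {n : ℕ} {ρ : ℕ → ℕ} (h : ρ 1 = n) {g : ℕ → ℕ → ℕ}
    (hg : ∀ ρ' : ℕ → ℕ, ρ' 1 = n → ρ' 2 = ρ 2 → ρ' 10 < n → ρ' 11 < n →
      cellTm.eval x ρ' = g (ρ' 10) (ρ' 11)) :
    emitElection.eval x ρ = (encodeElection (election n g (ρ 5))).map some := by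
  have h1 : Emits x n (symbol (Γ'.bit true)) fun _ => [some (Γ'.bit true)] := fun _ _ => rfl
  obtain ⟨L, hL⟩ : ∃ L, L = pairs n g ++ List.replicate (ρ 5) (0, 5 * n + 1) := ⟨_, rfl⟩
  have hv : ValidPairs (5 * n + 2) L := by
    intro q hq
    rw [hL, List.mem_append] at hq
    rcases hq with hq | hq
    · exact validPairs n g q hq
    · rw [List.eq_of_mem_replicate hq]
      simp only
      omega
  have h2 : encodeElection (election n g (ρ 5)) = encodeUnary (5 * n + 2) ++ (encodeUnary L.length ++
      (encodeUnary (5 * n + 1) ++ L.flatMap fun q => encodeVote (pairVote (5 * n + 2) q.1 q.2))) := by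
    rw [← concat_getElem L fun q => encodeVote (pairVote (5 * n + 2) q.1 q.2), hL]
    rfl
  simp only [emitElection, Em.eval, eval_unary, eval_times _ _ h, h1.eval_forPairs h hg,
    (emits_emitVote x n).eval_forPairs h hg, eval_symbol, h2, ← hL, List.map_append, List.map_flatMap,
    Tm.eval]
  refine congrArg₂ (· ++ ·) rfl (congrArg₂ (· ++ ·) ?_ (congrArg₂ (· ++ ·) rfl ?_))
  · simp only [encodeUnary, List.map_append, List.map_replicate, List.map_cons, List.map_nil]
    rw [List.flatMap_def, List.map_const']
    simp
  · refine List.flatMap_congr fun q hq => ?_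
    obtain ⟨h3, h4, h5⟩ := hv q hq
    rw [encodeVote_pairVote h3 h4 h5]

/-- The letter test for `Γ'.bit true` is added twice and that for `Γ'.bit false` once, so red edges
give `2`, other edges `1`, and blanks `0`. -/
theorem eval_cellTm (I : MatchingInstance) (hb : I.b = I.a) (ρ : ℕ → ℕ) (h1 : ρ 1 = I.a)
    (h2 : ρ 2 = (encodeNat I.k).length + 1 + (I.a + 1) + (I.a + 1)) (h10 : ρ 10 < I.a)
    (h11 : ρ 11 < I.a) : cellTm.eval (encodeMatching I) ρ = I.entry (ρ 10) (ρ 11) := by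
  have h := getElem?_encodeMatching I ⟨ρ 10, h10⟩ ⟨ρ 11, hb ▸ h11⟩
  have hpos : Tm.eval (encodeMatching I) (add (var 2) (add (mul (var 10) (add (var 1) (const 2)))
      (add (var 11) (const 1)))) ρ = (encodeNat I.k).length + 1 + (I.a + 1) + (I.b + 1) +
      (ρ 10 * (I.b + 2) + (ρ 11 + 1)) := by
    simp [Tm.eval, eval_mul, h1, h2, hb]
  rw [cellTm, Tm.eval, hpos]
  simp only [Tm.eval, Function.update_self, h, Option.some.injEq]
  have h3 : I.entry (ρ 10) (ρ 11) = 0 ∨ I.entry (ρ 10) (ρ 11) = 1 ∨ I.entry (ρ 10) (ρ 11) = 2 := by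
    unfold MatchingInstance.entry
    split_ifs <;> simp
  rcases h3 with h3 | h3 | h3 <;> simp [h3, entrySymbol]

/-- Run a program if the number of red edges is possible. The variable `4` holds this number. -/
def guarded (e : Em) : Em :=
  letIn 1 (block (const 1)) (ite (eq (block (const 2)) (var 1))
    (ite (lePrefix (add (var 1) (const 1))) skip
      (letIn 2 (add prefixLength (add (const 3) (add (var 1) (var 1))))
        (letIn 4 (sum 6 (var 1) (lePrefix (add (var 6) (const 1)))) e))) skip)

/-- The guard ensures that `e` runs only with `k ≤ a`, where a unary copy of `k` is affordable. In
all other cases nothing is emitted, which encodes the empty list of instances. -/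
theorem eval_guarded (I : MatchingInstance) (e : Em) {s : List Sym}
    (h : I.b = I.a → ∀ ρ : ℕ → ℕ, ρ 1 = I.a →
      ρ 2 = (encodeNat I.k).length + 1 + (I.a + 1) + (I.a + 1) → ρ 4 = I.k →
      e.eval (encodeMatching I) ρ = s) :
    (guarded e).eval (encodeMatching I) (fun _ => 0) =
      if I.b = I.a ∧ I.k ≤ I.a then s else [] := by
  obtain ⟨h1, h2⟩ := blockLength_encodeMatching I
  obtain ⟨y, hy⟩ : ∃ y, encodeMatching I = encodeBinary I.k ++ y := ⟨_, rfl⟩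
  rw [hy] at h h1 h2 ⊢
  simp only [guarded, Em.eval, eval_block, Tm.eval, h1, h2, eval_eq, eval_lePrefix, eval_prefixLength,
    Function.update_apply, Nat.reduceEqDiff, reduceIte]
  by_cases hb : I.b = I.a
  · by_cases hk : I.k ≤ I.a
    -- The binary `k` is converted to unary by counting the positive numbers up to `a` that are at
    -- most `k`.
    · have h3 : ∑ i ∈ Finset.range I.a, (if i + 1 ≤ I.k then 1 else 0) = I.k := by
        rw [Finset.sum_range]
        exact VoteGraph.sum_fin_lt hk
      rw [if_neg (by simp [hb]), if_pos (by rw [if_neg (by omega)]), if_pos ⟨hb, hk⟩]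
      refine h hb _ (by simp) ?_ (by simpa using h3)
      simp
      ring
    · rw [if_neg (by simp [hb]), if_neg (by rw [if_pos (by omega)]; simp), if_neg (by tauto)]
  · rw [if_pos (by simp [hb]), if_neg (by tauto)]

end BipartiteElection

/-! ### The reductions from exact perfect bipartite matching -/

namespace MatchingInstance

open Tm Em BipartiteElection

/-- The instances of manipulation for a matching instance. -/
def manipulations (I : MatchingInstance) : List ManipulationInstance :=
  if I.b = I.a ∧ I.k ≤ I.a then [⟨election I.a I.entry 0, I.a + I.k⟩] else []

/-- The instances of bribery for a matching instance. -/
def briberies (I : MatchingInstance) : List BriberyInstance :=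
  if I.b = I.a ∧ I.k ≤ I.a then [⟨election I.a I.entry (I.a + I.k), I.a + I.k⟩] else []

theorem nonempty_computable_manipulations : Nonempty (TM2ComputableInPolyTime
    exactPerfectBipartiteMatching.encode (conformantManipulation firstLast).encodeList
      manipulations) := by
  refine Em.nonempty_computableInPolyTime (guarded (letIn 5 (const 0)
    ((unary (add (var 1) (var 4))).seq (emitElection.seq (emit none))))) fun I => ?_
  refine (eval_guarded I _ fun hb ρ h1 h2 h4 => ?_).trans
    (b := if I.b = I.a ∧ I.k ≤ I.a then (encodeUnary (I.a + I.k) ++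
      encodeElection (election I.a I.entry 0)).map some ++ [none] else []) ?_
  · simp only [Em.eval, eval_unary, Tm.eval]
    rw [eval_emitElection (n := I.a) (g := I.entry) (by simp [h1]) fun ρ' h1' h2' => ?_]
    · simp [h1, h4]
    · exact eval_cellTm I hb ρ' h1' (by simp [h2', h2])
  · unfold manipulations
    split_ifs
    · exact (List.append_nil _).symm
    · rfl

theorem nonempty_computable_briberies : Nonempty (TM2ComputableInPolyTime
    exactPerfectBipartiteMatching.encode (conformantBribery firstLast).encodeList
      briberies) := by
  refine Em.nonempty_computableInPolyTime (guarded (letIn 5 (add (var 1) (var 4))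
    ((binary (var 5)).seq (emitElection.seq (emit none))))) fun I => ?_
  refine (eval_guarded I _ fun hb ρ h1 h2 h4 => ?_).trans
    (b := if I.b = I.a ∧ I.k ≤ I.a then (encodeBinary (I.a + I.k) ++
      encodeElection (election I.a I.entry (I.a + I.k))).map some ++ [none] else []) ?_
  · simp only [Em.eval, eval_binary, Tm.eval]
    rw [eval_emitElection (n := I.a) (g := I.entry) (by simp [h1]) fun ρ' h1' h2' => ?_]
    · simp [h1, h4]
    · exact eval_cellTm I hb ρ' h1' (by simp [h2', h2])
  · unfold briberies
    split_ifs
    · exact (List.append_nil _).symm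
    · rfl

/-- If a side condition fails, there is no matching, and the empty list contains no yes-instance. -/
theorem hasExactMatching_iff_manipulations (I : MatchingInstance) :
    HasExactMatching I ↔ ∃ J ∈ I.manipulations, CanManipulate firstLast J := by
  rw [hasExactMatching_iff_perm, manipulations]
  split_ifs with h
  · rw [← balanced_iff h.2]
    simp only [h, and_self, true_and, List.mem_singleton, exists_eq_left, election,
      List.replicate_zero, List.append_nil]
    exact (canManipulate_ofPairs _ (validPairs _ _) fun q hq => (ne_of_mem_pairs q hq).1).symm
  · simp [h]

theorem hasExactMatching_iff_briberies (I : MatchingInstance) :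
    HasExactMatching I ↔ ∃ J ∈ I.briberies, CanBribe firstLast J := by
  rw [hasExactMatching_iff_perm, briberies]
  split_ifs with h
  · rw [← balanced_iff h.2]
    simp only [h, and_self, true_and, List.mem_singleton, exists_eq_left, election]
    exact (canBribe_ofPairs _ (Nat.succ_pos _) (validPairs _ _) ne_of_mem_pairs).symm
  · simp [h]

end MatchingInstance

theorem dttReducible_matching_manipulation :
    DTTReducible exactPerfectBipartiteMatching (conformantManipulation firstLast) :=
  ⟨_, MatchingInstance.nonempty_computable_manipulations,
    MatchingInstance.hasExactMatching_iff_manipulations⟩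

theorem dttReducible_matching_bribery :
    DTTReducible exactPerfectBipartiteMatching (conformantBribery firstLast) :=
  ⟨_, MatchingInstance.nonempty_computable_briberies,
    MatchingInstance.hasExactMatching_iff_briberies⟩

end ConformantVoting

theorem mainTheorem12 :
    ConformantVoting.DTTEquivalent
      (ConformantVoting.conformantManipulation ConformantVoting.firstLast)
      ConformantVoting.exactPerfectBipartiteMatching ∧
    ConformantVoting.DTTEquivalent
      (ConformantVoting.conformantBribery ConformantVoting.firstLast)
      ConformantVoting.exactPerfectBipartiteMatching := by
  exact ⟨⟨ConformantVoting.dttReducible_manipulation_matching,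
    ConformantVoting.dttReducible_matching_manipulation⟩,
    ConformantVoting.dttReducible_bribery_matching, ConformantVoting.dttReducible_matching_bribery⟩
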